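/- **Setting.** Let $G$ be a real Lie group with semisimple Lie algebra $\mathfrak g=\mathfrak g_{-r}\oplus\dots\oplus\mathfrak g_r$, graded so that $[\mathfrak g_i,\mathfrak g_j]\subset\mathfrak g_{i+j}$ and $\mathfrak g_1$ generates $\mathfrak p_+=\mathfrak g_1\oplus\dots\oplus\mathfrak g_r$. Put $\mathfrak g^i=\bigoplus_{j\ge i}\mathfrak g_j$ and $\mathfrak g_-=\bigoplus_{j<0}\mathfrak g_j$, let $B$ be the Killing form, and let $E\in\mathfrak g$ be the grading element, so that $[E,X]=iX$ for $X\in\mathfrak g_i$. Let $P\subset G$ be a parabolic subgroup corresponding to the grading, i.e. a closed Lie subgroup with Lie algebra $\mathfrak p=\mathfrak g^0$ such that $\mathrm{Ad}(P)$ preserves every $\mathfrak g^i$. Let $(p:\mathcal G\to M,\omega)$ be a parabolic geometry of type $(G,P)$, i.e. a smooth principal $P$-bundle with a Cartan connection $\omega\in\Omega^1(\mathcal G,\mathfrak g)$. Sections of a natural bundle $\mathcal G\times_P W$ are identified with smooth $P$-equivariant functions $\sigma:\mathcal G\to W$, where equivariant means $\sigma(u\cdot h)=h^{-1}\cdot\sigma(u)$.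 The fundamental derivative $D\sigma:\mathcal G\to\mathfrak g^*\otimes W$ is $D\sigma(u)(X)=d\sigma(u)\bigl(\omega_u^{-1}(X)\bigr)$. The curved Casimir operator is $\mathcal C=(B\otimes\mathrm{id})\circ D^2$, i.e. $\mathcal C\sigma=\sum_\ell D^2\sigma(\xi_\ell,\xi^\ell)$ for bases $(\xi_\ell)$, $(\xi^\ell)$ of $\mathfrak g$ that are dual with respect to $B$. Let $V$ be a finite-dimensional irreducible (real or complex) smooth representation of $G$ and $VM=\mathcal G\times_PV$ the corresponding tractor bundle. Let $c_0\in\mathbb R$ be the eigenvalue on $V$ of the Casimir operator $\sum_\ell \xi_\ell\,\xi^\ell$ of $\mathfrak g$. Since $T^*M\cong\mathcal G\times_P\mathfrak p_+$, we have $\Omega^k(M,VM)=\Gamma\bigl(\mathcal G\times_P(\Lambda^k\mathfrak p_+\otimes V)\bigr)$. Call $Z_1\wedge\dots\wedge Z_k\otimes v$ with $Z_j\in\mathfrak g_{n_j}$ and $Ev=bv$ homogeneous of degree $n_1+\dots+n_k+b\in\mathbb R$. For $a\in\mathbb R$ let $F^{\ge a}$, respectively $F^{>a}$, be the span of the homogeneous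 elements of $\Lambda^k\mathfrak p_+\otimes V$ of degree $\ge a$, respectively $>a$. These subspaces induce the natural filtration of $\Lambda^kT^*M\otimes VM$, with associated graded components induced by $F^{\ge a}/F^{>a}$. Let $\partial^*:\Lambda^{k}\mathfrak p_+\otimes V\to\Lambda^{k-1}\mathfrak p_+\otimes V$ be the Lie algebra homology differential of $\mathfrak p_+$ (zero for $k=0$), $$\partial^*(Z_1\wedge\dots\wedge Z_k\otimes v)=\sum_i(-1)^iZ_1\wedge\dots\widehat{Z_i}\dots\wedge Z_k\otimes Z_iv+\sum_{i<j}(-1)^{i+j}[Z_i,Z_j]\wedge Z_1\wedge\dots\widehat{Z_i}\dots\widehat{Z_j}\dots\wedge Z_k\otimes v .$$ Let $\partial:\Lambda^{k}\mathfrak p_+\otimes V\to\Lambda^{k+1}\mathfrak p_+\otimes V$ be the Lie algebra cohomology differential of $\mathfrak g_-$ with coefficients in $V$, where $\Lambda^k\mathfrak p_+\otimes V$ is identified with the space of alternating $k$-linear maps $\mathfrak g_-^k\to V$ through the isomorphism $\mathfrak p_+\cong\mathfrak g_-^*$ given by $B$, with $Z_1\wedge\dots\wedge Z_k\otimes v$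 corresponding to $(X_1,\dots,X_k)\mapsto\det\bigl(B(Z_j,X_i)\bigr)v$. The Kostant Laplacian is $\square=\partial\partial^*+\partial^*\partial$. **Lemma 4.3.** For every $k\ge 0$, the action of $\mathcal C$ on $\Omega^k(M,VM)$ is compatible with the natural filtration of $\Lambda^kT^*M\otimes VM$, and on the sections of the associated graded bundle it induces $2\square+c_0$. That is, for every $a\in\mathbb R$: 1. $\mathcal C$ maps sections with values in $F^{\ge a}$ to sections with values in $F^{\ge a}$, and sections with values in $F^{>a}$ to sections with values in $F^{>a}$; 2. $\square(F^{\ge a})\subset F^{\ge a}$ and $\square(F^{>a})\subset F^{>a}$, so $\square$ acts on the associated graded; 3. for every section $\sigma$ with values in $F^{\ge a}$ and every $u\in\mathcal G$, $\;\mathcal C\sigma(u)-\bigl(2\,\square(\sigma(u))+c_0\,\sigma(u)\bigr)\in F^{>a}$. -/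

import Mathlib

open scoped Manifold ContDiff TensorProduct

noncomputable section

namespace CurvedCasimir

/-! ### Graded semisimple Lie algebras -/

section Algebra

variable {𝔤 : Type*} [LieRing 𝔤] [LieAlgebra ℝ 𝔤]

/-- A grading `𝔤 = 𝔤_{-k} ⊕ ⋯ ⊕ 𝔤_k` of a Lie algebra such that `𝔤_1` generates
`𝔤_1 ⊕ ⋯ ⊕ 𝔤_k`. -/
structure ParabolicGrading (𝔤 : Type*) [LieRing 𝔤] [LieAlgebra ℝ 𝔤] where
  /-- the component `𝔤_i` -/
  comp : ℤ → Submodule ℝ 𝔤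
  isInternal : DirectSum.IsInternal comp
  lie_mem : ∀ {i j : ℤ} {X Y : 𝔤}, X ∈ comp i → Y ∈ comp j → ⁅X, Y⁆ ∈ comp (i + j)
  bounded : ∃ k : ℕ, ∀ i : ℤ, (k : ℤ) < |i| → comp i = ⊥
  generated : (LieSubalgebra.lieSpan ℝ 𝔤 (comp 1 : Set 𝔤)).toSubmodule = ⨆ j ≥ (1 : ℤ), comp j

namespace ParabolicGrading

variable (g : ParabolicGrading 𝔤)

/-- The filtration component `𝔤^i = 𝔤_i ⊕ ⋯ ⊕ 𝔤_k`. -/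
def filt (i : ℤ) : Submodule ℝ 𝔤 := ⨆ j ≥ i, g.comp j

/-- The span of the components whose degree lies in a set closed under addition is a
subalgebra. -/
def subalgebraOf (S : AddSubsemigroup ℤ) : LieSubalgebra ℝ 𝔤 where
  toSubmodule := ⨆ j ∈ S, g.comp j
  lie_mem' := by
    intro X Y hX hY
    change X ∈ ⨆ j ∈ S, g.comp j at hX
    change Y ∈ ⨆ j ∈ S, g.comp j at hY
    change ⁅X, Y⁆ ∈ ⨆ j ∈ S, g.comp j
    rw [iSup_subtype'] at hX hY
    induction hX using Submodule.iSup_induction' with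
    | zero => simp
    | add x y _ _ hx hy => rw [add_lie]; exact add_mem hx hy
    | mem i x hx =>
      induction hY using Submodule.iSup_induction' with
      | zero => simp
      | add x y _ _ hx hy => rw [lie_add]; exact add_mem hx hy
      | mem j y hy =>
        exact Submodule.mem_iSup_of_mem (i.1 + j.1)
          (Submodule.mem_iSup_of_mem (S.add_mem i.2 j.2) (g.lie_mem hx hy))

/-- `𝔭₊ = 𝔤_1 ⊕ ⋯ ⊕ 𝔤_k`. -/
def pPlus : LieSubalgebra ℝ 𝔤 :=
  g.subalgebraOf ⟨{i | 1 ≤ i}, fun {a b} ha hb => by simp only [Set.mem_ofPred_eq] at *; omega⟩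

/-- `𝔤₋ = 𝔤_{-k} ⊕ ⋯ ⊕ 𝔤_{-1}`. -/
def gMinus : LieSubalgebra ℝ 𝔤 :=
  g.subalgebraOf ⟨{i | i < 0}, fun {a b} ha hb => by simp only [Set.mem_ofPred_eq] at *; omega⟩

lemma mem_pPlus_iff {X : 𝔤} : X ∈ g.pPlus ↔ X ∈ g.filt 1 := Iff.rfl

lemma comp_le_pPlus {i : ℤ} (hi : 1 ≤ i) : g.comp i ≤ g.pPlus.toSubmodule :=
  le_iSup₂_of_le (f := fun j (_ : j ∈ {i : ℤ | 1 ≤ i}) => g.comp j) i hi le_rfl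

lemma comp_le_gMinus {i : ℤ} (hi : i < 0) : g.comp i ≤ g.gMinus.toSubmodule :=
  le_iSup₂_of_le (f := fun j (_ : j ∈ {i : ℤ | i < 0}) => g.comp j) i hi le_rfl

/-- The linear map acting on `𝔤_i` as multiplication by `i`. -/
def degreeMap : 𝔤 →ₗ[ℝ] 𝔤 :=
  DirectSum.toModule ℝ ℤ 𝔤 (fun i => (i : ℝ) • (g.comp i).subtype) ∘ₗ
    (LinearEquiv.ofBijective (DirectSum.coeLinearMap g.comp) g.isInternal).symm.toLinearMap

lemma degreeMap_of_mem {i : ℤ} {X : 𝔤} (hX : X ∈ g.comp i) : g.degreeMap X = (i : ℝ) • X := by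
  have h : (LinearEquiv.ofBijective (DirectSum.coeLinearMap g.comp) g.isInternal).symm X
      = DirectSum.lof ℝ ℤ (fun i => g.comp i) i ⟨X, hX⟩ := by
    rw [LinearEquiv.symm_apply_eq]
    exact (DirectSum.coeLinearMap_lof g.comp i ⟨X, hX⟩).symm
  simp only [degreeMap, LinearMap.comp_apply, LinearEquiv.coe_coe, h, DirectSum.toModule_lof]
  rfl

lemma iSup_comp : ⨆ i, g.comp i = ⊤ := g.isInternal.submodule_iSup_eq_top

/-- Induction over homogeneous elements. -/
lemma induction_homogeneous {p : 𝔤 → Prop} (h0 : p 0) (hadd : ∀ x y, p x → p y → p (x + y))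
    (hmem : ∀ i, ∀ x ∈ g.comp i, p x) (x : 𝔤) : p x :=
  Submodule.iSup_induction g.comp (motive := p) (by rw [g.iSup_comp]; trivial) hmem h0 hadd

lemma degreeMap_lie (X Y : 𝔤) :
    g.degreeMap ⁅X, Y⁆ = ⁅X, g.degreeMap Y⁆ - ⁅Y, g.degreeMap X⁆ := by
  induction X using g.induction_homogeneous with
  | h0 => simp
  | hadd x y hx hy => simp only [add_lie, map_add, lie_add, hx, hy]; abel
  | hmem i x hx =>
    induction Y using g.induction_homogeneous with
    | h0 => simp
    | hadd x y hx hy => simp only [add_lie, map_add, lie_add, hx, hy]; abel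
    | hmem j y hy =>
      rw [g.degreeMap_of_mem (g.lie_mem hx hy), g.degreeMap_of_mem hx, g.degreeMap_of_mem hy,
        lie_smul, lie_smul, ← lie_skew x y]
      push_cast
      module

/-- The pairing of `𝔭₊` and `𝔤₋` by the Killing form. -/
def killingPairing : g.pPlus →ₗ[ℝ] g.gMinus →ₗ[ℝ] ℝ :=
  (killingForm ℝ 𝔤).compl₁₂ g.pPlus.toSubmodule.subtype g.gMinus.toSubmodule.subtype

lemma killingPairing_apply (Z : g.pPlus) (X : g.gMinus) :
    g.killingPairing Z X = killingForm ℝ 𝔤 (Z : 𝔤) (X : 𝔤) := rfl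

variable [FiniteDimensional ℝ 𝔤] [LieAlgebra.IsKilling ℝ 𝔤]

/-- The grading element exists because every derivation of a semisimple Lie algebra is inner. -/
lemma exists_gradingElement : ∃ E : 𝔤, ∀ i, ∀ X ∈ g.comp i, ⁅E, X⁆ = (i : ℝ) • X := by
  obtain ⟨E, hE⟩ := LieDerivation.IsKilling.exists_eq_ad
    (⟨g.degreeMap, g.degreeMap_lie⟩ : LieDerivation ℝ 𝔤 𝔤)
  refine ⟨E, fun i X hX => ?_⟩
  have h := congrArg (fun D : LieDerivation ℝ 𝔤 𝔤 => D X) hE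
  refine Eq.trans ?_ (h.trans (g.degreeMap_of_mem hX))
  simp

/-- The grading element `E`, characterised by `[E, X] = i X` for `X ∈ 𝔤_i`. -/
def gradingElement : 𝔤 := g.exists_gradingElement.choose

lemma gradingElement_lie {i : ℤ} {X : 𝔤} (hX : X ∈ g.comp i) :
    ⁅g.gradingElement, X⁆ = (i : ℝ) • X :=
  g.exists_gradingElement.choose_spec i X hX

lemma killingForm_comp_eq_zero {i j : ℤ} (hij : i + j ≠ 0) {X Y : 𝔤} (hX : X ∈ g.comp i)
    (hY : Y ∈ g.comp j) : killingForm ℝ 𝔤 X Y = 0 := by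
  have h := LieModule.traceForm_apply_lie_apply ℝ 𝔤 𝔤 X g.gradingElement Y
  rw [g.gradingElement_lie hY, ← lie_skew, g.gradingElement_lie hX] at h
  simp only [map_neg, map_smul, LinearMap.neg_apply, LinearMap.smul_apply, smul_eq_mul] at h
  have h2 : ((i + j : ℤ) : ℝ) * killingForm ℝ 𝔤 X Y = 0 := by
    push_cast
    change -((i : ℝ) * killingForm ℝ 𝔤 X Y) = (j : ℝ) * killingForm ℝ 𝔤 X Y at h
    linarith
  exact (mul_eq_zero.mp h2).resolve_left (by exact_mod_cast hij)

lemma killingForm_eq_zero_of_mem {S : AddSubsemigroup ℤ} {j : ℤ} (hS : ∀ i ∈ S, i + j ≠ 0)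
    {X Y : 𝔤} (hX : X ∈ g.subalgebraOf S) (hY : Y ∈ g.comp j) : killingForm ℝ 𝔤 X Y = 0 := by
  change X ∈ ⨆ j ∈ S, g.comp j at hX
  rw [iSup_subtype'] at hX
  induction hX using Submodule.iSup_induction' with
  | zero => simp
  | add x y _ _ hx hy => rw [map_add, LinearMap.add_apply, hx, hy, add_zero]
  | mem i x hx => exact g.killingForm_comp_eq_zero (hS i.1 i.2) hx hY

instance isPerfPair_killingPairing : g.killingPairing.IsPerfPair := by
  have hker : ∀ X : 𝔤, (∀ Y, killingForm ℝ 𝔤 X Y = 0) → X = 0 := by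
    intro X h
    have : X ∈ LinearMap.ker (killingForm ℝ 𝔤) := by
      rw [LinearMap.mem_ker]; ext Y; exact h Y
    rwa [LieAlgebra.IsKilling.ker_killingForm_eq_bot, Submodule.mem_bot] at this
  refine LinearMap.IsPerfPair.of_injective ?_ ?_
  · rw [injective_iff_map_eq_zero]
    intro Z hZ
    refine Subtype.ext (hker _ fun Y => ?_)
    induction Y using g.induction_homogeneous with
    | h0 => simp
    | hadd x y hx hy => rw [map_add, hx, hy, add_zero]
    | hmem j y hy =>
      by_cases hj : j < 0
      · exact LinearMap.congr_fun hZ ⟨y, g.comp_le_gMinus hj hy⟩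
      · exact g.killingForm_eq_zero_of_mem (by
          intro i (hi : 1 ≤ i); omega) Z.2 hy
  · rw [injective_iff_map_eq_zero]
    intro X hX
    refine Subtype.ext (hker _ fun Y => ?_)
    induction Y using g.induction_homogeneous with
    | h0 => simp
    | hadd x y hx hy => rw [map_add, hx, hy, add_zero]
    | hmem j y hy =>
      by_cases hj : 1 ≤ j
      · rw [LieModule.traceForm_comm]
        exact LinearMap.congr_fun hX ⟨y, g.comp_le_pPlus hj hy⟩
      · exact g.killingForm_eq_zero_of_mem (by
          intro i (hi : i < 0); omega) X.2 hy

/-- The isomorphism `𝔭₊ ≅ (𝔤₋)^*` induced by the Killing form. -/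
def killingEquiv : g.pPlus ≃ₗ[ℝ] Module.Dual ℝ g.gMinus := g.killingPairing.toPerfPair

end ParabolicGrading

end Algebra

/-! ### Lie algebra differentials -/

section Differentials

variable {L : Type*} [LieRing L] [LieAlgebra ℝ L]
variable {N : Type*} [AddCommGroup N] [Module ℝ N]

/-- The bracket of a Lie algebra as a bilinear map. -/
def lieBilin (L : Type*) [LieRing L] [LieAlgebra ℝ L] : L →ₗ[ℝ] L →ₗ[ℝ] L :=
  LinearMap.mk₂ ℝ (fun X Y => ⁅X, Y⁆) add_lie smul_lie lie_add lie_smul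

/-- `bracketSum β (X_0, …, X_{n+1}) =
  ∑_{i<j} (-1)^{i+j} β([X_i, X_j], X_0, …, X̂_i, …, X̂_j, …, X_{n+1})`,
see `bracketSum_apply`. -/
def bracketSum {n : ℕ} (β : L [⋀^Fin (n + 1)]→ₗ[ℝ] N) : L [⋀^Fin (n + 2)]→ₗ[ℝ] N :=
  (-(1 / 2) : ℝ) • AlternatingMap.alternatizeUncurryFin
    (AlternatingMap.alternatizeUncurryFinLM ∘ₗ
      (lieBilin L).compr₂ β.curryLeft)

/-- The pairs `i < j` of positions in `{0, …, n+1}` are written as `(i.castSucc, j.succ)` with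
`i ≤ j`, whence the exponent `i + j + 1`. -/
lemma bracketSum_apply {n : ℕ} (β : L [⋀^Fin (n + 1)]→ₗ[ℝ] N) (X : Fin (n + 2) → L) :
    bracketSum β X = ∑ i : Fin (n + 1), ∑ j ≥ i, (-1 : ℤ) ^ (i + j + 1 : ℕ) •
      β (Matrix.vecCons ⁅X i.castSucc, X j.succ⁆ (j.removeNth (i.castSucc.removeNth X))) := by
  rw [bracketSum, AlternatingMap.smul_apply,
    AlternatingMap.alternatizeUncurryFin_alternatizeUncurryFinLM_comp_apply, Finset.smul_sum]
  refine Finset.sum_congr rfl fun i _ => ?_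
  rw [Finset.smul_sum]
  refine Finset.sum_congr rfl fun j _ => ?_
  have h : ∀ (x y : L) (v : Fin n → L), (lieBilin L).compr₂ β.curryLeft x y v
      = β (Matrix.vecCons ⁅x, y⁆ v) := fun x y v => rfl
  have h' : ∀ (x y : L) (v : Fin n → L), β (Matrix.vecCons ⁅y, x⁆ v)
      = - β (Matrix.vecCons ⁅x, y⁆ v) := by
    intro x y v
    have := β.curryLeft.map_neg ⁅x, y⁆
    rw [lie_skew] at this
    exact congrArg (fun f => f v) this
  rw [h, h, h' (X i.castSucc) (X j.succ), pow_succ, sub_neg_eq_add, ← two_smul ℝ (β _),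
    smul_comm, smul_smul]
  norm_num

/-- `(X_0, …, X_n) ↦ ∑_i (-1)^i φ(X_i) (β (X_0, …, X̂_i, …, X_n))`. -/
def actionSum {n : ℕ} {N' : Type*} [AddCommGroup N'] [Module ℝ N']
    (φ : L →ₗ[ℝ] N →ₗ[ℝ] N') (β : L [⋀^Fin n]→ₗ[ℝ] N) : L [⋀^Fin (n + 1)]→ₗ[ℝ] N' :=
  AlternatingMap.alternatizeUncurryFin
    { toFun := fun X => (φ X).compAlternatingMap β
      map_add' := fun X Y => by ext; simp
      map_smul' := fun c X => by ext; simp }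

lemma actionSum_apply {n : ℕ} {N' : Type*} [AddCommGroup N'] [Module ℝ N']
    (φ : L →ₗ[ℝ] N →ₗ[ℝ] N') (β : L [⋀^Fin n]→ₗ[ℝ] N) (X : Fin (n + 1) → L) :
    actionSum φ β X = ∑ i : Fin (n + 1), (-1 : ℤ) ^ (i : ℕ) • φ (X i) (β (i.removeNth X)) := by
  rw [actionSum, AlternatingMap.alternatizeUncurryFin_apply]
  rfl

variable {V : Type*} [AddCommGroup V] [Module ℝ V]

/-- The Lie algebra cohomology (Chevalley–Eilenberg) differential
`C^k(L, V) → C^{k+1}(L, V)`. -/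
def cohomologyDifferential (θ : L →ₗ[ℝ] V →ₗ[ℝ] V) :
    (k : ℕ) → (L [⋀^Fin k]→ₗ[ℝ] V) →ₗ[ℝ] (L [⋀^Fin (k + 1)]→ₗ[ℝ] V)
  | 0 =>
    { toFun := fun α => actionSum θ α
      map_add' := fun α β => by ext X; simp [actionSum_apply]
      map_smul' := fun c α => by ext X; simp [actionSum_apply] }
  | _ + 1 =>
    { toFun := fun α => actionSum θ α + bracketSum α
      map_add' := fun α β => by
        ext X
        simp only [actionSum_apply, bracketSum_apply, AlternatingMap.add_apply, map_add, smul_add,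
          Finset.sum_add_distrib]
        abel
      map_smul' := fun c α => by
        ext X
        simp only [actionSum_apply, bracketSum_apply, AlternatingMap.add_apply, map_smul,
          AlternatingMap.smul_apply, RingHom.id_apply, smul_add, Finset.smul_sum, smul_comm c] }

/-- The space `Λ^k L ⊗ V`. -/
def Forms (L V : Type*) [LieRing L] [LieAlgebra ℝ L] [AddCommGroup V] [Module ℝ V] (k : ℕ) :=
  (⋀[ℝ]^k L) ⊗[ℝ] V

namespace Forms

instance instAddCommGroup (k : ℕ) : AddCommGroup (Forms L V k) :=
  inferInstanceAs (AddCommGroup ((⋀[ℝ]^k L) ⊗[ℝ] V))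

instance instModule (k : ℕ) : Module ℝ (Forms L V k) :=
  inferInstanceAs (Module ℝ ((⋀[ℝ]^k L) ⊗[ℝ] V))

instance instFinite [FiniteDimensional ℝ L] [FiniteDimensional ℝ V] (k : ℕ) :
    FiniteDimensional ℝ (Forms L V k) :=
  inferInstanceAs (Module.Finite ℝ ((⋀[ℝ]^k L) ⊗[ℝ] V))

variable (L V) in
/-- `Forms L V k` is by definition the tensor product `Λ^k L ⊗ V`. -/
def equivTensor (k : ℕ) : Forms L V k ≃ₗ[ℝ] (⋀[ℝ]^k L) ⊗[ℝ] V := LinearEquiv.refl ℝ _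

variable (V) in
/-- The alternating map `(X_1, …, X_k) ↦ (v ↦ X_1 ∧ ⋯ ∧ X_k ⊗ v)`. -/
def wedge (k : ℕ) : L [⋀^Fin k]→ₗ[ℝ] (V →ₗ[ℝ] Forms L V k) :=
  (TensorProduct.mk ℝ (⋀[ℝ]^k L) V).compAlternatingMap (exteriorPower.ιMulti ℝ k)

lemma wedge_apply (k : ℕ) (X : Fin k → L) (v : V) :
    wedge V k X v = (equivTensor L V k).symm (exteriorPower.ιMulti ℝ k X ⊗ₜ[ℝ] v) := rfl

/-- The linear map on `Λ^k L ⊗ V` induced by an alternating map. -/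
def lift {N : Type*} [AddCommGroup N] [Module ℝ N] {k : ℕ}
    (f : L [⋀^Fin k]→ₗ[ℝ] (V →ₗ[ℝ] N)) : Forms L V k →ₗ[ℝ] N :=
  TensorProduct.lift (exteriorPower.alternatingMapLinearEquiv f)

lemma lift_wedge {N : Type*} [AddCommGroup N] [Module ℝ N] {k : ℕ}
    (f : L [⋀^Fin k]→ₗ[ℝ] (V →ₗ[ℝ] N)) (X : Fin k → L) (v : V) :
    lift f (wedge V k X v) = f X v := by
  change TensorProduct.lift (exteriorPower.alternatingMapLinearEquiv f)
    (exteriorPower.ιMulti ℝ k X ⊗ₜ[ℝ] v) = f X v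
  rw [TensorProduct.lift.tmul, exteriorPower.alternatingMapLinearEquiv_apply_ιMulti]

/-- The map `Λ^k A ⊗ T` on `Λ^k L ⊗ V`. -/
def map (k : ℕ) (A : L →ₗ[ℝ] L) (T : V →ₗ[ℝ] V) : Forms L V k →ₗ[ℝ] Forms L V k :=
  TensorProduct.map (exteriorPower.map k A) T

end Forms

/-- The alternating map underlying the Lie algebra homology differential. -/
def homologyAlternating (θ : L →ₗ[ℝ] V →ₗ[ℝ] V) :
    (k : ℕ) → L [⋀^Fin (k + 1)]→ₗ[ℝ] (V →ₗ[ℝ] Forms L V k)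
  | 0 => -actionSum ((LinearMap.llcomp ℝ V V _).flip ∘ₗ θ) (Forms.wedge V 0)
  | k + 1 => -actionSum ((LinearMap.llcomp ℝ V V _).flip ∘ₗ θ) (Forms.wedge V (k + 1))
      + bracketSum (Forms.wedge V (k + 1))

/-- The Lie algebra homology differential `Λ^{k+1} L ⊗ V → Λ^k L ⊗ V`. With `X_1, …, X_{k+1}`
numbered from one it is
`X_1 ∧ ⋯ ∧ X_{k+1} ⊗ v ↦ ∑_i (-1)^i X_1 ∧ ⋯ X̂_i ⋯ ∧ X_{k+1} ⊗ X_i v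
  + ∑_{i<j} (-1)^{i+j} [X_i, X_j] ∧ X_1 ∧ ⋯ X̂_i ⋯ X̂_j ⋯ ∧ X_{k+1} ⊗ v`,
see `homologyDifferential_zero_wedge` and `homologyDifferential_succ_wedge`. -/
def homologyDifferential (θ : L →ₗ[ℝ] V →ₗ[ℝ] V) (k : ℕ) :
    Forms L V (k + 1) →ₗ[ℝ] Forms L V k :=
  Forms.lift (homologyAlternating θ k)

lemma homologyDifferential_zero_wedge (θ : L →ₗ[ℝ] V →ₗ[ℝ] V) (X : Fin 1 → L) (v : V) :
    homologyDifferential θ 0 (Forms.wedge V 1 X v) =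
      -Forms.wedge V 0 (Fin.removeNth 0 X) (θ (X 0) v) := by
  rw [homologyDifferential, Forms.lift_wedge, homologyAlternating]
  simp [actionSum_apply]

lemma homologyDifferential_succ_wedge (θ : L →ₗ[ℝ] V →ₗ[ℝ] V) (k : ℕ) (X : Fin (k + 2) → L)
    (v : V) :
    homologyDifferential θ (k + 1) (Forms.wedge V (k + 2) X v) =
      ∑ i : Fin (k + 2), (-1 : ℤ) ^ (i + 1 : ℕ) •
        Forms.wedge V (k + 1) (i.removeNth X) (θ (X i) v) +
      ∑ i : Fin (k + 1), ∑ j ≥ i, (-1 : ℤ) ^ (i + j + 1 : ℕ) •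
        Forms.wedge V (k + 1) (Matrix.vecCons ⁅X i.castSucc, X j.succ⁆
          (j.removeNth (i.castSucc.removeNth X))) v := by
  rw [homologyDifferential, Forms.lift_wedge, homologyAlternating, AlternatingMap.add_apply,
    AlternatingMap.neg_apply, actionSum_apply, bracketSum_apply]
  simp [LinearMap.sum_apply, pow_succ]

/-- The pairing `Λ^k(M^*) → (Λ^k M)^*` is an isomorphism for finite dimensional `M`. -/
lemma pairingDual_bijective (M : Type*) [AddCommGroup M] [Module ℝ M] [FiniteDimensional ℝ M]
    (k : ℕ) : Function.Bijective (exteriorPower.pairingDual ℝ M k) := by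
  have hsurj : Function.Surjective (exteriorPower.pairingDual ℝ M k) := by
    let b := Module.finBasis ℝ M
    rw [← LinearMap.range_eq_top, eq_top_iff, ← (b.exteriorPower k).dualBasis.span_eq,
      Submodule.span_le]
    rintro _ ⟨s, rfl⟩
    refine ⟨exteriorPower.ιMulti_family ℝ k b.coord s, ?_⟩
    rw [Module.Basis.coe_dualBasis]
    exact (exteriorPower.basis_coord ℝ k b s).symm
  have hdim : Module.finrank ℝ (⋀[ℝ]^k (Module.Dual ℝ M))
      = Module.finrank ℝ (Module.Dual ℝ (⋀[ℝ]^k M)) := by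
    rw [exteriorPower.finrank_eq, Subspace.dual_finrank_eq, Subspace.dual_finrank_eq,
      exteriorPower.finrank_eq]
  exact ⟨(LinearMap.injective_iff_surjective_of_finrank_eq_finrank hdim).mpr hsurj, hsurj⟩

/-- The isomorphism `Λ^k L ≅ (Λ^k M)^*` induced by an isomorphism `κ : L ≅ M^*`. -/
def exteriorDualEquiv {M : Type*} [AddCommGroup M] [Module ℝ M] [FiniteDimensional ℝ M]
    (κ : L ≃ₗ[ℝ] Module.Dual ℝ M) (k : ℕ) : (⋀[ℝ]^k L) ≃ₗ[ℝ] Module.Dual ℝ (⋀[ℝ]^k M) :=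
  LinearEquiv.ofBijective (exteriorPower.pairingDual ℝ M k ∘ₗ exteriorPower.map k κ.toLinearMap) <|
    (pairingDual_bijective M k).comp
      ⟨exteriorPower.map_injective κ.symm.toLinearMap (by simp),
        exteriorPower.map_surjective κ.surjective⟩

/-- For an isomorphism `κ : L ≅ M^*`, the induced isomorphism of `Λ^k L ⊗ V` with the space of
alternating `k`-linear maps on `M` with values in `V`, see `Forms.toAlternating_wedge`. -/
def Forms.toAlternating {M : Type*} [AddCommGroup M] [Module ℝ M] [FiniteDimensional ℝ M]
    (κ : L ≃ₗ[ℝ] Module.Dual ℝ M) (V : Type*) [AddCommGroup V] [Module ℝ V] (k : ℕ) :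
    Forms L V k ≃ₗ[ℝ] (M [⋀^Fin k]→ₗ[ℝ] V) :=
  (Forms.equivTensor L V k).trans <|
    (TensorProduct.congr (exteriorDualEquiv κ k) (LinearEquiv.refl ℝ V)).trans <|
      (dualTensorHomEquiv ℝ (⋀[ℝ]^k M) V).trans exteriorPower.alternatingMapLinearEquiv.symm

lemma Forms.toAlternating_wedge {M : Type*} [AddCommGroup M] [Module ℝ M] [FiniteDimensional ℝ M]
    (κ : L ≃ₗ[ℝ] Module.Dual ℝ M) (k : ℕ) (Z : Fin k → L) (v : V) (X : Fin k → M) :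
    Forms.toAlternating κ V k (Forms.wedge V k Z v) X =
      (Matrix.of fun i j => κ (Z j) (X i)).det • v := by
  rw [Forms.wedge_apply]
  simp [Forms.toAlternating, exteriorDualEquiv, exteriorPower.alternatingMapLinearEquiv_symm_apply]

end Differentials

/-! ### The Kostant Laplacian -/

section Kostant

variable {𝔤 : Type*} [LieRing 𝔤] [LieAlgebra ℝ 𝔤] [FiniteDimensional ℝ 𝔤]
  [LieAlgebra.IsKilling ℝ 𝔤] {V : Type*} [AddCommGroup V] [Module ℝ V]
  (g : ParabolicGrading 𝔤) (θ : 𝔤 →ₗ[ℝ] V →ₗ[ℝ] V)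

/-- A basis of `𝔤`. -/
def lieBasis (𝔤 : Type*) [LieRing 𝔤] [LieAlgebra ℝ 𝔤] [FiniteDimensional ℝ 𝔤] :
    Module.Basis (Fin (Module.finrank ℝ 𝔤)) ℝ 𝔤 := Module.finBasis ℝ 𝔤

/-- The basis of `𝔤` dual to `lieBasis 𝔤` with respect to the Killing form. -/
def lieDualBasis (𝔤 : Type*) [LieRing 𝔤] [LieAlgebra ℝ 𝔤] [FiniteDimensional ℝ 𝔤]
    [LieAlgebra.IsKilling ℝ 𝔤] : Module.Basis (Fin (Module.finrank ℝ 𝔤)) ℝ 𝔤 :=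
  LinearMap.BilinForm.dualBasis (killingForm ℝ 𝔤)
    (LieAlgebra.IsKilling.killingForm_nondegenerate ℝ 𝔤) (lieBasis 𝔤)

/-- The Casimir operator `v ↦ ∑_ℓ ξ^ℓ ξ_ℓ v`. -/
def casimir : Module.End ℝ V := ∑ ℓ, θ (lieBasis 𝔤 ℓ) ∘ₗ θ (lieDualBasis 𝔤 ℓ)

/-- The Kostant codifferential `∂^* : Λ^{k+1} 𝔭₊ ⊗ V → Λ^k 𝔭₊ ⊗ V`, i.e. the homology
differential of `𝔭₊` with coefficients in `V`. -/
def kostantCodifferential (k : ℕ) : Forms g.pPlus V (k + 1) →ₗ[ℝ] Forms g.pPlus V k :=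
  homologyDifferential (θ ∘ₗ g.pPlus.toSubmodule.subtype) k

/-- The Lie algebra cohomology differential `∂` of `𝔤₋` with coefficients in `V`, transported to
`Λ^k 𝔭₊ ⊗ V → Λ^{k+1} 𝔭₊ ⊗ V` through `𝔭₊ ≅ (𝔤₋)^*`. -/
def kostantDifferential (k : ℕ) : Forms g.pPlus V k →ₗ[ℝ] Forms g.pPlus V (k + 1) :=
  (Forms.toAlternating g.killingEquiv V (k + 1)).symm.toLinearMap ∘ₗ
    cohomologyDifferential (θ ∘ₗ g.gMinus.toSubmodule.subtype) k ∘ₗ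
      (Forms.toAlternating g.killingEquiv V k).toLinearMap

/-- The Kostant Laplacian `□ = ∂ ∂^* + ∂^* ∂` on `Λ^k 𝔭₊ ⊗ V`. -/
def kostantLaplacian : (k : ℕ) → Forms g.pPlus V k →ₗ[ℝ] Forms g.pPlus V k
  | 0 => kostantCodifferential g θ 0 ∘ₗ kostantDifferential g θ 0
  | k + 1 => kostantDifferential g θ k ∘ₗ kostantCodifferential g θ k +
      kostantCodifferential g θ (k + 1) ∘ₗ kostantDifferential g θ (k + 1)

/-- The decomposable elements `Z_1 ∧ ⋯ ∧ Z_k ⊗ v` of `Λ^k 𝔭₊ ⊗ V` that are homogeneous of degree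
`c` with respect to the grading of `𝔤` and the grading of `V` by the eigenvalues of the grading
element. -/
def homogeneousForms (k : ℕ) (c : ℝ) : Set (Forms g.pPlus V k) :=
  {w | ∃ (Z : Fin k → g.pPlus) (n : Fin k → ℤ) (v : V) (b : ℝ),
    (∀ j, (Z j : 𝔤) ∈ g.comp (n j)) ∧ θ g.gradingElement v = b • v ∧
    c = ∑ j, (n j : ℝ) + b ∧ w = Forms.wedge V k Z v}

/-- The component of degree at least `a` of the natural filtration of `Λ^k 𝔭₊ ⊗ V`. -/
def formFiltration (k : ℕ) (a : ℝ) : Submodule ℝ (Forms g.pPlus V k) :=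
  Submodule.span ℝ (⋃ c ∈ Set.Ici a, homogeneousForms g θ k c)

/-- The next smaller component (degree larger than `a`) of the natural filtration of
`Λ^k 𝔭₊ ⊗ V`; the degree `a` part of the associated graded space is
`formFiltration g θ k a ⧸ formFiltrationNext g θ k a`. -/
def formFiltrationNext (k : ℕ) (a : ℝ) : Submodule ℝ (Forms g.pPlus V k) :=
  Submodule.span ℝ (⋃ c ∈ Set.Ioi a, homogeneousForms g θ k c)

end Kostant

/-! ### Smooth functions with values in a finite dimensional vector space -/

section Smooth

variable {EX : Type*} [NormedAddCommGroup EX] [NormedSpace ℝ EX]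
  {HX : Type*} [TopologicalSpace HX] (I : ModelWithCorners ℝ EX HX)
  {X : Type*} [TopologicalSpace X] [ChartedSpace HX X]
  {W : Type*} [AddCommGroup W] [Module ℝ W] [FiniteDimensional ℝ W]

/-- Linear coordinates on a finite dimensional vector space. -/
def coords (W : Type*) [AddCommGroup W] [Module ℝ W] [FiniteDimensional ℝ W] :
    W ≃ₗ[ℝ] (Fin (Module.finrank ℝ W) → ℝ) := (Module.finBasis ℝ W).equivFun

/-- Smoothness of a function on a manifold with values in a finite dimensional vector space. -/
def IsSmooth (f : X → W) : Prop :=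
  ContMDiff I 𝓘(ℝ, Fin (Module.finrank ℝ W) → ℝ) ∞ (fun x => coords W (f x))

/-- The derivative `T_x X → W` of a function with values in a finite dimensional vector space. -/
def vectorDeriv (f : X → W) (x : X) : TangentSpace I x →ₗ[ℝ] W :=
  (coords W).symm.toLinearMap ∘ₗ
    (mfderiv I 𝓘(ℝ, Fin (Module.finrank ℝ W) → ℝ) (fun x => coords W (f x)) x).toLinearMap

end Smooth

/-! ### Lie groups -/

section LieGroups

variable {EG : Type*} [NormedAddCommGroup EG] [NormedSpace ℝ EG]
  {G : Type*} [TopologicalSpace G] [ChartedSpace EG G] [Group G]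

instance lieGroup_minSmoothness [LieGroup 𝓘(ℝ, EG) ∞ G] :
    LieGroup 𝓘(ℝ, EG) (minSmoothness ℝ 3) G :=
  LieGroup.of_le (m := minSmoothness ℝ 3) (n := ∞) (by
    rw [minSmoothness_of_isRCLikeNormedField]
    exact ENat.LEInfty.out)

instance finiteDimensional_groupLieAlgebra [FiniteDimensional ℝ EG] :
    FiniteDimensional ℝ (GroupLieAlgebra 𝓘(ℝ, EG) G) :=
  inferInstanceAs (FiniteDimensional ℝ EG)

variable (EG) in
/-- The adjoint action `Ad(x) : 𝔤 → 𝔤`, the derivative of `y ↦ x y x⁻¹` at the identity. -/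
def Ad (x : G) : GroupLieAlgebra 𝓘(ℝ, EG) G →ₗ[ℝ] GroupLieAlgebra 𝓘(ℝ, EG) G :=
  (mfderiv 𝓘(ℝ, EG) 𝓘(ℝ, EG) (fun y : G => x * y * x⁻¹) 1).toLinearMap

variable {𝕜 : Type*} [RCLike 𝕜] {V : Type*} [AddCommGroup V] [Module ℝ V] [Module 𝕜 V]
  [IsScalarTower ℝ 𝕜 V] [FiniteDimensional ℝ V]

/-- The underlying real linear action of a real or complex representation. -/
def realAction (ρ : Representation 𝕜 G V) (x : G) : V →ₗ[ℝ] V := (ρ x).restrictScalars ℝ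

variable (EG) in
/-- The infinitesimal representation `𝔤 → End(V)`, the derivative of `ρ` at the identity. -/
def infinitesimal (ρ : Representation 𝕜 G V) :
    GroupLieAlgebra 𝓘(ℝ, EG) G →ₗ[ℝ] V →ₗ[ℝ] V :=
  vectorDeriv 𝓘(ℝ, EG) (realAction ρ) 1

variable (EP : Type*) [NormedAddCommGroup EP] [NormedSpace ℝ EP]

/-- `P` is a parabolic subgroup of `G` corresponding to a grading of the Lie algebra `𝔤`: a closed
Lie subgroup whose Lie algebra is `𝔭 = 𝔤^0` and whose adjoint action preserves the filtration
`𝔤^i`. -/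
structure IsParabolicSubgroup [FiniteDimensional ℝ EG] [CompleteSpace EG]
    [LieGroup 𝓘(ℝ, EG) ∞ G] (P : Subgroup G)
    [ChartedSpace EP P] (g : ParabolicGrading (GroupLieAlgebra 𝓘(ℝ, EG) G)) : Prop where
  isClosed : IsClosed (P : Set G)
  smooth_incl : ContMDiff 𝓘(ℝ, EP) 𝓘(ℝ, EG) ∞ (Subtype.val : P → G)
  injective_incl : Function.Injective
    (mfderiv 𝓘(ℝ, EP) 𝓘(ℝ, EG) (Subtype.val : P → G) 1)
  range_incl : LinearMap.range
    (mfderiv 𝓘(ℝ, EP) 𝓘(ℝ, EG) (Subtype.val : P → G) 1).toLinearMap = g.filt 0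
  ad_mem : ∀ (h : P) (i : ℤ), ∀ X ∈ g.filt i, Ad EG (h : G) X ∈ g.filt i

end LieGroups

/-! ### Cartan geometries, natural bundles and the curved Casimir operator -/

section Geometry

variable {EG : Type*} [NormedAddCommGroup EG] [NormedSpace ℝ EG] [FiniteDimensional ℝ EG]
  [CompleteSpace EG]
  {G : Type*} [TopologicalSpace G] [ChartedSpace EG G] [Group G] [LieGroup 𝓘(ℝ, EG) ∞ G]
  {EP : Type*} [NormedAddCommGroup EP] [NormedSpace ℝ EP]
  {P : Subgroup G} [ChartedSpace EP P]
  {EB : Type*} [NormedAddCommGroup EB] [NormedSpace ℝ EB]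
  {𝒢 : Type*} [TopologicalSpace 𝒢] [ChartedSpace EB 𝒢]
  {EM : Type*} [NormedAddCommGroup EM] [NormedSpace ℝ EM]
  {M : Type*} [TopologicalSpace M] [ChartedSpace EM M]

variable (EG EP P EB 𝒢 EM M) in
/-- A Cartan geometry `(p : 𝒢 → M, ω)` of type `(G, P)`: a smooth principal `P`-bundle with a
Cartan connection `ω ∈ Ω^1(𝒢, 𝔤)`. -/
structure CartanGeometry [IsManifold 𝓘(ℝ, EB) ∞ 𝒢] where
  /-- the bundle projection `p` -/
  proj : 𝒢 → M
  smooth_proj : ContMDiff 𝓘(ℝ, EB) 𝓘(ℝ, EM) ∞ proj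
  /-- the principal right action -/
  act : 𝒢 → P → 𝒢
  smooth_act : ContMDiff (𝓘(ℝ, EB).prod 𝓘(ℝ, EP)) 𝓘(ℝ, EB) ∞ (fun q : 𝒢 × P => act q.1 q.2)
  act_one : ∀ u, act u 1 = u
  act_mul : ∀ u h h', act u (h * h') = act (act u h) h'
  proj_act : ∀ u h, proj (act u h) = proj u
  /-- local triviality -/
  exists_trivialization : ∀ x : M, ∃ e : Bundle.Trivialization P proj, x ∈ e.baseSet ∧
    ContMDiffOn 𝓘(ℝ, EB) (𝓘(ℝ, EM).prod 𝓘(ℝ, EP)) ∞ e e.source ∧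
    ContMDiffOn (𝓘(ℝ, EM).prod 𝓘(ℝ, EP)) 𝓘(ℝ, EB) ∞ e.toOpenPartialHomeomorph.symm e.target ∧
    ∀ u ∈ e.source, ∀ h, e (act u h) = ((e u).1, (e u).2 * h)
  /-- the Cartan connection `ω`, an isomorphism `T_u 𝒢 ≅ 𝔤` for every `u` -/
  form : (u : 𝒢) → TangentSpace 𝓘(ℝ, EB) u ≃ₗ[ℝ] GroupLieAlgebra 𝓘(ℝ, EG) G
  smooth_form : IsSmooth 𝓘(ℝ, EB).tangent
    (fun v : TangentBundle 𝓘(ℝ, EB) 𝒢 => form v.proj v.snd)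
  /-- equivariance: `ω (T r^h ξ) = Ad(h⁻¹) (ω ξ)` -/
  form_act : ∀ (u : 𝒢) (h : P) (ξ : TangentSpace 𝓘(ℝ, EB) u),
    form (act u h) (mfderiv 𝓘(ℝ, EB) 𝓘(ℝ, EB) (fun u' => act u' h) u ξ) =
      Ad EG ((h⁻¹ : P) : G) (form u ξ)
  /-- `ω` reproduces the generators of fundamental vector fields -/
  form_fundamental : ∀ (u : 𝒢) (A : GroupLieAlgebra 𝓘(ℝ, EP) P),
    form (act u 1) (mfderiv 𝓘(ℝ, EP) 𝓘(ℝ, EB) (fun h : P => act u h) 1 A) =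
      mfderiv 𝓘(ℝ, EP) 𝓘(ℝ, EG) (Subtype.val : P → G) 1 A

namespace CartanGeometry

variable [IsManifold 𝓘(ℝ, EB) ∞ 𝒢] (Γ : CartanGeometry EG EP P EB 𝒢 EM M)

/-- The sections of the natural bundle `𝒢 ×_P W`, realized as the `P`-equivariant smooth functions
`𝒢 → W`; here `τ` is the action of `P` on `W`. -/
def sections {W : Type*} [AddCommGroup W] [Module ℝ W] [FiniteDimensional ℝ W]
    (τ : P → W →ₗ[ℝ] W) : Set (𝒢 → W) :=
  {σ | IsSmooth 𝓘(ℝ, EB) σ ∧ ∀ u h, σ (Γ.act u h) = τ h⁻¹ (σ u)}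

/-- The fundamental derivative `D σ`, as a function `𝒢 → 𝔤^* ⊗ W = Hom(𝔤, W)`: the derivative of
`σ` in the direction of the vector field `ω^{-1}(s)`. -/
def fundamentalDerivative {W : Type*} [AddCommGroup W] [Module ℝ W] [FiniteDimensional ℝ W]
    (σ : 𝒢 → W) : 𝒢 → (GroupLieAlgebra 𝓘(ℝ, EG) G →ₗ[ℝ] W) :=
  fun u => vectorDeriv 𝓘(ℝ, EB) σ u ∘ₗ (Γ.form u).symm.toLinearMap

/-- The curved Casimir operator `(B ⊗ id) ∘ D²`: the iterated fundamental derivative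
`D² σ : 𝒢 → 𝔤^* ⊗ 𝔤^* ⊗ W`, contracted with the Killing form `B`. -/
def curvedCasimir [LieAlgebra.IsKilling ℝ (GroupLieAlgebra 𝓘(ℝ, EG) G)]
    {W : Type*} [AddCommGroup W] [Module ℝ W] [FiniteDimensional ℝ W]
    (σ : 𝒢 → W) : 𝒢 → W :=
  fun u => ∑ ℓ, Γ.fundamentalDerivative (Γ.fundamentalDerivative σ) u
    (lieBasis (GroupLieAlgebra 𝓘(ℝ, EG) G) ℓ) (lieDualBasis (GroupLieAlgebra 𝓘(ℝ, EG) G) ℓ)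

end CartanGeometry

variable [LieAlgebra.IsKilling ℝ (GroupLieAlgebra 𝓘(ℝ, EG) G)]
  {g : ParabolicGrading (GroupLieAlgebra 𝓘(ℝ, EG) G)}
  {𝕜 : Type*} [RCLike 𝕜] {V : Type*} [AddCommGroup V] [Module ℝ V] [Module 𝕜 V]
  [IsScalarTower ℝ 𝕜 V] [FiniteDimensional ℝ V]

/-- The restriction of `Ad(h)`, `h ∈ P`, to `𝔭₊`. -/
def adPlus (hP : IsParabolicSubgroup EP P g) (h : P) : g.pPlus →ₗ[ℝ] g.pPlus :=
  (Ad EG (h : G)).restrict (p := g.pPlus.toSubmodule) (q := g.pPlus.toSubmodule) (hP.ad_mem h 1)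

/-- The action `Λ^k Ad ⊗ ρ` of `P` on `Λ^k 𝔭₊ ⊗ V`. -/
def formAction (hP : IsParabolicSubgroup EP P g) (ρ : Representation 𝕜 G V) (k : ℕ) (h : P) :
    Forms g.pPlus V k →ₗ[ℝ] Forms g.pPlus V k :=
  Forms.map k (adPlus hP h) (realAction ρ (h : G))

/-- The `VM`-valued `k`-forms on `M`, i.e. the sections of the natural bundle
`𝒢 ×_P (Λ^k 𝔭₊ ⊗ V) = Λ^k T^*M ⊗ VM`, with values in the subbundle corresponding to the subspace
`F` of `Λ^k 𝔭₊ ⊗ V`. -/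
def formSections [IsManifold 𝓘(ℝ, EB) ∞ 𝒢] (Γ : CartanGeometry EG EP P EB 𝒢 EM M)
    (hP : IsParabolicSubgroup EP P g) (ρ : Representation 𝕜 G V) (k : ℕ)
    (F : Submodule ℝ (Forms g.pPlus V k)) : Set (𝒢 → Forms g.pPlus V k) :=
  {σ | σ ∈ Γ.sections (formAction hP ρ k) ∧ ∀ u, σ u ∈ F}

end Geometry

end CurvedCasimir

end

noncomputable section

set_option linter.unusedSectionVars false

namespace CurvedCasimir

/-! ### Uncurrying of alternating maps and contraction with the first argument -/

section Alternating

variable {M N N' : Type*} [AddCommGroup M] [Module ℝ M] [AddCommGroup N] [Module ℝ N]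
  [AddCommGroup N'] [Module ℝ N']

/-! Let ξ_ℓ, η^ℓ be the Killing-dual bases, let subscripts +, 0, − denote components in 𝔭₊, 𝔤_0, 𝔤₋,
and let X· be `formAct`, the derivation of Λ^k 𝔭₊ ⊗ V extending Z ↦ [X, Z]_+ on 𝔭₊ and the action on
V. For X in 𝔭 this is the derivative of the action of P. The proof compares two formulas, one for 𝒞
and one for □, which share the same expression in the action of 𝔤_0.

Geometric side (`curvedCasimir_eq`). Since 𝔤_i and 𝔤_j are orthogonal unless i + j = 0, the
contraction defining 𝒞 splits into pairs from 𝔭₊ × 𝔤₋, 𝔤_0 × 𝔤_0 and 𝔤₋ × 𝔭₊. Whenever one slot lies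
in 𝔭, equivariance evaluates the derivative: Dσ(A) = −A·σ, D²σ(A, X) = Dσ([A, X]) − A·Dσ(X), D²σ(X,
A) = −A·Dσ(X). With `shift` = ∑ [(ξ_ℓ)_+, η^ℓ], which lies in 𝔤_0, this gives 𝒞σ = ∑
(ξ_ℓ)_0·(η^ℓ)_0·σ − shift·σ − 2 ∑ (ξ_ℓ)_+·Dσ(η^ℓ).

Algebraic side (`kostantLaplacian_formula`). Kostant's formula states that the first two terms are
(2□ + c₀)σ. It is proved by induction on k, a form of positive degree being a sum of products Z ∧ φ.
Exterior multiplication satisfies ∂*(Z ∧ φ) = −Z·φ − Z ∧ ∂*φ and ∂(Z ∧ φ) = ½ ∑ ξ_ℓ ∧ [η^ℓ, Z] ∧ φ −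
Z ∧ ∂φ, where elements of 𝔤 in a wedge stand for their 𝔭₊-components. Together with the commutator
of Z· and ∂ (`formAct_kostantDifferential`) these rules express □(Z ∧ φ) through □φ. Comparison with
the Leibniz rule for the 𝔤_0-expression leaves one identity in 𝔤, `sum_lie_lie_sub_shift_lie`, which
follows from traces. In degree zero the formula is the splitting of the Casimir of V, a scalar by
irreducibility.

Conclusion. Elements of 𝔤_0 preserve the degree and elements of 𝔭₊ raise it by at least one. A
derivative of a function with values in a linear subspace stays in that subspace, so Dσ(η^ℓ) has
values in F^{≥a} if σ does, and the last sum lies in F^{>a}. This is claim 3; claim 2 is read off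
from Kostant's formula, and claim 1 follows from both, the equivariance and smoothness of 𝒞σ being
part of it.

The analytic input is that the derivative of Ad at the identity is the bracket of left invariant
fields (`hasVecDeriv_Ad`) and that D maps smooth functions to smooth functions
(`isSmooth_fundamentalDerivative`). -/

open AlternatingMap in
lemma curryLeft_alternatizeUncurryFin {n : ℕ} (f : M →ₗ[ℝ] M [⋀^Fin (n + 1)]→ₗ[ℝ] N) (X : M) :
    (alternatizeUncurryFin f).curryLeft X =
      f X - alternatizeUncurryFin (curryLeftLinearMap.flip X ∘ₗ f) := by
  ext v
  simp only [curryLeft_apply_apply, alternatizeUncurryFin_apply, AlternatingMap.sub_apply]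
  rw [Fin.sum_univ_succ, sub_eq_add_neg, ← Finset.sum_neg_distrib]
  congr 1
  · simp [Matrix.vecCons, Fin.removeNth_zero]
  · refine Finset.sum_congr rfl fun i _ => ?_
    have : Fin.removeNth i.succ (Matrix.vecCons X v) = Matrix.vecCons X (Fin.removeNth i v) := by
      ext j
      refine Fin.cases ?_ (fun j => ?_) j <;> simp [Fin.removeNth]
    rw [this]
    simp [pow_succ]

-- A 0-form cannot be contracted, so the correction term is absent here. For this reason several
-- identities below come in two versions, one for the lowest degree.
open AlternatingMap in
lemma curryLeft_alternatizeUncurryFin_zero (f : M →ₗ[ℝ] M [⋀^Fin 0]→ₗ[ℝ] N) (X : M) :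
    (alternatizeUncurryFin f).curryLeft X = f X := by
  ext v
  simp only [curryLeft_apply_apply, alternatizeUncurryFin_apply]
  simp [Matrix.vecCons, Fin.removeNth_zero]

-- Antisymmetrization kills the symmetric bilinear map `f + f.flip`.
open AlternatingMap in
lemma alternatizeUncurryFin_swap {n : ℕ} (f : M →ₗ[ℝ] M →ₗ[ℝ] M [⋀^Fin n]→ₗ[ℝ] N) :
    alternatizeUncurryFin (alternatizeUncurryFinLM ∘ₗ f) =
      -alternatizeUncurryFin (alternatizeUncurryFinLM ∘ₗ f.flip) := by
  have h := alternatizeUncurryFin_alternatizeUncurryFinLM_comp_of_symmetric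
    (f := f + f.flip) (fun x y => by simp [add_comm])
  rw [LinearMap.comp_add, alternatizeUncurryFin_add] at h
  exact eq_neg_of_add_eq_zero_left h

end Alternating

/-! ### Generators of the space of forms -/

namespace Forms

variable {L : Type*} [LieRing L] [LieAlgebra ℝ L]
variable {V : Type*} [AddCommGroup V] [Module ℝ V]
variable {N : Type*} [AddCommGroup N] [Module ℝ N]

lemma hom_ext {k : ℕ} {f g : Forms L V k →ₗ[ℝ] N}
    (h : ∀ X v, f (wedge V k X v) = g (wedge V k X v)) : f = g := by
  refine TensorProduct.ext (exteriorPower.linearMap_ext ?_)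
  ext X v
  exact h X v

variable (V) in
/-- Left multiplication `φ ↦ Z ∧ φ`. -/
def leftMul (k : ℕ) : L →ₗ[ℝ] Forms L V k →ₗ[ℝ] Forms L V (k + 1) where
  toFun Z := lift ((wedge V (k + 1)).curryLeft Z)
  map_add' Z Z' := hom_ext fun X v => by simp only [LinearMap.add_apply, lift_wedge, map_add]; rfl
  map_smul' c Z := hom_ext fun X v => by
    simp only [LinearMap.smul_apply, lift_wedge, map_smul, RingHom.id_apply]; rfl

lemma leftMul_wedge (k : ℕ) (Z : L) (X : Fin k → L) (v : V) :
    leftMul V k Z (wedge V k X v) = wedge V (k + 1) (Matrix.vecCons Z X) v := by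
  change lift _ _ = _
  rw [lift_wedge]; rfl

-- Translates contraction of the universal alternating map into exterior multiplication on its
-- values; recursions for alternating maps become recursions for forms.
variable (V) in
lemma curryLeft_wedge (k : ℕ) (Z : L) :
    (wedge V (k + 1)).curryLeft Z =
      (LinearMap.llcomp ℝ V _ _ (leftMul V k Z)).compAlternatingMap (wedge V k) := by
  ext X v
  exact (leftMul_wedge k Z X v).symm

lemma leftMul_leftMul (k : ℕ) (Z Z' : L) (φ : Forms L V k) :
    leftMul V (k + 1) Z (leftMul V k Z' φ) = -leftMul V (k + 1) Z' (leftMul V k Z φ) := by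
  rw [← LinearMap.neg_apply, ← LinearMap.comp_apply, ← LinearMap.comp_apply]
  refine LinearMap.congr_fun (hom_ext fun X v => ?_) φ
  simp only [LinearMap.comp_apply, LinearMap.neg_apply, leftMul_wedge]
  have h := AlternatingMap.map_swap (wedge V (k + 2)) (Matrix.vecCons Z (Matrix.vecCons Z' X))
    (i := 0) (j := 1) (by simp)
  have h2 : (Matrix.vecCons Z (Matrix.vecCons Z' X)) ∘ (Equiv.swap (0 : Fin (k + 2)) 1) =
      Matrix.vecCons Z' (Matrix.vecCons Z X) := by
    ext j
    refine Fin.cases ?_ (fun j => Fin.cases ?_ (fun j => ?_) j) j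
    · simp
    · simp
    · rw [Function.comp_apply, Equiv.swap_apply_of_ne_of_ne (by simp [Fin.ext_iff])
        (by simp [Fin.ext_iff])]
      simp
  rw [h2] at h
  rw [h]; simp

variable (L V) in
/-- The inclusion of `V` as the space of forms of degree zero. -/
def unit : V →ₗ[ℝ] Forms L V 0 := wedge V 0 Fin.elim0

lemma wedge_zero (X : Fin 0 → L) (v : V) : wedge V 0 X v = unit L V v := by
  rw [unit, Subsingleton.elim X Fin.elim0]

lemma hom_ext_zero {f g : Forms L V 0 →ₗ[ℝ] N} (h : ∀ v, f (unit L V v) = g (unit L V v)) :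
    f = g :=
  hom_ext fun X v => by rw [wedge_zero, h]

/-- Products Z ∧ φ span the forms of positive degree. All inductions on the degree of a form go
through this. -/
lemma hom_ext_succ {k : ℕ} {f g : Forms L V (k + 1) →ₗ[ℝ] N}
    (h : ∀ Z φ, f (leftMul V k Z φ) = g (leftMul V k Z φ)) : f = g :=
  hom_ext fun X v => by
    have : X = Matrix.vecCons (X 0) (Fin.tail X) := (Fin.cons_self_tail X).symm
    rw [this, ← leftMul_wedge, h]

/-- The derivation of `Λ^k L ⊗ V` induced by linear maps on `L` and on `V`. -/
def derivation (D : L →ₗ[ℝ] L) (T : V →ₗ[ℝ] V) : (k : ℕ) → Forms L V k →ₗ[ℝ] Forms L V k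
  | 0 => lift ((LinearMap.lcomp ℝ _ T).compAlternatingMap (wedge V 0))
  | k + 1 => lift (AlternatingMap.alternatizeUncurryFin ((wedge V (k + 1)).curryLeft ∘ₗ D) +
      (LinearMap.lcomp ℝ _ T).compAlternatingMap (wedge V (k + 1)))

lemma derivation_unit (D : L →ₗ[ℝ] L) (T : V →ₗ[ℝ] V) (v : V) :
    derivation D T 0 (unit L V v) = unit L V (T v) := by
  rw [derivation, unit, lift_wedge]; rfl

lemma derivation_wedge (D : L →ₗ[ℝ] L) (T : V →ₗ[ℝ] V) (k : ℕ) (X : Fin (k + 1) → L) (v : V) :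
    derivation D T (k + 1) (wedge V (k + 1) X v) =
      ∑ i : Fin (k + 1), (-1 : ℤ) ^ (i : ℕ) •
        wedge V (k + 1) (Matrix.vecCons (D (X i)) (i.removeNth X)) v +
      wedge V (k + 1) X (T v) := by
  rw [derivation, lift_wedge, AlternatingMap.add_apply,
    AlternatingMap.alternatizeUncurryFin_apply, LinearMap.add_apply, LinearMap.sum_apply]
  rfl

/-- The Leibniz rule; with `derivation_unit` it determines the operator. -/
lemma derivation_leftMul (D : L →ₗ[ℝ] L) (T : V →ₗ[ℝ] V) (k : ℕ) (Z : L) (φ : Forms L V k) :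
    derivation D T (k + 1) (leftMul V k Z φ) =
      leftMul V k (D Z) φ + leftMul V k Z (derivation D T k φ) := by
  change (derivation D T (k + 1) ∘ₗ leftMul V k Z) φ =
    (leftMul V k (D Z) + leftMul V k Z ∘ₗ derivation D T k) φ
  refine LinearMap.congr_fun (hom_ext fun X v => ?_) φ
  cases k with
  | zero =>
    rw [LinearMap.add_apply, LinearMap.comp_apply, LinearMap.comp_apply, wedge_zero,
      derivation_unit, unit, leftMul_wedge, derivation_wedge, leftMul_wedge, leftMul_wedge]
    simp [Fin.removeNth_zero, Matrix.vecCons]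
  | succ k =>
    rw [LinearMap.add_apply, LinearMap.comp_apply, LinearMap.comp_apply, leftMul_wedge,
      derivation_wedge, derivation_wedge, map_add, leftMul_wedge, leftMul_wedge, ← add_assoc,
      Fin.sum_univ_succ, map_sum]
    congr 2
    · simp [Fin.removeNth_zero, Matrix.vecCons]
    · refine Finset.sum_congr rfl fun i _ => ?_
      have : Fin.removeNth i.succ (Matrix.vecCons Z X) = Matrix.vecCons Z (Fin.removeNth i X) := by
        ext j
        refine Fin.cases ?_ (fun j => ?_) j <;> simp [Fin.removeNth]
      rw [this, map_zsmul, leftMul_wedge, Matrix.cons_val_succ]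
      simp only [← leftMul_wedge]
      -- Moving Z in front of `D (X i)` costs the sign that the shift of index from `i` to `i.succ`
      -- has introduced.
      rw [leftMul_leftMul, smul_neg, ← neg_smul]
      simp [pow_succ]

end Forms

/-! ### The differentials and exterior multiplication -/

section Homology

variable {L : Type*} [LieRing L] [LieAlgebra ℝ L]
variable {V : Type*} [AddCommGroup V] [Module ℝ V]
variable {N N' : Type*} [AddCommGroup N] [Module ℝ N] [AddCommGroup N'] [Module ℝ N']

open AlternatingMap

lemma homologyDifferential_zero_leftMul (θ : L →ₗ[ℝ] V →ₗ[ℝ] V) (Z : L) (v : V) :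
    homologyDifferential θ 0 (Forms.leftMul V 0 Z (Forms.unit L V v)) =
      -Forms.unit L V (θ Z v) := by
  rw [Forms.unit, Forms.leftMul_wedge, homologyDifferential_zero_wedge, Forms.wedge_zero]
  rfl

/-- The sum `∑_{i<j} (-1)^{i+j} β([X_i, X_j], …)` contracted with `X` in the first argument. -/
lemma curryLeft_bracketSum {n : ℕ} (β : L [⋀^Fin (n + 2)]→ₗ[ℝ] N) (X : L) :
    (bracketSum β).curryLeft X =
      -alternatizeUncurryFin (β.curryLeft ∘ₗ lieBilin L X) - bracketSum (β.curryLeft X) := by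
  have h1 : ∀ Y : L, curryLeftLinearMap.flip X ∘ₗ (lieBilin L).compr₂ β.curryLeft Y =
      -((lieBilin L).compr₂ (β.curryLeft X).curryLeft Y) := by
    intro Y
    ext Y' v
    simp only [LinearMap.comp_apply, LinearMap.flip_apply, LinearMap.compr₂_apply,
      curryLeftLinearMap_apply, curryLeft_apply_apply, LinearMap.neg_apply,
      AlternatingMap.neg_apply]
    have h := AlternatingMap.map_swap β (Matrix.vecCons X (Matrix.vecCons (lieBilin L Y Y') v))
      (i := 0) (j := 1) (by simp)
    have h2 : (Matrix.vecCons X (Matrix.vecCons (lieBilin L Y Y') v)) ∘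
        (Equiv.swap (0 : Fin (n + 2)) 1) =
        Matrix.vecCons (lieBilin L Y Y') (Matrix.vecCons X v) := by
      ext j
      refine Fin.cases ?_ (fun j => Fin.cases ?_ (fun j => ?_) j) j
      · simp
      · simp
      · rw [Function.comp_apply, Equiv.swap_apply_of_ne_of_ne (by simp [Fin.ext_iff])
          (by simp [Fin.ext_iff])]
        simp
    rw [h2] at h
    rw [h]
  have h2 : curryLeftLinearMap.flip X ∘ₗ alternatizeUncurryFinLM ∘ₗ
        (lieBilin L).compr₂ β.curryLeft =
      -(β.curryLeft ∘ₗ lieBilin L X) +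
        alternatizeUncurryFinLM ∘ₗ (lieBilin L).compr₂ (β.curryLeft X).curryLeft := by
    refine LinearMap.ext fun Y => ?_
    simp only [LinearMap.comp_apply, LinearMap.flip_apply, LinearMap.add_apply,
      LinearMap.neg_apply, curryLeftLinearMap_apply, alternatizeUncurryFinLM_apply]
    rw [curryLeft_alternatizeUncurryFin, h1 Y, ← alternatizeUncurryFinLM_apply (-_), map_neg,
      sub_neg_eq_add]
    congr 1
    simp only [LinearMap.compr₂_apply]
    rw [← map_neg]
    congr 1
    exact (lie_skew Y X).symm
  rw [bracketSum, curryLeft_smul, LinearMap.smul_apply, curryLeft_alternatizeUncurryFin, h2,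
    alternatizeUncurryFin_add, LinearMap.comp_apply, alternatizeUncurryFinLM_apply, bracketSum,
    ← alternatizeUncurryFinLM_apply (-_), map_neg, alternatizeUncurryFinLM_apply]
  have h3 : (lieBilin L).compr₂ β.curryLeft X = β.curryLeft ∘ₗ lieBilin L X := rfl
  rw [h3]
  -- The two slots of the bracket contribute equally, which absorbs the factor 1/2 of `bracketSum`
  -- in the first term.
  module

lemma curryLeft_bracketSum_zero (β : L [⋀^Fin 1]→ₗ[ℝ] N) (X : L) :
    (bracketSum β).curryLeft X = -alternatizeUncurryFin (β.curryLeft ∘ₗ lieBilin L X) := by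
  have h2 : curryLeftLinearMap.flip X ∘ₗ alternatizeUncurryFinLM ∘ₗ
        (lieBilin L).compr₂ β.curryLeft =
      -(β.curryLeft ∘ₗ lieBilin L X) := by
    refine LinearMap.ext fun Y => ?_
    simp only [LinearMap.comp_apply, LinearMap.flip_apply, 
      LinearMap.neg_apply, curryLeftLinearMap_apply, alternatizeUncurryFinLM_apply]
    rw [curryLeft_alternatizeUncurryFin_zero]
    simp only [LinearMap.compr₂_apply]
    rw [← map_neg]
    congr 1
    exact (lie_skew Y X).symm
  rw [bracketSum, curryLeft_smul, LinearMap.smul_apply, curryLeft_alternatizeUncurryFin, h2,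
    LinearMap.comp_apply, alternatizeUncurryFinLM_apply, 
    ← alternatizeUncurryFinLM_apply (-_), map_neg, alternatizeUncurryFinLM_apply]
  have h3 : (lieBilin L).compr₂ β.curryLeft X = β.curryLeft ∘ₗ lieBilin L X := rfl
  rw [h3]
  module

lemma bracketSum_comp {n : ℕ} (T : N →ₗ[ℝ] N') (β : L [⋀^Fin (n + 1)]→ₗ[ℝ] N) :
    bracketSum (T.compAlternatingMap β) = T.compAlternatingMap (bracketSum β) := by
  ext X
  simp only [bracketSum_apply, LinearMap.compAlternatingMap_apply, map_sum, map_zsmul]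

lemma actionSum_comp {n : ℕ} {P P' : Type*} [AddCommGroup P] [Module ℝ P] [AddCommGroup P']
    [Module ℝ P'] (φ : L →ₗ[ℝ] N →ₗ[ℝ] N') (φ' : L →ₗ[ℝ] P →ₗ[ℝ] P') (T : P →ₗ[ℝ] N)
    (T' : P' →ₗ[ℝ] N') (h : ∀ X, φ X ∘ₗ T = T' ∘ₗ φ' X) (β : L [⋀^Fin n]→ₗ[ℝ] P) :
    actionSum φ (T.compAlternatingMap β) = T'.compAlternatingMap (actionSum φ' β) := by
  ext X
  simp only [actionSum_apply, LinearMap.compAlternatingMap_apply, map_sum, map_zsmul]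
  refine Finset.sum_congr rfl fun i _ => ?_
  congr 1
  exact LinearMap.congr_fun (h (X i)) _

lemma curryLeft_actionSum {n : ℕ} (φ : L →ₗ[ℝ] N →ₗ[ℝ] N') (β : L [⋀^Fin (n + 1)]→ₗ[ℝ] N)
    (X : L) : (actionSum φ β).curryLeft X =
      (φ X).compAlternatingMap β - actionSum φ (β.curryLeft X) := by
  rw [actionSum, curryLeft_alternatizeUncurryFin]
  rfl

lemma curryLeft_neg {n : ℕ} (β : L [⋀^Fin (n + 1)]→ₗ[ℝ] N) (X : L) :
    (-β).curryLeft X = -β.curryLeft X := by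
  rw [← neg_one_smul ℝ, curryLeft_smul, LinearMap.smul_apply, neg_one_smul]

/-- Cartan's formula for homology: the anticommutator of ∂* with Z ∧ is minus the action of Z.
Contracting the defining alternating map with Z in the first argument, the summand in which Z acts
on V and the brackets containing Z combine to this action; all other summands reproduce ∂* on the
remaining factors, with opposite sign. -/
lemma homologyDifferential_leftMul (θ : L →ₗ[ℝ] V →ₗ[ℝ] V) (k : ℕ) (Z : L)
    (φ : Forms L V (k + 1)) :
    homologyDifferential θ (k + 1) (Forms.leftMul V (k + 1) Z φ) =
      -Forms.derivation (lieBilin L Z) (θ Z) (k + 1) φ -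
        Forms.leftMul V k Z (homologyDifferential θ k φ) := by
  change (homologyDifferential θ (k + 1) ∘ₗ Forms.leftMul V (k + 1) Z) φ =
    (-Forms.derivation (lieBilin L Z) (θ Z) (k + 1) -
        Forms.leftMul V k Z ∘ₗ homologyDifferential θ k) φ
  refine LinearMap.congr_fun (Forms.hom_ext fun X v => ?_) φ
  simp only [LinearMap.comp_apply, LinearMap.sub_apply, LinearMap.neg_apply, Forms.leftMul_wedge,
    homologyDifferential, Forms.lift_wedge, Forms.derivation]
  have e1 : homologyAlternating θ (k + 1) (Matrix.vecCons Z X) =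
    (homologyAlternating θ (k + 1)).curryLeft Z X := rfl
  have key : (homologyAlternating θ (k + 1)).curryLeft Z =
      -(alternatizeUncurryFin ((Forms.wedge V (k + 1)).curryLeft ∘ₗ lieBilin L Z) +
        (LinearMap.lcomp ℝ _ (θ Z)).compAlternatingMap (Forms.wedge V (k + 1))) -
      (LinearMap.llcomp ℝ V _ _ (Forms.leftMul V k Z)).compAlternatingMap
        (homologyAlternating θ k) := by
    have ha : ∀ k : ℕ, actionSum ((LinearMap.llcomp ℝ V V _).flip ∘ₗ θ)
        ((Forms.wedge V (k + 1)).curryLeft Z) =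
        (LinearMap.llcomp ℝ V _ _ (Forms.leftMul V k Z)).compAlternatingMap
          (actionSum ((LinearMap.llcomp ℝ V V _).flip ∘ₗ θ) (Forms.wedge V k)) := by
      intro k
      rw [Forms.curryLeft_wedge]
      exact actionSum_comp _ _ _ _ (fun X => rfl) _
    have hb : ∀ k : ℕ, bracketSum ((Forms.wedge V (k + 2)).curryLeft Z) =
        (LinearMap.llcomp ℝ V _ _ (Forms.leftMul V (k + 1) Z)).compAlternatingMap
          (bracketSum (Forms.wedge V (k + 1))) := by
      intro k
      rw [Forms.curryLeft_wedge, bracketSum_comp]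
    have hs : homologyAlternating θ (k + 1) =
        -actionSum ((LinearMap.llcomp ℝ V V _).flip ∘ₗ θ) (Forms.wedge V (k + 1)) +
          bracketSum (Forms.wedge V (k + 1)) := by rw [homologyAlternating]
    rw [hs]
    cases k with
    | zero =>
      rw [curryLeft_add, LinearMap.add_apply, curryLeft_neg,
        curryLeft_actionSum, curryLeft_bracketSum_zero, ha, homologyAlternating]
      ext X v
      simp only [LinearMap.add_apply, AlternatingMap.add_apply, LinearMap.neg_apply,
        AlternatingMap.neg_apply, LinearMap.sub_apply, AlternatingMap.sub_apply,
        LinearMap.compAlternatingMap_apply, LinearMap.comp_apply, LinearMap.flip_apply,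
        LinearMap.llcomp_apply, LinearMap.lcomp_apply, map_neg]
      abel
    | succ k =>
      rw [curryLeft_add, LinearMap.add_apply, curryLeft_neg,
        curryLeft_actionSum, curryLeft_bracketSum, ha, hb, homologyAlternating]
      ext X v
      simp only [LinearMap.add_apply, AlternatingMap.add_apply, LinearMap.neg_apply,
        AlternatingMap.neg_apply, LinearMap.sub_apply, AlternatingMap.sub_apply,
        LinearMap.compAlternatingMap_apply, LinearMap.comp_apply, LinearMap.flip_apply,
        LinearMap.llcomp_apply, LinearMap.lcomp_apply, map_neg, map_add]
      abel
  rw [e1, key]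
  rfl

end Homology

section Cohomology

variable {L : Type*} [LieRing L] [LieAlgebra ℝ L]
variable {V : Type*} [AddCommGroup V] [Module ℝ V]

open AlternatingMap

/-- Exterior multiplication of a `V`-valued alternating map by a linear form. -/
def wedgeForm {n : ℕ} (ζ : L →ₗ[ℝ] ℝ) (α : L [⋀^Fin n]→ₗ[ℝ] V) : L [⋀^Fin (n + 1)]→ₗ[ℝ] V :=
  alternatizeUncurryFin (ζ.smulRight α)

lemma curryLeft_wedgeForm {n : ℕ} (ζ : L →ₗ[ℝ] ℝ) (α : L [⋀^Fin (n + 1)]→ₗ[ℝ] V) (X : L) :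
    (wedgeForm ζ α).curryLeft X = ζ X • α - wedgeForm ζ (α.curryLeft X) := by
  rw [wedgeForm, curryLeft_alternatizeUncurryFin]
  congr 1

lemma curryLeft_wedgeForm_zero (ζ : L →ₗ[ℝ] ℝ) (α : L [⋀^Fin 0]→ₗ[ℝ] V) (X : L) :
    (wedgeForm ζ α).curryLeft X = ζ X • α := by
  rw [wedgeForm, curryLeft_alternatizeUncurryFin_zero]
  rfl

/-- Exterior multiplication anticommutes with uncurrying. -/
lemma alternatizeUncurryFin_wedgeForm {n : ℕ} (ζ : L →ₗ[ℝ] ℝ)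
    (f : L →ₗ[ℝ] L [⋀^Fin n]→ₗ[ℝ] V) (h : L →ₗ[ℝ] L [⋀^Fin (n + 1)]→ₗ[ℝ] V)
    (hh : ∀ X, h X = wedgeForm ζ (f X)) :
    alternatizeUncurryFin h = -wedgeForm ζ (alternatizeUncurryFin f) := by
  -- h is the uncurrying of (X, Y) ↦ ζ(Y) f(X). Exchanging the two slots brings ζ to the front and
  -- produces the sign.
  have e : h = alternatizeUncurryFinLM ∘ₗ
      ((LinearMap.lsmul ℝ (L [⋀^Fin n]→ₗ[ℝ] V)).compl₁₂ ζ f).flip := by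
    refine LinearMap.ext fun X => ?_
    rw [hh, wedgeForm]
    simp only [LinearMap.comp_apply, alternatizeUncurryFinLM_apply]
    congr 1
  rw [e, alternatizeUncurryFin_swap, wedgeForm, LinearMap.flip_flip]
  congr 2
  refine LinearMap.ext fun X => ?_
  simp only [LinearMap.comp_apply, LinearMap.smulRight_apply]
  rw [← alternatizeUncurryFinLM_apply, ← map_smul]
  rfl

lemma actionSum_wedgeForm {n : ℕ} (θ : L →ₗ[ℝ] V →ₗ[ℝ] V) (ζ : L →ₗ[ℝ] ℝ)
    (α : L [⋀^Fin n]→ₗ[ℝ] V) :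
    actionSum θ (wedgeForm ζ α) = -wedgeForm ζ (actionSum θ α) := by
  refine alternatizeUncurryFin_wedgeForm ζ _ _ fun X => ?_
  ext v
  simp [wedgeForm, alternatizeUncurryFin_apply, map_sum]

/-- The exterior product of the differential of a linear form with an alternating map. -/
def wedgeFormDifferential {n : ℕ} (ζ : L →ₗ[ℝ] ℝ) (α : L [⋀^Fin n]→ₗ[ℝ] V) :
    L [⋀^Fin (n + 2)]→ₗ[ℝ] V :=
  (-(1 / 2) : ℝ) • alternatizeUncurryFin (alternatizeUncurryFinLM ∘ₗ
    ((lieBilin L).compr₂ ζ).compr₂ (LinearMap.toSpanSingleton ℝ _ α))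

/-- A decomposition of ζ ∘ [ , ] into products of linear forms turns dζ ∧ α into iterated exterior
products, which can be expressed in Λ 𝔭₊ ⊗ V. The decomposition used later comes from Killing-dual
bases. -/
lemma wedgeFormDifferential_eq_sum {n : ℕ} {ι : Type*} [Fintype ι] (ζ : L →ₗ[ℝ] ℝ)
    (α : L [⋀^Fin n]→ₗ[ℝ] V) (a b : ι → L →ₗ[ℝ] ℝ)
    (h : ∀ X Y, ζ ⁅X, Y⁆ = ∑ i, a i X * b i Y) :
    wedgeFormDifferential ζ α = (-(1 / 2) : ℝ) • ∑ i, wedgeForm (a i) (wedgeForm (b i) α) := by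
  rw [wedgeFormDifferential]
  congr 1
  have e : alternatizeUncurryFinLM ∘ₗ ((lieBilin L).compr₂ ζ).compr₂
      (LinearMap.toSpanSingleton ℝ _ α) = ∑ i, (a i).smulRight (wedgeForm (b i) α) := by
    refine LinearMap.ext fun X => ?_
    simp only [LinearMap.comp_apply, LinearMap.sum_apply, LinearMap.smulRight_apply, wedgeForm,
      ← alternatizeUncurryFinLM_apply]
    rw [show ∑ i, a i X • alternatizeUncurryFinLM ((b i).smulRight α) =
      alternatizeUncurryFinLM (∑ i, a i X • (b i).smulRight α) by simp only [map_sum, map_smul]]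
    congr 1
    refine LinearMap.ext fun Y => ?_
    simp only [LinearMap.compr₂_apply, LinearMap.sum_apply, LinearMap.smul_apply,
      LinearMap.smulRight_apply, LinearMap.toSpanSingleton_apply, smul_smul, ← Finset.sum_smul]
    rw [← h X Y]
    rfl
  rw [e, ← alternatizeUncurryFinLM_apply, map_sum]
  rfl

lemma bracketSum_wedgeForm_zero (ζ : L →ₗ[ℝ] ℝ) (α : L [⋀^Fin 0]→ₗ[ℝ] V) :
    bracketSum (wedgeForm ζ α) = wedgeFormDifferential ζ α := by
  rw [bracketSum, wedgeFormDifferential]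
  congr 3
  refine LinearMap.ext fun X => LinearMap.ext fun Y => ?_
  simp only [LinearMap.compr₂_apply, curryLeft_wedgeForm_zero]
  rfl

/-- Contracting ζ ∧ α with [X, Y] gives ζ([X, Y]) α minus ζ ∧ (α contracted with [X, Y]). The first
term yields dζ ∧ α; in the second, ζ ∧ passes through two antisymmetrizations, whose signs cancel.
-/
lemma bracketSum_wedgeForm {n : ℕ} (ζ : L →ₗ[ℝ] ℝ) (α : L [⋀^Fin (n + 1)]→ₗ[ℝ] V) :
    bracketSum (wedgeForm ζ α) = wedgeFormDifferential ζ α - wedgeForm ζ (bracketSum α) := by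
  let c : L →ₗ[ℝ] L →ₗ[ℝ] L [⋀^Fin n]→ₗ[ℝ] V := (lieBilin L).compr₂ α.curryLeft
  let s : L →ₗ[ℝ] L →ₗ[ℝ] L [⋀^Fin (n + 1)]→ₗ[ℝ] V :=
    ((lieBilin L).compr₂ ζ).compr₂ (LinearMap.toSpanSingleton ℝ _ α)
  let b : L →ₗ[ℝ] L →ₗ[ℝ] L [⋀^Fin (n + 1)]→ₗ[ℝ] V :=
    (lieBilin L).compr₂ (wedgeForm ζ α).curryLeft
  have h1 : ∀ X, alternatizeUncurryFin (s X - b X) =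
      -wedgeForm ζ (alternatizeUncurryFin (c X)) := by
    intro X
    refine alternatizeUncurryFin_wedgeForm ζ _ _ fun Y => ?_
    simp only [LinearMap.sub_apply, s, b, c, LinearMap.compr₂_apply, curryLeft_wedgeForm]
    rw [LinearMap.toSpanSingleton_apply, sub_sub_cancel]
  have h2 : alternatizeUncurryFin (alternatizeUncurryFinLM ∘ₗ (b - s)) =
      -wedgeForm ζ (alternatizeUncurryFin (alternatizeUncurryFinLM ∘ₗ c)) := by
    refine alternatizeUncurryFin_wedgeForm ζ _ _ fun X => ?_
    rw [LinearMap.comp_apply, LinearMap.comp_apply, alternatizeUncurryFinLM_apply,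
      alternatizeUncurryFinLM_apply, ← neg_neg (wedgeForm _ _), ← h1 X,
      ← alternatizeUncurryFinLM_apply (s X - b X), ← map_neg, LinearMap.sub_apply, neg_sub,
      alternatizeUncurryFinLM_apply]
  have h3 : ∀ (r : ℝ) (β : L [⋀^Fin (n + 2)]→ₗ[ℝ] V), wedgeForm ζ (r • β) = r • wedgeForm ζ β := by
    intro r β
    rw [wedgeForm, wedgeForm, ← alternatizeUncurryFin_smul]
    congr 1
    ext; simp [smul_comm r]
  rw [LinearMap.comp_sub, ← alternatizeUncurryFinLM_apply, map_sub] at h2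
  simp only [alternatizeUncurryFinLM_apply] at h2
  rw [bracketSum, bracketSum, wedgeFormDifferential, h3]
  change (-(1 / 2) : ℝ) • alternatizeUncurryFin (alternatizeUncurryFinLM ∘ₗ b) =
    (-(1 / 2) : ℝ) • alternatizeUncurryFin (alternatizeUncurryFinLM ∘ₗ s) -
      (-(1 / 2) : ℝ) • wedgeForm ζ (alternatizeUncurryFin (alternatizeUncurryFinLM ∘ₗ c))
  rw [eq_add_of_sub_eq h2]
  module

/-- The antiderivation rule, the counterpart for ∂ of `homologyDifferential_leftMul`. -/
lemma cohomologyDifferential_wedgeForm (θ : L →ₗ[ℝ] V →ₗ[ℝ] V) {n : ℕ} (ζ : L →ₗ[ℝ] ℝ)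
    (α : L [⋀^Fin n]→ₗ[ℝ] V) :
    cohomologyDifferential θ (n + 1) (wedgeForm ζ α) =
      wedgeFormDifferential ζ α - wedgeForm ζ (cohomologyDifferential θ n α) := by
  have hadd : ∀ {n : ℕ} (β γ : L [⋀^Fin n]→ₗ[ℝ] V),
      wedgeForm ζ (β + γ) = wedgeForm ζ β + wedgeForm ζ γ := by
    intro n β γ
    rw [wedgeForm, wedgeForm, wedgeForm, ← alternatizeUncurryFin_add]
    congr 1
    ext; simp
  cases n with
  | zero =>
    change actionSum θ (wedgeForm ζ α) + bracketSum (wedgeForm ζ α) =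
      wedgeFormDifferential ζ α - wedgeForm ζ (actionSum θ α)
    rw [actionSum_wedgeForm, bracketSum_wedgeForm_zero]; abel
  | succ n =>
    change actionSum θ (wedgeForm ζ α) + bracketSum (wedgeForm ζ α) =
      wedgeFormDifferential ζ α - wedgeForm ζ (actionSum θ α + bracketSum α)
    rw [actionSum_wedgeForm, bracketSum_wedgeForm, hadd]; abel

/-- Laplace expansion of the determinant along the column of Z. -/
lemma toAlternating_leftMul {M : Type*} [AddCommGroup M] [Module ℝ M] [FiniteDimensional ℝ M]
    (κ : L ≃ₗ[ℝ] Module.Dual ℝ M) (k : ℕ) (Z : L) (φ : Forms L V k) :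
    Forms.toAlternating κ V (k + 1) (Forms.leftMul V k Z φ) =
      alternatizeUncurryFin (LinearMap.smulRight (κ Z) (Forms.toAlternating κ V k φ)) := by
  change ((Forms.toAlternating κ V (k + 1)).toLinearMap ∘ₗ Forms.leftMul V k Z) φ =
    ((alternatizeUncurryFinLM ∘ₗ LinearMap.smulRightₗ (κ Z)) ∘ₗ
      (Forms.toAlternating κ V k).toLinearMap) φ
  refine LinearMap.congr_fun (Forms.hom_ext fun Y v => ?_) φ
  ext X
  simp only [LinearMap.comp_apply, LinearEquiv.coe_coe, Forms.leftMul_wedge,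
    Forms.toAlternating_wedge, alternatizeUncurryFinLM_apply, alternatizeUncurryFin_apply,
    LinearMap.smulRightₗ_apply]
  rw [Matrix.det_succ_column_zero, Finset.sum_smul]
  refine Finset.sum_congr rfl fun i _ => ?_
  rw [mul_assoc, mul_smul, mul_smul, ← Int.cast_smul_eq_zsmul ℝ]
  simp only [Int.cast_pow, Int.cast_neg, Int.cast_one, Matrix.of_apply, Matrix.cons_val_zero]
  rw [LinearMap.smulRight_apply, AlternatingMap.smul_apply, Forms.toAlternating_wedge]
  rfl

end Cohomology

/-! ### Contraction with the Killing form -/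

section Contraction

variable {𝔤 : Type*} [LieRing 𝔤] [LieAlgebra ℝ 𝔤] [FiniteDimensional ℝ 𝔤]
  [LieAlgebra.IsKilling ℝ 𝔤] {A B C N : Type*} [AddCommGroup N] [Module ℝ N]
  [AddCommGroup A] [Module ℝ A] [AddCommGroup B] [Module ℝ B] [AddCommGroup C] [Module ℝ C]

local notation "ξ" => lieBasis 𝔤
local notation "η" => lieDualBasis 𝔤
local notation "κ" => killingForm ℝ 𝔤

lemma killingForm_eq_iff {X Y : 𝔤} (h : ∀ Z, κ X Z = κ Y Z) : X = Y := by
  have : X - Y ∈ LinearMap.ker κ := by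
    rw [LinearMap.mem_ker]; ext Z; simp [h]
  rwa [LieAlgebra.IsKilling.ker_killingForm_eq_bot, Submodule.mem_bot, sub_eq_zero] at this

lemma sum_killingForm_dualBasis_smul (Y : 𝔤) : ∑ ℓ, κ Y (η ℓ) • ξ ℓ = Y := by
  conv_rhs => rw [← (lieBasis 𝔤).sum_repr Y]
  refine Finset.sum_congr rfl fun ℓ _ => ?_
  congr 1
  conv_lhs => rw [← (lieBasis 𝔤).sum_repr Y]
  simp only [map_sum, LinearMap.sum_apply, map_smul, LinearMap.smul_apply, smul_eq_mul]
  rw [Finset.sum_eq_single ℓ]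
  · rw [lieDualBasis, LinearMap.BilinForm.apply_dualBasis_right
      (sym := ⟨fun X Y => LieModule.traceForm_comm ℝ 𝔤 𝔤 X Y⟩)]
    simp
  · intro m _ hm
    rw [lieDualBasis, LinearMap.BilinForm.apply_dualBasis_right
      (sym := ⟨fun X Y => LieModule.traceForm_comm ℝ 𝔤 𝔤 X Y⟩)]
    simp [hm]
  · simp

lemma sum_killingForm_basis_smul (Y : 𝔤) : ∑ ℓ, κ (ξ ℓ) Y • η ℓ = Y := by
  refine killingForm_eq_iff fun Z => ?_
  conv_rhs => rw [← sum_killingForm_dualBasis_smul Z]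
  simp only [map_sum, LinearMap.sum_apply, map_smul, LinearMap.smul_apply, smul_eq_mul]
  refine Finset.sum_congr rfl fun ℓ _ => ?_
  rw [LieModule.traceForm_comm ℝ 𝔤 𝔤 (η ℓ) Z, LieModule.traceForm_comm ℝ 𝔤 𝔤 (ξ ℓ) Y, mul_comm]

/-- Two linear maps are adjoint with respect to the Killing form. -/
def IsKillingAdjoint (T T' : 𝔤 →ₗ[ℝ] 𝔤) : Prop := ∀ X Y, κ (T X) Y = κ X (T' Y)

lemma IsKillingAdjoint.symm {T T' : 𝔤 →ₗ[ℝ] 𝔤} (h : IsKillingAdjoint T T') :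
    IsKillingAdjoint T' T := fun X Y => by
  rw [LieModule.traceForm_comm, ← h, LieModule.traceForm_comm]

lemma IsKillingAdjoint.comp {T T' S S' : 𝔤 →ₗ[ℝ] 𝔤} (h : IsKillingAdjoint T T')
    (hS : IsKillingAdjoint S S') : IsKillingAdjoint (T ∘ₗ S) (S' ∘ₗ T') := fun X Y => by
  rw [LinearMap.comp_apply, LinearMap.comp_apply, h, hS]

lemma IsKillingAdjoint.sub {T T' S S' : 𝔤 →ₗ[ℝ] 𝔤} (h : IsKillingAdjoint T T')
    (hS : IsKillingAdjoint S S') : IsKillingAdjoint (T - S) (T' - S') := fun X Y => by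
  simp [h X Y, hS X Y]

lemma isKillingAdjoint_id : IsKillingAdjoint (LinearMap.id : 𝔤 →ₗ[ℝ] 𝔤) LinearMap.id :=
  fun _ _ => rfl

lemma isKillingAdjoint_lieBilin (X : 𝔤) :
    IsKillingAdjoint (lieBilin 𝔤 X) (-lieBilin 𝔤 X) := fun Y Z => by
  change κ ⁅X, Y⁆ Z = κ Y (-⁅X, Z⁆)
  rw [map_neg, ← LieModule.traceForm_apply_lie_apply, ← lie_skew X Y, map_neg]
  rfl

/-- The tensor ∑ ξ_ℓ ⊗ η^ℓ corresponds to the identity under the Killing form, so an operator moves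
from one slot to the other as its adjoint. Applied to ad X this is invariance of the contraction,
applied to projections it is the splitting along the grading. -/
lemma sum_isKillingAdjoint (β : 𝔤 →ₗ[ℝ] 𝔤 →ₗ[ℝ] N) {T T' : 𝔤 →ₗ[ℝ] 𝔤}
    (h : IsKillingAdjoint T T') : ∑ ℓ, β (T (ξ ℓ)) (η ℓ) = ∑ ℓ, β (ξ ℓ) (T' (η ℓ)) := by
  have h1 : ∀ ℓ, β (T (ξ ℓ)) (η ℓ) = ∑ m, κ (T (ξ ℓ)) (η m) • β (ξ m) (η ℓ) := by
    intro ℓ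
    conv_lhs => rw [← sum_killingForm_dualBasis_smul (T (ξ ℓ))]
    simp
  have h2 : ∀ m, β (ξ m) (T' (η m)) = ∑ ℓ, κ (ξ ℓ) (T' (η m)) • β (ξ m) (η ℓ) := by
    intro m
    conv_lhs => rw [← sum_killingForm_basis_smul (T' (η m))]
    simp
  simp only [h1, h2]
  rw [Finset.sum_comm]
  simp only [h _ _]

lemma sum_swap (β : 𝔤 →ₗ[ℝ] 𝔤 →ₗ[ℝ] N) : ∑ ℓ, β (ξ ℓ) (η ℓ) = ∑ ℓ, β (η ℓ) (ξ ℓ) := by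
  have h1 : ∀ ℓ, β (ξ ℓ) (η ℓ) = ∑ m, κ (ξ m) (ξ ℓ) • β (η m) (η ℓ) := by
    intro ℓ
    conv_lhs => rw [← sum_killingForm_basis_smul (ξ ℓ)]
    simp
  have h2 : ∀ m, β (η m) (ξ m) = ∑ ℓ, κ (ξ ℓ) (ξ m) • β (η m) (η ℓ) := by
    intro m
    conv_lhs => rw [← sum_killingForm_basis_smul (ξ m)]
    simp
  simp only [h1, h2]
  rw [Finset.sum_comm]
  refine Finset.sum_congr rfl fun m _ => Finset.sum_congr rfl fun ℓ _ => ?_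
  rw [LieModule.traceForm_comm]

/-- The bilinear map `(X, Y) ↦ f X (h Y a)`. -/
def compBilin (f : 𝔤 →ₗ[ℝ] B →ₗ[ℝ] C) (h : 𝔤 →ₗ[ℝ] A →ₗ[ℝ] B) (a : A) : 𝔤 →ₗ[ℝ] 𝔤 →ₗ[ℝ] C :=
  f.compl₂ (h.flip a)

lemma sum_comp_isKillingAdjoint (f : 𝔤 →ₗ[ℝ] B →ₗ[ℝ] C) (h : 𝔤 →ₗ[ℝ] A →ₗ[ℝ] B)
    {T T' : 𝔤 →ₗ[ℝ] 𝔤} (hT : IsKillingAdjoint T T') (a : A) :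
    ∑ ℓ, f (T (ξ ℓ)) (h (η ℓ) a) = ∑ ℓ, f (ξ ℓ) (h (T' (η ℓ)) a) :=
  sum_isKillingAdjoint (compBilin f h a) hT

lemma sum_comp_swap (f : 𝔤 →ₗ[ℝ] B →ₗ[ℝ] C) (h : 𝔤 →ₗ[ℝ] A →ₗ[ℝ] B) (a : A) :
    ∑ ℓ, f (ξ ℓ) (h (η ℓ) a) = ∑ ℓ, f (η ℓ) (h (ξ ℓ) a) :=
  sum_swap (compBilin f h a)

/-- The coefficient of ξ_ℓ in T ξ_ℓ is its pairing with η^ℓ. -/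
lemma sum_killingForm_eq_trace (T : 𝔤 →ₗ[ℝ] 𝔤) :
    ∑ ℓ, κ (T (ξ ℓ)) (η ℓ) = LinearMap.trace ℝ 𝔤 T := by
  rw [LinearMap.trace_eq_matrix_trace ℝ (lieBasis 𝔤), Matrix.trace]
  refine Finset.sum_congr rfl fun ℓ _ => ?_
  rw [Matrix.diag_apply, LinearMap.toMatrix_apply]
  conv_rhs => rw [← sum_killingForm_dualBasis_smul (T (ξ ℓ))]
  simp [Finsupp.single_apply]

lemma IsKillingAdjoint.trace_eq {T T' : 𝔤 →ₗ[ℝ] 𝔤} (h : IsKillingAdjoint T T') :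
    LinearMap.trace ℝ 𝔤 T = LinearMap.trace ℝ 𝔤 T' := by
  rw [← sum_killingForm_eq_trace, ← sum_killingForm_eq_trace]
  refine (sum_isKillingAdjoint κ h).trans ?_
  refine (sum_swap ((killingForm ℝ 𝔤).compl₂ T')).trans ?_
  change ∑ ℓ, κ (η ℓ) (T' (ξ ℓ)) = _
  simp only [LieModule.traceForm_comm ℝ 𝔤 𝔤 (η _) (T' (ξ _))]

end Contraction

/-! ### Projections onto sums of grading components -/

namespace ParabolicGrading

section Projections

variable {𝔤 : Type*} [LieRing 𝔤] [LieAlgebra ℝ 𝔤] (g : ParabolicGrading 𝔤)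

open Classical in
/-- The projection onto the sum of the components whose degree lies in `S`. -/
def proj (S : Set ℤ) : 𝔤 →ₗ[ℝ] 𝔤 :=
  DirectSum.toModule ℝ ℤ 𝔤 (fun i => if i ∈ S then (g.comp i).subtype else 0) ∘ₗ
    (LinearEquiv.ofBijective (DirectSum.coeLinearMap g.comp) g.isInternal).symm.toLinearMap

open Classical in
lemma proj_of_mem_comp (S : Set ℤ) {i : ℤ} {X : 𝔤} (hX : X ∈ g.comp i) :
    g.proj S X = if i ∈ S then X else 0 := by
  have h : (LinearEquiv.ofBijective (DirectSum.coeLinearMap g.comp) g.isInternal).symm X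
      = DirectSum.lof ℝ ℤ (fun i => g.comp i) i ⟨X, hX⟩ := by
    rw [LinearEquiv.symm_apply_eq]
    exact (DirectSum.coeLinearMap_lof g.comp i ⟨X, hX⟩).symm
  simp only [proj, LinearMap.comp_apply, LinearEquiv.coe_coe, h, DirectSum.toModule_lof]
  split_ifs <;> rfl

lemma proj_eq_self (S : Set ℤ) {i : ℤ} (hi : i ∈ S) {X : 𝔤} (hX : X ∈ g.comp i) :
    g.proj S X = X := by
  rw [g.proj_of_mem_comp S hX, if_pos hi]

lemma proj_eq_zero (S : Set ℤ) {i : ℤ} (hi : i ∉ S) {X : 𝔤} (hX : X ∈ g.comp i) :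
    g.proj S X = 0 := by
  rw [g.proj_of_mem_comp S hX, if_neg hi]

lemma proj_mem (S : Set ℤ) (X : 𝔤) : g.proj S X ∈ ⨆ j ∈ S, g.comp j := by
  classical
  induction X using g.induction_homogeneous with
  | h0 => simp
  | hadd x y hx hy => rw [map_add]; exact add_mem hx hy
  | hmem i x hx =>
    rw [g.proj_of_mem_comp S hx]
    split_ifs with hi
    · exact Submodule.mem_iSup_of_mem i (Submodule.mem_iSup_of_mem hi hx)
    · exact zero_mem _

lemma iSup_comp_induction {S : Set ℤ} {p : 𝔤 → Prop} (h0 : p 0)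
    (hadd : ∀ x y, p x → p y → p (x + y)) (hmem : ∀ i ∈ S, ∀ x ∈ g.comp i, p x) {X : 𝔤}
    (hX : X ∈ ⨆ j ∈ S, g.comp j) : p X := by
  rw [iSup_subtype'] at hX
  exact Submodule.iSup_induction (fun i : S => g.comp i) (motive := p) hX
    (fun i x hx => hmem i i.2 x hx) h0 hadd

lemma proj_eq_self_of_mem {S T : Set ℤ} (hST : T ⊆ S) {X : 𝔤} (hX : X ∈ ⨆ j ∈ T, g.comp j) :
    g.proj S X = X :=
  g.iSup_comp_induction (p := fun X => g.proj S X = X) (map_zero _)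
    (fun x y hx hy => by rw [map_add, hx, hy]) (fun _ hi _ hx => g.proj_eq_self S (hST hi) hx) hX

lemma proj_proj (S : Set ℤ) (X : 𝔤) : g.proj S (g.proj S X) = g.proj S X :=
  g.proj_eq_self_of_mem subset_rfl (g.proj_mem S X)

lemma lie_mem_iSup {S T U : Set ℤ} (h : ∀ i ∈ S, ∀ j ∈ T, i + j ∈ U) {X Y : 𝔤}
    (hX : X ∈ ⨆ j ∈ S, g.comp j) (hY : Y ∈ ⨆ j ∈ T, g.comp j) : ⁅X, Y⁆ ∈ ⨆ j ∈ U, g.comp j := by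
  refine g.iSup_comp_induction (p := fun X => ⁅X, Y⁆ ∈ ⨆ j ∈ U, g.comp j) (by simp)
    (fun x y hx hy => by rw [add_lie]; exact add_mem hx hy) (fun i hi x hx => ?_) hX
  refine g.iSup_comp_induction (p := fun Y => ⁅x, Y⁆ ∈ ⨆ j ∈ U, g.comp j) (by simp)
    (fun x y hx hy => by rw [lie_add]; exact add_mem hx hy) (fun j hj y hy => ?_) hY
  exact Submodule.mem_iSup_of_mem (i + j) (Submodule.mem_iSup_of_mem (h i hi j hj) (g.lie_mem hx hy))

/-- The projection onto `𝔭₊`. -/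
abbrev plus : 𝔤 →ₗ[ℝ] 𝔤 := g.proj {i | 1 ≤ i}

/-- The projection onto `𝔤_0`. -/
abbrev mid : 𝔤 →ₗ[ℝ] 𝔤 := g.proj {0}

/-- The projection onto `𝔤₋`. -/
abbrev minus : 𝔤 →ₗ[ℝ] 𝔤 := g.proj {i | i < 0}

lemma plus_add_mid_add_minus (X : 𝔤) : g.plus X + g.mid X + g.minus X = X := by
  classical
  induction X using g.induction_homogeneous with
  | h0 => simp
  | hadd x y hx hy =>
    rw [map_add, map_add, map_add]
    conv_rhs => rw [← hx, ← hy]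
    abel
  | hmem i x hx =>
    simp only [g.proj_of_mem_comp _ hx, Set.mem_ofPred_eq, Set.mem_singleton_iff]
    rcases lt_trichotomy i 0 with h | h | h
    · rw [if_neg (by omega), if_neg (by omega), if_pos (by omega)]; simp
    · rw [if_neg (by omega), if_pos (by omega), if_neg (by omega)]; simp
    · rw [if_pos (by omega), if_neg (by omega), if_neg (by omega)]; simp

lemma mid_mem (X : 𝔤) : g.mid X ∈ g.comp 0 := by
  have := g.proj_mem {0} X
  simpa using this

lemma plus_mem (X : 𝔤) : g.plus X ∈ g.pPlus := g.proj_mem _ X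

lemma plus_eq_self {X : 𝔤} (hX : X ∈ g.pPlus) : g.plus X = X := g.proj_eq_self_of_mem subset_rfl hX

lemma mid_lie_mem {X Y : 𝔤} (hX : X ∈ g.comp 0) (hY : Y ∈ g.pPlus) : ⁅X, Y⁆ ∈ g.pPlus :=
  g.lie_mem_iSup (S := {0}) (T := {i | 1 ≤ i}) (U := {i | 1 ≤ i})
    (by rintro i rfl j hj; simpa using hj) (by simpa using hX) hY

variable [FiniteDimensional ℝ 𝔤] [LieAlgebra.IsKilling ℝ 𝔤]

/-- The Killing form pairs 𝔤_i only with 𝔤_{−i}, so transposition negates the degrees. -/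
lemma isKillingAdjoint_proj {S T : Set ℤ} (h : ∀ i, i ∈ S ↔ -i ∈ T) :
    IsKillingAdjoint (g.proj S) (g.proj T) := by
  classical
  intro X Y
  induction X using g.induction_homogeneous with
  | h0 => simp
  | hadd x y hx hy => simp only [map_add, LinearMap.add_apply, hx, hy]
  | hmem i x hx =>
    induction Y using g.induction_homogeneous with
    | h0 => simp
    | hadd x y hx hy => simp only [map_add, hx, hy]
    | hmem j y hy =>
      by_cases hij : i + j = 0
      · obtain rfl : j = -i := by omega
        rw [g.proj_of_mem_comp S hx, g.proj_of_mem_comp T hy]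
        by_cases hi : i ∈ S
        · rw [if_pos hi, if_pos ((h i).1 hi)]
        · rw [if_neg hi, if_neg (fun hh => hi ((h i).2 hh))]; simp
      · rw [g.proj_of_mem_comp S hx, g.proj_of_mem_comp T hy]
        split_ifs <;> simp [g.killingForm_comp_eq_zero hij hx hy]

lemma isKillingAdjoint_plus : IsKillingAdjoint g.plus g.minus :=
  g.isKillingAdjoint_proj fun i => by simp only [Set.mem_ofPred_eq]; omega

lemma isKillingAdjoint_minus : IsKillingAdjoint g.minus g.plus := g.isKillingAdjoint_plus.symm

lemma isKillingAdjoint_mid : IsKillingAdjoint g.mid g.mid :=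
  g.isKillingAdjoint_proj fun i => by simp

/-- An element commuting with the grading element has degree zero. -/
lemma mem_comp_zero_of_gradingElement_lie_eq_zero {X : 𝔤} (hX : ⁅g.gradingElement, X⁆ = 0) :
    X ∈ g.comp 0 := by
  classical
  have key : ∀ i : ℤ, i ≠ 0 → g.proj {i} X = 0 := by
    intro i hi
    have h : ∀ Y, g.proj {i} ⁅g.gradingElement, Y⁆ = (i : ℝ) • g.proj {i} Y := by
      intro Y
      induction Y using g.induction_homogeneous with
      | h0 => simp
      | hadd x y hx hy => rw [lie_add, map_add, map_add, hx, hy, smul_add]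
      | hmem j y hy =>
        rw [g.gradingElement_lie hy, map_smul, g.proj_of_mem_comp _ hy]
        split_ifs with hj
        · rw [Set.mem_singleton_iff.mp hj]
        · simp
    have h1 := h X
    rw [hX, map_zero] at h1
    exact (smul_eq_zero.mp h1.symm).resolve_left (by exact_mod_cast hi)
  have h2 : ∀ Y, g.proj {0} Y + g.proj {i | i ≠ 0} Y = Y := by
    intro Y
    induction Y using g.induction_homogeneous with
    | h0 => simp
    | hadd x y hx hy =>
      rw [map_add, map_add]
      conv_rhs => rw [← hx, ← hy]
      abel
    | hmem j y hy =>
      rw [g.proj_of_mem_comp _ hy, g.proj_of_mem_comp _ hy]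
      by_cases hj : j = 0 <;> simp [hj]
  -- By nondegeneracy it suffices to pair with homogeneous elements. One of degree j sees only the
  -- component of X of degree −j, which `key` kills when j ≠ 0.
  have h3 : g.proj {i | i ≠ 0} X = 0 := by
    refine killingForm_eq_iff fun Z => ?_
    induction Z using g.induction_homogeneous with
    | h0 => simp
    | hadd x y hx hy => rw [map_add, map_add, hx, hy]
    | hmem j y hy =>
      have e : IsKillingAdjoint (g.proj {i | i ≠ 0}) (g.proj {i | i ≠ 0}) :=
        g.isKillingAdjoint_proj fun i => by simp
      have e' : IsKillingAdjoint (g.proj {-j}) (g.proj {j}) :=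
        g.isKillingAdjoint_proj fun i => by simp; omega
      by_cases hj : j = 0
      · rw [e, g.proj_eq_zero _ (by simpa using hj) hy]; simp
      · rw [e, g.proj_eq_self _ (by simpa using hj) hy]
        rw [← g.proj_eq_self {j} rfl hy, ← e', key _ (by omega), map_zero, LinearMap.zero_apply,
          LinearMap.zero_apply]
  rw [← h2 X, h3, add_zero]
  exact g.mid_mem X

end Projections

end ParabolicGrading

/-! ### The Kostant Laplacian and the action of the parabolic subalgebra -/

section KostantFormula

variable {𝔤 : Type*} [LieRing 𝔤] [LieAlgebra ℝ 𝔤] (g : ParabolicGrading 𝔤)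
  {V : Type*} [AddCommGroup V] [Module ℝ V] (θ : 𝔤 →ₗ[ℝ] V →ₗ[ℝ] V)

/-- The projection of `𝔤` onto `𝔭₊`, as a map to the subtype. -/
def ParabolicGrading.projPlus : 𝔤 →ₗ[ℝ] g.pPlus :=
  g.plus.codRestrict g.pPlus.toSubmodule g.plus_mem

lemma ParabolicGrading.coe_projPlus (X : 𝔤) : (g.projPlus X : 𝔤) = g.plus X := rfl

lemma ParabolicGrading.projPlus_coe (Z : g.pPlus) : g.projPlus (Z : 𝔤) = Z :=
  Subtype.ext (g.plus_eq_self Z.2)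

variable (V) in
/-- Exterior multiplication by the `𝔭₊`-component of an element of `𝔤`. -/
def extMul (k : ℕ) : 𝔤 →ₗ[ℝ] Forms g.pPlus V k →ₗ[ℝ] Forms g.pPlus V (k + 1) :=
  Forms.leftMul V k ∘ₗ g.projPlus

lemma extMul_coe (k : ℕ) (Z : g.pPlus) (φ : Forms g.pPlus V k) :
    extMul g V k (Z : 𝔤) φ = Forms.leftMul V k Z φ := by
  change Forms.leftMul V k (g.projPlus (Z : 𝔤)) φ = _
  rw [g.projPlus_coe]

lemma extMul_extMul (k : ℕ) (X Y : 𝔤) (φ : Forms g.pPlus V k) :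
    extMul g V (k + 1) X (extMul g V k Y φ) = -extMul g V (k + 1) Y (extMul g V k X φ) :=
  Forms.leftMul_leftMul k _ _ φ

lemma forms_hom_ext_succ {N : Type*} [AddCommGroup N] [Module ℝ N] {k : ℕ}
    {f h : Forms g.pPlus V (k + 1) →ₗ[ℝ] N}
    (H : ∀ Z ∈ g.pPlus, ∀ φ, f (extMul g V k Z φ) = h (extMul g V k Z φ)) : f = h :=
  Forms.hom_ext_succ fun Z φ => by rw [← extMul_coe, H _ Z.2]

/-- The endomorphism `Z ↦ [X, Z]_+` of `𝔭₊`. -/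
def adProj : 𝔤 →ₗ[ℝ] g.pPlus →ₗ[ℝ] g.pPlus :=
  ((lieBilin 𝔤).compl₂ g.pPlus.toSubmodule.subtype).compr₂ g.projPlus

lemma adProj_apply (X : 𝔤) (Z : g.pPlus) : adProj g X Z = g.projPlus ⁅X, (Z : 𝔤)⁆ := rfl

/-- The derivation of `Λ^k 𝔭₊ ⊗ V` by which an element of `𝔤` acts; on `𝔭` this is the natural
action. -/
def formAct (k : ℕ) : 𝔤 →ₗ[ℝ] Module.End ℝ (Forms g.pPlus V k) where
  toFun X := Forms.derivation (adProj g X) (θ X) k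
  map_add' X Y := by
    induction k with
    | zero =>
      refine Forms.hom_ext_zero fun v => ?_
      simp [Forms.derivation_unit]
    | succ k ih =>
      refine Forms.hom_ext_succ fun Z φ => ?_
      rw [LinearMap.add_apply, Forms.derivation_leftMul, Forms.derivation_leftMul,
        Forms.derivation_leftMul, ih]
      simp only [map_add, LinearMap.add_apply]
      abel
  map_smul' c X := by
    induction k with
    | zero =>
      refine Forms.hom_ext_zero fun v => ?_
      simp [Forms.derivation_unit]
    | succ k ih =>
      refine Forms.hom_ext_succ fun Z φ => ?_
      rw [LinearMap.smul_apply, Forms.derivation_leftMul, Forms.derivation_leftMul, ih]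
      simp only [map_smul, LinearMap.smul_apply, smul_add, RingHom.id_apply]

lemma formAct_unit (X : 𝔤) (v : V) :
    formAct g θ 0 X (Forms.unit g.pPlus V v) = Forms.unit g.pPlus V (θ X v) :=
  Forms.derivation_unit (adProj g X) (θ X) v

lemma formAct_extMul (k : ℕ) (X Y : 𝔤) (φ : Forms g.pPlus V k) :
    formAct g θ (k + 1) X (extMul g V k Y φ) =
      extMul g V k ⁅X, g.plus Y⁆ φ + extMul g V k Y (formAct g θ k X φ) :=
  Forms.derivation_leftMul (adProj g X) (θ X) k (g.projPlus Y) φ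

variable [FiniteDimensional ℝ 𝔤] [LieAlgebra.IsKilling ℝ 𝔤]

local notation "ξ" => lieBasis 𝔤
local notation "η" => lieDualBasis 𝔤

lemma kostantCodifferential_zero_extMul (X : 𝔤) (v : V) :
    kostantCodifferential g θ 0 (extMul g V 0 X (Forms.unit g.pPlus V v)) =
      -formAct g θ 0 (g.plus X) (Forms.unit g.pPlus V v) := by
  rw [formAct_unit]
  exact homologyDifferential_zero_leftMul _ _ v

lemma kostantCodifferential_extMul (k : ℕ) (X : 𝔤) (φ : Forms g.pPlus V (k + 1)) :
    kostantCodifferential g θ (k + 1) (extMul g V (k + 1) X φ) =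
      -formAct g θ (k + 1) (g.plus X) φ -
        extMul g V k X (kostantCodifferential g θ k φ) := by
  refine (homologyDifferential_leftMul _ k (g.projPlus X) φ).trans ?_
  have h : adProj g (g.plus X) = lieBilin g.pPlus (g.projPlus X) :=
    LinearMap.ext fun Z => g.projPlus_coe ⁅g.projPlus X, Z⁆
  change _ = -Forms.derivation (adProj g (g.plus X)) (θ (g.plus X)) (k + 1) φ - _
  rw [h]
  rfl

lemma killingEquiv_apply (Z : g.pPlus) (X : g.gMinus) :
    g.killingEquiv Z X = killingForm ℝ 𝔤 (Z : 𝔤) (X : 𝔤) := rfl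

lemma killingForm_plus_gMinus (Y : 𝔤) (X : g.gMinus) :
    killingForm ℝ 𝔤 (g.plus Y) (X : 𝔤) = killingForm ℝ 𝔤 Y (X : 𝔤) := by
  rw [g.isKillingAdjoint_plus, g.proj_eq_self_of_mem (T := {i | i < 0}) subset_rfl X.2]

/-- ∂v is the map X ↦ Xv on 𝔤₋; expand X as ∑ B(ξ_ℓ, X) η^ℓ. -/
lemma kostantDifferential_unit (v : V) :
    kostantDifferential g θ 0 (Forms.unit g.pPlus V v) =
      ∑ ℓ, extMul g V 0 (ξ ℓ) (Forms.unit g.pPlus V (θ (η ℓ) v)) := by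
  rw [kostantDifferential, LinearMap.comp_apply, LinearEquiv.coe_coe, LinearEquiv.symm_apply_eq,
    map_sum]
  ext X
  have h1 : ∀ w : V, Forms.toAlternating g.killingEquiv V 0 (Forms.unit g.pPlus V w) =
      AlternatingMap.constOfIsEmpty ℝ g.gMinus (Fin 0) w := by
    intro w
    ext Y
    rw [Forms.unit, Forms.toAlternating_wedge]
    simp
  have h2 : ∀ (Y : 𝔤) (w : V), Forms.toAlternating g.killingEquiv V 1
      (extMul g V 0 Y (Forms.unit g.pPlus V w)) X = killingForm ℝ 𝔤 Y (X 0 : 𝔤) • w := by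
    intro Y w
    change Forms.toAlternating g.killingEquiv V 1
      (Forms.leftMul V 0 (g.projPlus Y) (Forms.unit g.pPlus V w)) X = _
    rw [toAlternating_leftMul, AlternatingMap.alternatizeUncurryFin_apply, h1]
    simp [killingEquiv_apply, g.coe_projPlus, killingForm_plus_gMinus]
  rw [LinearMap.comp_apply, LinearEquiv.coe_coe, h1]
  change actionSum _ _ X = _
  have h3 : ∀ f : Fin (Module.finrank ℝ 𝔤) → g.gMinus [⋀^Fin 1]→ₗ[ℝ] V,
      (∑ ℓ, f ℓ) X = ∑ ℓ, f ℓ X := fun f =>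
    map_sum (⟨⟨fun α => α X, fun _ _ => rfl⟩, fun _ _ => rfl⟩ :
      (g.gMinus [⋀^Fin 1]→ₗ[ℝ] V) →ₗ[ℝ] V) f _
  rw [actionSum_apply, h3]
  have h4 : θ (X 0) v = ∑ ℓ, killingForm ℝ 𝔤 (ξ ℓ) (X 0 : 𝔤) • θ (η ℓ) v := by
    conv_lhs => rw [← sum_killingForm_basis_smul (X 0 : 𝔤)]
    simp
  simp only [h2, ← h4]
  simp
  rfl

/-- For ζ = B(Z, ·), invariance of B gives ζ([X, Y]) = −∑ B(ξ_ℓ, X) B([η^ℓ, Z], Y), which makes dζ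
explicit. The factor 1/2 compensates the double counting of pairs in an iterated wedge. -/
lemma kostantDifferential_extMul (k : ℕ) {Z : 𝔤} (hZ : Z ∈ g.pPlus) (φ : Forms g.pPlus V k) :
    kostantDifferential g θ (k + 1) (extMul g V k Z φ) =
      (1 / 2 : ℝ) • ∑ ℓ, extMul g V (k + 1) (ξ ℓ) (extMul g V k ⁅η ℓ, Z⁆ φ) -
        extMul g V (k + 1) Z (kostantDifferential g θ k φ) := by
  set T := fun k => Forms.toAlternating g.killingEquiv V k
  have hT : ∀ (k : ℕ) (Y : 𝔤) (ψ : Forms g.pPlus V k), T (k + 1) (extMul g V k Y ψ) =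
      wedgeForm (g.killingEquiv (g.projPlus Y)) (T k ψ) :=
    fun k Y ψ => toAlternating_leftMul _ k _ ψ
  have hd : ∀ (k : ℕ) (ψ : Forms g.pPlus V k), T (k + 1) (kostantDifferential g θ k ψ) =
      cohomologyDifferential (θ ∘ₗ g.gMinus.toSubmodule.subtype) k (T k ψ) := fun k ψ =>
    LinearEquiv.apply_symm_apply _ _
  apply (T (k + 2)).injective
  rw [map_sub, map_smul, map_sum, hd, hT, hT, hd, cohomologyDifferential_wedgeForm]
  congr 1
  rw [wedgeFormDifferential_eq_sum (ι := Fin (Module.finrank ℝ 𝔤)) _ _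
    (fun ℓ => g.killingEquiv (g.projPlus (ξ ℓ)))
    (fun ℓ => -g.killingEquiv (g.projPlus ⁅η ℓ, Z⁆))]
  · rw [neg_smul, ← smul_neg, ← Finset.sum_neg_distrib]
    congr 1
    refine Finset.sum_congr rfl fun ℓ _ => ?_
    rw [hT, hT, ← map_neg, ← map_neg]
    have h1 : ∀ (Y : 𝔤) (α : g.gMinus [⋀^Fin k]→ₗ[ℝ] V),
        wedgeForm (g.killingEquiv (g.projPlus (-Y))) α =
        -wedgeForm (g.killingEquiv (g.projPlus Y)) α := by
      intro Y α
      rw [wedgeForm, wedgeForm, ← AlternatingMap.alternatizeUncurryFinLM_apply,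
        ← AlternatingMap.alternatizeUncurryFinLM_apply, ← map_neg]
      congr 1
      ext; simp
    have h2 : ∀ (ζ : g.gMinus →ₗ[ℝ] ℝ) (α : g.gMinus [⋀^Fin (k + 1)]→ₗ[ℝ] V),
        -wedgeForm ζ (-α) = wedgeForm ζ α := by
      intro ζ α
      rw [wedgeForm, wedgeForm, ← AlternatingMap.alternatizeUncurryFinLM_apply,
        ← AlternatingMap.alternatizeUncurryFinLM_apply, ← map_neg]
      congr 1
      ext; simp
    rw [h1, h2]
  · intro X Y
    simp only [LinearMap.neg_apply, mul_neg, killingEquiv_apply, g.coe_projPlus,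
      killingForm_plus_gMinus, g.plus_eq_self hZ, LieSubalgebra.coe_bracket]
    have h3 : ∀ A : 𝔤, killingForm ℝ 𝔤 ⁅A, Z⁆ (Y : 𝔤) = killingForm ℝ 𝔤 A ⁅Z, (Y : 𝔤)⁆ :=
      fun A => LieModule.traceForm_apply_lie_apply ℝ 𝔤 𝔤 A Z Y
    have h4 : ∑ ℓ, killingForm ℝ 𝔤 (ξ ℓ) (X : 𝔤) * killingForm ℝ 𝔤 ⁅η ℓ, Z⁆ (Y : 𝔤) =
        killingForm ℝ 𝔤 (X : 𝔤) ⁅Z, (Y : 𝔤)⁆ := by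
      conv_rhs => rw [← sum_killingForm_basis_smul (X : 𝔤)]
      simp [h3]
    have h5 : ⁅Z, (X : 𝔤)⁆ = -⁅(X : 𝔤), Z⁆ := (lie_skew _ _).symm
    rw [Finset.sum_neg_distrib, h4, ← LieModule.traceForm_apply_lie_apply,
      ← LieModule.traceForm_apply_lie_apply, h5, map_neg, LinearMap.neg_apply]

end KostantFormula

/-! ### The trace identity in 𝔤 behind Kostant's formula -/

section Laplacian

variable {𝔤 : Type*} [LieRing 𝔤] [LieAlgebra ℝ 𝔤] [FiniteDimensional ℝ 𝔤]
  [LieAlgebra.IsKilling ℝ 𝔤] (g : ParabolicGrading 𝔤)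
  {V : Type*} [AddCommGroup V] [Module ℝ V] (θ : 𝔤 →ₗ[ℝ] V →ₗ[ℝ] V)

local notation "ξ" => lieBasis 𝔤
local notation "η" => lieDualBasis 𝔤
local notation "ad" => lieBilin 𝔤

/-- The element `∑_i [Z^i, X_i]` of `𝔤_0`, for dual bases `(X_i)` of `𝔤₋` and `(Z^i)` of `𝔭₊`. -/
def ParabolicGrading.shift : 𝔤 := ∑ ℓ, ⁅g.plus (ξ ℓ), η ℓ⁆

lemma killingForm_lie_left (X Y Z : 𝔤) :
    killingForm ℝ 𝔤 ⁅X, Y⁆ Z = -killingForm ℝ 𝔤 Y ⁅X, Z⁆ := by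
  exact (isKillingAdjoint_lieBilin X Y Z).trans (map_neg (killingForm ℝ 𝔤 Y) _)

/-- Pairing a contracted double bracket with X produces a trace, so identities between such brackets
reduce to cyclicity and transposition. -/
lemma killingForm_sum_lie_lie (S T : 𝔤 →ₗ[ℝ] 𝔤) {S' : 𝔤 →ₗ[ℝ] 𝔤} (hS : IsKillingAdjoint S S')
    (X Z : 𝔤) : killingForm ℝ 𝔤 (∑ ℓ, ⁅T (ξ ℓ), S ⁅η ℓ, Z⁆⁆) X =
      LinearMap.trace ℝ 𝔤 (ad Z ∘ₗ S' ∘ₗ ad X ∘ₗ T) := by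
  rw [← sum_killingForm_eq_trace, map_sum, LinearMap.sum_apply]
  refine Finset.sum_congr rfl fun ℓ _ => ?_
  have h1 : ∀ A B : 𝔤, ⁅A, B⁆ = -⁅B, A⁆ := fun A B => (lie_skew A B).symm
  change _ = killingForm ℝ 𝔤 ⁅Z, S' ⁅X, T (ξ ℓ)⁆⁆ (η ℓ)
  rw [killingForm_lie_left, killingForm_lie_left, hS, h1 (η ℓ) Z, h1 (T (ξ ℓ)) X, map_neg,
    map_neg, map_neg, LinearMap.neg_apply, neg_neg, LieModule.traceForm_comm]

/-- The left side is what the Casimir of 𝔤_0 minus the shift does to the factor Z, the right side is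
what 2□ does to it. After pairing with X and writing a = ad Z, b = ad X and p, o, m for the
projections to 𝔭₊, 𝔤_0, 𝔤₋, the claim is tr(abo) − tr(abp) + tr(abm) + tr(ambp) = 0. Besides
transposition, the input is that ad Z maps 𝔭₊ ⊕ 𝔤_0 into 𝔭₊, that is (1 − p)a(1 − m) = 0. -/
lemma sum_lie_lie_sub_shift_lie {Z : 𝔤} (hZ : Z ∈ g.pPlus) :
    ∑ ℓ, ⁅g.mid (ξ ℓ), ⁅g.mid (η ℓ), Z⁆⁆ - ⁅g.shift, Z⁆ =
      -∑ ℓ, ⁅g.plus (ξ ℓ), g.plus ⁅η ℓ, Z⁆⁆ := by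
  rw [← sub_eq_zero, sub_neg_eq_add]
  refine killingForm_eq_iff fun X => ?_
  have e1 : ∑ ℓ, ⁅g.mid (ξ ℓ), ⁅g.mid (η ℓ), Z⁆⁆ =
      ∑ ℓ, ⁅g.mid (ξ ℓ), (LinearMap.id : 𝔤 →ₗ[ℝ] 𝔤) ⁅η ℓ, Z⁆⁆ := by
    refine Eq.trans (sum_comp_isKillingAdjoint (ad ∘ₗ g.mid) (ad) g.isKillingAdjoint_mid
      Z).symm ?_
    refine Finset.sum_congr rfl fun ℓ _ => ?_
    change ⁅g.mid (g.mid (ξ ℓ)), _⁆ = _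
    rw [g.proj_proj]; rfl
  set a : Module.End ℝ 𝔤 := ad Z with ha
  set b : Module.End ℝ 𝔤 := ad X with hb
  set p : Module.End ℝ 𝔤 := g.plus with hp
  set o : Module.End ℝ 𝔤 := g.mid with ho
  set m : Module.End ℝ 𝔤 := g.minus with hm
  have hpom : p + o + m = 1 := LinearMap.ext g.plus_add_mid_add_minus
  have e2 : killingForm ℝ 𝔤 ⁅g.shift, Z⁆ X =
      LinearMap.trace ℝ 𝔤 (a * b * p) - LinearMap.trace ℝ 𝔤 (b * a * p) := by
    have h1 : killingForm ℝ 𝔤 ⁅g.shift, Z⁆ X = killingForm ℝ 𝔤 g.shift ⁅Z, X⁆ :=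
      LieModule.traceForm_apply_lie_apply ℝ 𝔤 𝔤 g.shift Z X
    rw [h1, ParabolicGrading.shift, map_sum, LinearMap.sum_apply, ← map_sub,
      ← sum_killingForm_eq_trace]
    refine Finset.sum_congr rfl fun ℓ _ => ?_
    rw [killingForm_lie_left, ← map_neg, lie_skew, LieModule.traceForm_comm, lie_lie]
    rfl
  -- Transposition reverses products, exchanges p and m, and negates a and b; here and in `f2` the
  -- two signs cancel.
  have f1 : LinearMap.trace ℝ 𝔤 (b * a * p) = LinearMap.trace ℝ 𝔤 (a * b * m) := by
    have h := (((isKillingAdjoint_lieBilin X).comp (isKillingAdjoint_lieBilin Z)).comp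
      g.isKillingAdjoint_plus).trace_eq
    refine h.trans ?_
    rw [LinearMap.neg_comp, LinearMap.comp_neg, LinearMap.comp_neg, LinearMap.comp_neg, neg_neg]
    exact LinearMap.trace_mul_comm ℝ m (a * b)
  have f2 : LinearMap.trace ℝ 𝔤 (a * m * b) = LinearMap.trace ℝ 𝔤 (a * b * p) := by
    have h := (((isKillingAdjoint_lieBilin Z).comp g.isKillingAdjoint_minus).comp
      (isKillingAdjoint_lieBilin X)).trace_eq
    refine h.trans ?_
    rw [LinearMap.neg_comp, LinearMap.comp_neg, LinearMap.comp_neg, neg_neg]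
    change LinearMap.trace ℝ 𝔤 (b * (p * a)) = _
    rw [LinearMap.trace_mul_comm, mul_assoc, LinearMap.trace_mul_comm]
  have f3 : (1 - p) * a * (1 - m) = 0 := by
    have h : 1 - m = p + o := by rw [← hpom]; abel
    rw [h]
    refine LinearMap.ext fun Y => ?_
    have h2 : ⁅Z, p Y + o Y⁆ ∈ g.pPlus := by
      rw [lie_add]
      refine add_mem (g.pPlus.lie_mem hZ (g.plus_mem Y)) ?_
      rw [← lie_skew]
      exact neg_mem (g.mid_lie_mem (g.mid_mem Y) hZ)
    change ⁅Z, p Y + o Y⁆ - p ⁅Z, p Y + o Y⁆ = 0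
    rw [sub_eq_zero]
    exact (g.plus_eq_self h2).symm
  -- Expanded by `f5` and reduced by `f2`, this trace reads tr(ab) − 2 tr(abp) + tr(ambp); splitting
  -- tr(ab) by `f7` gives the claim.
  have f4 : LinearMap.trace ℝ 𝔤 ((1 - p) * a * (1 - m) * b) = 0 := by
    rw [f3, zero_mul, map_zero]
  have f5 : (1 - p) * a * (1 - m) * b = a * b - p * (a * b) - a * m * b + p * (a * m * b) := by
    noncomm_ring
  have f6 : a * b = a * b * p + a * b * o + a * b * m := by
    rw [← mul_add, ← mul_add, hpom, mul_one]
  have f7 := congrArg (LinearMap.trace ℝ 𝔤) f6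
  rw [f5, map_add, map_sub, map_sub, LinearMap.trace_mul_comm ℝ p (a * b),
    LinearMap.trace_mul_comm ℝ p (a * m * b), f2] at f4
  rw [map_add, map_add] at f7
  have g1 := killingForm_sum_lie_lie LinearMap.id g.mid isKillingAdjoint_id X Z
  have g2 := killingForm_sum_lie_lie g.plus g.plus g.isKillingAdjoint_plus X Z
  rw [← e1] at g1
  rw [map_add, map_sub, LinearMap.add_apply, LinearMap.sub_apply, g1, g2, e2, f1, map_zero,
    LinearMap.zero_apply]
  change LinearMap.trace ℝ 𝔤 (a * b * o) - (LinearMap.trace ℝ 𝔤 (a * b * p) -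
    LinearMap.trace ℝ 𝔤 (a * b * m)) + LinearMap.trace ℝ 𝔤 (a * m * b * p) = 0
  linarith

end Laplacian

/-! ### The commutator of the action of 𝔭₊ with ∂ -/

section LaplacianFormula

variable {𝔤 : Type*} [LieRing 𝔤] [LieAlgebra ℝ 𝔤] [FiniteDimensional ℝ 𝔤]
  [LieAlgebra.IsKilling ℝ 𝔤] (g : ParabolicGrading 𝔤)
  {V : Type*} [AddCommGroup V] [Module ℝ V] (θ : 𝔤 →ₗ[ℝ] V →ₗ[ℝ] V)

local notation "ξ" => lieBasis 𝔤
local notation "η" => lieDualBasis 𝔤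
local notation "ad" => lieBilin 𝔤

section Anticommuting

variable {A B C : Type*} [AddCommGroup A] [Module ℝ A] [AddCommGroup B] [Module ℝ B]
  [AddCommGroup C] [Module ℝ C] (f : 𝔤 →ₗ[ℝ] B →ₗ[ℝ] C) (h : 𝔤 →ₗ[ℝ] A →ₗ[ℝ] B) (a : A)

lemma isKillingAdjoint_id_sub_plus :
    IsKillingAdjoint (LinearMap.id - g.plus) (LinearMap.id - g.minus) :=
  isKillingAdjoint_id.sub g.isKillingAdjoint_plus

lemma sum_lie_comp_lie (Z W : 𝔤) :
    ∑ ℓ, f ⁅Z, ξ ℓ⁆ (h ⁅η ℓ, W⁆ a) = ∑ ℓ, f (ξ ℓ) (h ⁅⁅η ℓ, Z⁆, W⁆ a) := by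
  refine (sum_comp_isKillingAdjoint f (h ∘ₗ (ad).flip W)
    (isKillingAdjoint_lieBilin Z) a).trans (Finset.sum_congr rfl fun ℓ _ => ?_)
  change f (ξ ℓ) (h ⁅-⁅Z, η ℓ⁆, W⁆ a) = _
  rw [lie_skew]

lemma sum_lie_sub_minus_comp_lie (Z W : 𝔤) :
    ∑ ℓ, f ⁅W, η ℓ - g.minus (η ℓ)⁆ (h ⁅Z, ξ ℓ⁆ a) =
      ∑ ℓ, f (ξ ℓ) (h ⁅Z, ⁅η ℓ, W⁆ - g.plus ⁅η ℓ, W⁆⁆ a) := by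
  refine (sum_comp_swap (f ∘ₗ ad W ∘ₗ (LinearMap.id - g.minus)) (h ∘ₗ ad Z) a).symm.trans ?_
  rw [← neg_inj, ← Finset.sum_neg_distrib, ← Finset.sum_neg_distrib]
  refine Eq.trans ?_ ((sum_comp_isKillingAdjoint f (h ∘ₗ ad Z)
    ((isKillingAdjoint_id_sub_plus g).comp (isKillingAdjoint_lieBilin W)).symm a).trans ?_)
  · refine Finset.sum_congr rfl fun ℓ _ => ?_
    change -f (ad W (ξ ℓ - g.minus (ξ ℓ))) (h (ad Z (η ℓ)) a) =
      f (-ad W (ξ ℓ - g.minus (ξ ℓ))) (h (ad Z (η ℓ)) a)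
    rw [map_neg, LinearMap.neg_apply]
  · refine Finset.sum_congr rfl fun ℓ _ => ?_
    change f (ξ ℓ) (h ⁅Z, ⁅W, η ℓ⁆ - g.plus ⁅W, η ℓ⁆⁆ a) = _
    rw [← lie_skew W (η ℓ), map_neg, ← neg_sub', lie_neg, map_neg, LinearMap.neg_apply, map_neg]

/-- With f and h two successive exterior multiplications, this compares Z· with ∂ on the quadratic
term ½ ∑ ξ_ℓ ∧ [η^ℓ, W]. The bracket [η^ℓ, [Z, W]] is expanded by Jacobi and ad Z is moved across
the contraction. Anticommutation then identifies the two sums in which a 𝔭₊-component is removed. -/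
lemma sum_anticommuting_lie (hf : ∀ X Y, f X (h Y a) = -f Y (h X a)) (Z W : 𝔤) :
    -∑ ℓ, f ⁅Z, ξ ℓ - g.plus (ξ ℓ)⁆ (h ⁅η ℓ, W⁆ a) =
      (1 / 2 : ℝ) • (∑ ℓ, f ⁅Z, g.plus (ξ ℓ)⁆ (h ⁅η ℓ, W⁆ a) +
        ∑ ℓ, f (ξ ℓ) (h ⁅Z, g.plus ⁅η ℓ, W⁆⁆ a)) -
      (1 / 2 : ℝ) • ∑ ℓ, f (ξ ℓ) (h ⁅η ℓ, ⁅Z, W⁆⁆ a) := by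
  have s1 : ∑ ℓ, f (ξ ℓ) (h ⁅η ℓ, ⁅Z, W⁆⁆ a) =
      ∑ ℓ, f (ξ ℓ) (h ⁅⁅η ℓ, Z⁆, W⁆ a) + ∑ ℓ, f (ξ ℓ) (h ⁅Z, ⁅η ℓ, W⁆⁆ a) := by
    simp only [leibniz_lie (η _) Z W, map_add, LinearMap.add_apply, Finset.sum_add_distrib]
  have s2 := sum_lie_comp_lie f h a Z W
  have s3 := sum_lie_sub_minus_comp_lie g f h a Z W
  have s4 : ∑ ℓ, f ⁅W, η ℓ - g.minus (η ℓ)⁆ (h ⁅Z, ξ ℓ⁆ a) =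
      ∑ ℓ, f ⁅Z, ξ ℓ - g.plus (ξ ℓ)⁆ (h ⁅η ℓ, W⁆ a) := by
    refine Eq.trans ?_ (sum_comp_isKillingAdjoint (f ∘ₗ ad Z) (h ∘ₗ (ad).flip W)
      (isKillingAdjoint_id_sub_plus g) a).symm
    refine Finset.sum_congr rfl fun ℓ _ => ?_
    rw [hf, ← map_neg, ← LinearMap.neg_apply, ← map_neg, lie_skew]
    rfl
  rw [s1, ← s2]
  rw [s3] at s4
  simp only [lie_sub, map_sub, LinearMap.sub_apply, Finset.sum_sub_distrib] at s4 ⊢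
  rw [eq_add_of_sub_eq s4]
  module

end Anticommuting

/-- The action of `𝔭₊` commutes with `∂` up to terms of higher degree. -/
lemma formAct_kostantDifferential (hθ : ∀ X Y v, θ ⁅X, Y⁆ v = θ X (θ Y v) - θ Y (θ X v))
    (k : ℕ) {Z : 𝔤} (hZ : Z ∈ g.pPlus) (φ : Forms g.pPlus V k) :
    formAct g θ (k + 1) Z (kostantDifferential g θ k φ) -
        kostantDifferential g θ k (formAct g θ k Z φ) =
      -∑ ℓ, extMul g V k ⁅Z, ξ ℓ - g.plus (ξ ℓ)⁆ (formAct g θ k (η ℓ) φ) := by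
  induction k with
  | zero =>
    -- The identity is recast as an equality of linear maps, so that it can be checked on
    -- generators; the same device recurs in the inductive step and in Kostant's formula.
    let lhs := formAct g θ 1 Z ∘ₗ kostantDifferential g θ 0 -
      kostantDifferential g θ 0 ∘ₗ formAct g θ 0 Z
    let rhs := -∑ ℓ, extMul g V 0 ⁅Z, ξ ℓ - g.plus (ξ ℓ)⁆ ∘ₗ formAct g θ 0 (η ℓ)
    have key : lhs = rhs := by
      refine Forms.hom_ext_zero fun v => ?_
      simp only [lhs, rhs, LinearMap.sub_apply, LinearMap.comp_apply, LinearMap.neg_apply,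
        LinearMap.sum_apply, formAct_unit, kostantDifferential_unit, map_sum, formAct_extMul]
      have h1 : ∑ ℓ, extMul g V 0 (ξ ℓ) (Forms.unit g.pPlus V (θ ⁅Z, η ℓ⁆ v)) =
          -∑ ℓ, extMul g V 0 ⁅Z, ξ ℓ⁆ (Forms.unit g.pPlus V (θ (η ℓ) v)) := by
        have := sum_comp_isKillingAdjoint (extMul g V 0)
          (θ.compr₂ (Forms.unit g.pPlus V)) (isKillingAdjoint_lieBilin Z) v
        rw [← neg_eq_iff_eq_neg]
        simpa using! this.symm
      simp only [hθ, map_sub, lie_sub, LinearMap.sub_apply, Finset.sum_sub_distrib,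
        Finset.sum_add_distrib] at h1 ⊢
      rw [add_sub_assoc, h1]
      abel
    have := LinearMap.congr_fun key φ
    simpa [lhs, rhs] using this
  | succ k ih =>
    let lhs := formAct g θ (k + 2) Z ∘ₗ kostantDifferential g θ (k + 1) -
      kostantDifferential g θ (k + 1) ∘ₗ formAct g θ (k + 1) Z
    let rhs := -∑ ℓ, extMul g V (k + 1) ⁅Z, ξ ℓ - g.plus (ξ ℓ)⁆ ∘ₗ formAct g θ (k + 1) (η ℓ)
    have key : lhs = rhs := by
      refine forms_hom_ext_succ g fun W hW φ => ?_
      simp only [lhs, rhs, LinearMap.sub_apply, LinearMap.comp_apply, LinearMap.neg_apply,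
        LinearMap.sum_apply, formAct_extMul, g.plus_eq_self hW, map_add, map_sub,
        kostantDifferential_extMul g θ k hW, map_smul, map_sum,
        kostantDifferential_extMul g θ k (g.pPlus.lie_mem hZ hW)]
      have hK := congrArg (extMul g V (k + 1) W) (ih φ)
      rw [map_sub, map_neg, map_sum] at hK
      have r := sum_anticommuting_lie g (extMul g V (k + 1)) (extMul g V k) φ
        (fun X Y => extMul_extMul g k X Y φ) Z W
      simp only [extMul_extMul g k _ W, Finset.sum_add_distrib, Finset.sum_neg_distrib]
      -- By the Leibniz rules for Z· and ∂, what is left is the quadratic term treated by `r` and W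
      -- ∧ applied to the induction hypothesis.
      linear_combination (norm := module) (-1 : ℝ) • r - hK
    have := LinearMap.congr_fun key φ
    simpa [lhs, rhs] using this

end LaplacianFormula

/-! ### Kostant's formula -/

section KostantTheorem

variable {𝔤 : Type*} [LieRing 𝔤] [LieAlgebra ℝ 𝔤] [FiniteDimensional ℝ 𝔤]
  [LieAlgebra.IsKilling ℝ 𝔤] (g : ParabolicGrading 𝔤)
  {V : Type*} [AddCommGroup V] [Module ℝ V] (θ : 𝔤 →ₗ[ℝ] V →ₗ[ℝ] V)

local notation "ξ" => lieBasis 𝔤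
local notation "η" => lieDualBasis 𝔤
local notation "ad" => lieBilin 𝔤

/-- The contraction of a bilinear map with the Killing form, decomposed according to
`𝔤 = 𝔤₋ ⊕ 𝔤_0 ⊕ 𝔭₊`. -/
lemma sum_eq_sum_plus_add_sum_mid_add_sum_plus {N : Type*} [AddCommGroup N] [Module ℝ N]
    (β : 𝔤 →ₗ[ℝ] 𝔤 →ₗ[ℝ] N) :
    ∑ ℓ, β (ξ ℓ) (η ℓ) = ∑ ℓ, β (g.plus (ξ ℓ)) (η ℓ) + ∑ ℓ, β (g.mid (ξ ℓ)) (g.mid (η ℓ)) +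
      ∑ ℓ, β (η ℓ) (g.plus (ξ ℓ)) := by
  have h1 : ∑ ℓ, β (g.mid (ξ ℓ)) (g.mid (η ℓ)) = ∑ ℓ, β (g.mid (ξ ℓ)) (η ℓ) := by
    refine (sum_isKillingAdjoint (β ∘ₗ g.mid) g.isKillingAdjoint_mid).symm.trans ?_
    simp [g.proj_proj]
  have h2 : ∑ ℓ, β (η ℓ) (g.plus (ξ ℓ)) = ∑ ℓ, β (g.minus (ξ ℓ)) (η ℓ) := by
    rw [sum_isKillingAdjoint β g.isKillingAdjoint_minus]
    exact (sum_swap (β.compl₂ g.plus)).symm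
  rw [h1, h2, ← Finset.sum_add_distrib, ← Finset.sum_add_distrib]
  refine Finset.sum_congr rfl fun ℓ _ => ?_
  conv_lhs => rw [← g.plus_add_mid_add_minus (ξ ℓ)]
  simp

lemma kostantCodifferential_sum_extMul (k : ℕ) (Z : 𝔤) (φ : Forms g.pPlus V (k + 1)) :
    kostantCodifferential g θ (k + 2) (∑ ℓ, extMul g V (k + 2) (ξ ℓ) (extMul g V (k + 1) ⁅η ℓ, Z⁆ φ)) =
      ∑ ℓ, (-extMul g V (k + 1) ⁅g.plus (ξ ℓ), g.plus ⁅η ℓ, Z⁆⁆ φ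
        - extMul g V (k + 1) ⁅η ℓ, Z⁆ (formAct g θ (k + 1) (g.plus (ξ ℓ)) φ)
        + extMul g V (k + 1) (ξ ℓ) (formAct g θ (k + 1) (g.plus ⁅η ℓ, Z⁆) φ)
        + extMul g V (k + 1) (ξ ℓ) (extMul g V k ⁅η ℓ, Z⁆ (kostantCodifferential g θ k φ))) := by
  rw [map_sum]
  refine Finset.sum_congr rfl fun ℓ _ => ?_
  rw [kostantCodifferential_extMul, kostantCodifferential_extMul, formAct_extMul, map_sub, map_neg]
  abel

lemma kostantCodifferential_sum_extMul_zero (Z : 𝔤) (φ : Forms g.pPlus V 0) :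
    kostantCodifferential g θ 1 (∑ ℓ, extMul g V 1 (ξ ℓ) (extMul g V 0 ⁅η ℓ, Z⁆ φ)) =
      ∑ ℓ, (-extMul g V 0 ⁅g.plus (ξ ℓ), g.plus ⁅η ℓ, Z⁆⁆ φ
        - extMul g V 0 ⁅η ℓ, Z⁆ (formAct g θ 0 (g.plus (ξ ℓ)) φ)
        + extMul g V 0 (ξ ℓ) (formAct g θ 0 (g.plus ⁅η ℓ, Z⁆) φ)) := by
  rw [map_sum]
  refine Finset.sum_congr rfl fun ℓ _ => ?_
  have h : ∀ Y : 𝔤, kostantCodifferential g θ 0 (extMul g V 0 Y φ) =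
      -formAct g θ 0 (g.plus Y) φ := fun Y =>
    LinearMap.congr_fun (f := kostantCodifferential g θ 0 ∘ₗ extMul g V 0 Y)
      (g := -formAct g θ 0 (g.plus Y))
      (Forms.hom_ext_zero fun v => kostantCodifferential_zero_extMul g θ Y v) φ
  rw [kostantCodifferential_extMul, h, formAct_extMul, map_neg]
  abel

/-- From the recursions for ∂ and ∂*. The terms ½ ∑ ξ_ℓ ∧ [η^ℓ, Z] ∧ ∂*φ arise from ∂∂* and from ∂*∂
with opposite signs and cancel (for k = 0 they do not occur). There remain the commutator of Z· with
∂ and the other part of ∂* of the quadratic term. -/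
lemma kostantLaplacian_extMul_aux
    (k : ℕ) {Z : 𝔤} (hZ : Z ∈ g.pPlus) (φ : Forms g.pPlus V k) :
    kostantLaplacian g θ (k + 1) (extMul g V k Z φ) =
      extMul g V k Z (kostantLaplacian g θ k φ) +
      (formAct g θ (k + 1) Z (kostantDifferential g θ k φ) -
        kostantDifferential g θ k (formAct g θ k Z φ)) +
      (1 / 2 : ℝ) • ∑ ℓ, (-extMul g V k ⁅g.plus (ξ ℓ), g.plus ⁅η ℓ, Z⁆⁆ φ
        - extMul g V k ⁅η ℓ, Z⁆ (formAct g θ k (g.plus (ξ ℓ)) φ)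
        + extMul g V k (ξ ℓ) (formAct g θ k (g.plus ⁅η ℓ, Z⁆) φ)) := by
  cases k with
  | zero =>
    have h : kostantCodifferential g θ 0 (extMul g V 0 Z φ) =
        -formAct g θ 0 Z φ := by
      have := LinearMap.congr_fun (f := kostantCodifferential g θ 0 ∘ₗ extMul g V 0 Z)
        (g := -formAct g θ 0 (g.plus Z))
        (Forms.hom_ext_zero fun v => kostantCodifferential_zero_extMul g θ Z v) φ
      rwa [g.plus_eq_self hZ] at this
    simp only [kostantLaplacian, LinearMap.add_apply, LinearMap.comp_apply]
    rw [h, kostantDifferential_extMul g θ 0 hZ, map_sub, map_smul,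
      kostantCodifferential_sum_extMul_zero, kostantCodifferential_extMul, g.plus_eq_self hZ,
      map_neg]
    module
  | succ k =>
    simp only [kostantLaplacian, LinearMap.add_apply, LinearMap.comp_apply]
    rw [kostantCodifferential_extMul g θ k, g.plus_eq_self hZ, map_sub,
      kostantDifferential_extMul g θ k hZ, kostantDifferential_extMul g θ (k + 1) hZ, map_sub,
      map_smul, kostantCodifferential_sum_extMul, kostantCodifferential_extMul, g.plus_eq_self hZ,
      map_neg, map_add, Finset.sum_add_distrib]
    module

/-- Each of the two sums containing an action in `kostantLaplacian_extMul_aux` contributes ∑ [Z,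
(ξ_ℓ)_−] ∧ η^ℓ·φ. Half of their total cancels the 𝔤₋-part of the commutator of Z· with ∂, so only
the first-order term from 𝔤_0 survives, as it must for an operator built from the action of 𝔤_0. -/
lemma kostantLaplacian_extMul (hθ : ∀ X Y v, θ ⁅X, Y⁆ v = θ X (θ Y v) - θ Y (θ X v))
    (k : ℕ) {Z : 𝔤} (hZ : Z ∈ g.pPlus) (φ : Forms g.pPlus V k) :
    (2 : ℝ) • kostantLaplacian g θ (k + 1) (extMul g V k Z φ) =
      (2 : ℝ) • extMul g V k Z (kostantLaplacian g θ k φ) -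
      (2 : ℝ) • ∑ ℓ, extMul g V k ⁅Z, g.mid (ξ ℓ)⁆ (formAct g θ k (η ℓ) φ) -
      ∑ ℓ, extMul g V k ⁅g.plus (ξ ℓ), g.plus ⁅η ℓ, Z⁆⁆ φ := by
  have h1 : ∑ ℓ, extMul g V k (ξ ℓ) (formAct g θ k (g.plus ⁅η ℓ, Z⁆) φ) =
      ∑ ℓ, extMul g V k ⁅Z, g.minus (ξ ℓ)⁆ (formAct g θ k (η ℓ) φ) := by
    rw [← neg_inj, ← Finset.sum_neg_distrib, ← Finset.sum_neg_distrib]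
    refine Eq.trans ?_ ((sum_comp_isKillingAdjoint (extMul g V k) (formAct g θ k)
      (g.isKillingAdjoint_plus.comp (isKillingAdjoint_lieBilin Z)).symm φ).symm.trans ?_)
    · refine Finset.sum_congr rfl fun ℓ _ => ?_
      change _ = extMul g V k (ξ ℓ) (formAct g θ k (g.plus ⁅Z, η ℓ⁆) φ)
      rw [← lie_skew Z (η ℓ), map_neg, map_neg, LinearMap.neg_apply, map_neg]
    · refine Finset.sum_congr rfl fun ℓ _ => ?_
      change extMul g V k (-⁅Z, g.minus (ξ ℓ)⁆) (formAct g θ k (η ℓ) φ) = _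
      rw [map_neg, LinearMap.neg_apply]
  have h2 : -∑ ℓ, extMul g V k ⁅η ℓ, Z⁆ (formAct g θ k (g.plus (ξ ℓ)) φ) =
      ∑ ℓ, extMul g V k ⁅Z, g.minus (ξ ℓ)⁆ (formAct g θ k (η ℓ) φ) := by
    refine Eq.trans ?_ (sum_comp_isKillingAdjoint (extMul g V k ∘ₗ ad Z) (formAct g θ k)
      g.isKillingAdjoint_minus φ).symm
    refine Eq.trans ?_ (sum_comp_swap (extMul g V k ∘ₗ ad Z) (formAct g θ k ∘ₗ g.plus) φ).symm
    rw [← Finset.sum_neg_distrib]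
    refine Finset.sum_congr rfl fun ℓ _ => ?_
    rw [← LinearMap.neg_apply, ← map_neg, lie_skew]
    rfl
  have h3 : ∑ ℓ, extMul g V k ⁅Z, ξ ℓ - g.plus (ξ ℓ)⁆ (formAct g θ k (η ℓ) φ) =
      ∑ ℓ, extMul g V k ⁅Z, g.mid (ξ ℓ)⁆ (formAct g θ k (η ℓ) φ) +
      ∑ ℓ, extMul g V k ⁅Z, g.minus (ξ ℓ)⁆ (formAct g θ k (η ℓ) φ) := by
    rw [← Finset.sum_add_distrib]
    refine Finset.sum_congr rfl fun ℓ _ => ?_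
    have : ξ ℓ - g.plus (ξ ℓ) = g.mid (ξ ℓ) + g.minus (ξ ℓ) := by
      rw [sub_eq_iff_eq_add]
      conv_lhs => rw [← g.plus_add_mid_add_minus (ξ ℓ)]
      abel
    rw [this, lie_add, map_add, LinearMap.add_apply]
  rw [kostantLaplacian_extMul_aux g θ k hZ, formAct_kostantDifferential g θ hθ k hZ, h3,
    Finset.sum_add_distrib, Finset.sum_sub_distrib, Finset.sum_neg_distrib, h1]
  rw [neg_eq_iff_eq_neg] at h2
  rw [h2]
  module

/-- Kostant's formula for the Laplacian in terms of the action of `𝔤_0`. -/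
theorem kostantLaplacian_formula (hθ : ∀ X Y v, θ ⁅X, Y⁆ v = θ X (θ Y v) - θ Y (θ X v))
    {c : ℝ} (hc : ∀ v, casimir θ v = c • v) (k : ℕ) (φ : Forms g.pPlus V k) :
    (2 : ℝ) • kostantLaplacian g θ k φ + c • φ =
      ∑ ℓ, formAct g θ k (g.mid (ξ ℓ)) (formAct g θ k (g.mid (η ℓ)) φ) -
        formAct g θ k g.shift φ := by
  induction k with
  | zero =>
    let lhs := (2 : ℝ) • kostantLaplacian g θ 0 + c • LinearMap.id
    let rhs := ∑ ℓ, formAct g θ 0 (g.mid (ξ ℓ)) ∘ₗ formAct g θ 0 (g.mid (η ℓ)) -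
        formAct g θ 0 g.shift
    have key : lhs = rhs := by
      refine Forms.hom_ext_zero fun v => ?_
      have h1 := sum_eq_sum_plus_add_sum_mid_add_sum_plus g (compBilin θ θ v)
      have h2 : ∑ ℓ, compBilin θ θ v (ξ ℓ) (η ℓ) = c • v := by
        rw [← hc, casimir, LinearMap.sum_apply]
        rfl
      -- Reordering the products so that 𝔭₊ acts last costs the brackets that sum to the shift. The
      -- reordered sum is −□ on V.
      have h3 : ∑ ℓ, compBilin θ θ v (η ℓ) (g.plus (ξ ℓ)) =
          ∑ ℓ, compBilin θ θ v (g.plus (ξ ℓ)) (η ℓ) - θ g.shift v := by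
        rw [ParabolicGrading.shift, map_sum, LinearMap.sum_apply, ← Finset.sum_sub_distrib]
        refine Finset.sum_congr rfl fun ℓ _ => ?_
        rw [hθ]
        exact (sub_sub_cancel _ _).symm
      rw [h2, h3] at h1
      have h4 := congrArg (Forms.unit g.pPlus V) h1
      simp only [map_add, map_sub, map_smul, map_sum] at h4
      simp only [lhs, rhs, LinearMap.sub_apply, LinearMap.comp_apply, LinearMap.add_apply,
        LinearMap.smul_apply, LinearMap.sum_apply, formAct_unit, kostantLaplacian,
        kostantDifferential_unit, map_sum, kostantCodifferential_zero_extMul,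
        LinearMap.id_apply, h4, Finset.sum_neg_distrib]
      change _ • -∑ ℓ, (Forms.unit g.pPlus V) (θ (g.plus (ξ ℓ)) (θ (η ℓ) v)) +
        (∑ ℓ, (Forms.unit g.pPlus V) (θ (g.plus (ξ ℓ)) (θ (η ℓ) v)) +
        ∑ ℓ, (Forms.unit g.pPlus V) (θ (g.mid (ξ ℓ)) (θ (g.mid (η ℓ)) v)) +
        (∑ ℓ, (Forms.unit g.pPlus V) (θ (g.plus (ξ ℓ)) (θ (η ℓ) v)) - _)) = _
      module
    have := LinearMap.congr_fun key φ
    simpa [lhs, rhs] using this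
  | succ k ih =>
    let lhs := (2 : ℝ) • kostantLaplacian g θ (k + 1) + c • LinearMap.id
    let rhs := ∑ ℓ, formAct g θ (k + 1) (g.mid (ξ ℓ)) ∘ₗ formAct g θ (k + 1) (g.mid (η ℓ)) -
        formAct g θ (k + 1) g.shift
    have key : lhs = rhs := by
      refine forms_hom_ext_succ g fun Z hZ φ => ?_
      simp only [lhs, rhs, LinearMap.sub_apply, LinearMap.comp_apply, LinearMap.add_apply,
        LinearMap.smul_apply, LinearMap.sum_apply, LinearMap.id_apply,
        kostantLaplacian_extMul g θ hθ k hZ]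
      have h0 := congrArg (extMul g V k Z) (ih φ)
      rw [map_add, map_smul, map_smul, map_sub, map_sum] at h0
      have h1 := congrArg (fun Y => extMul g V k Y φ) (sum_lie_lie_sub_shift_lie g hZ)
      simp only [map_sub, map_sum, map_neg, LinearMap.sub_apply, LinearMap.sum_apply,
        LinearMap.neg_apply] at h1
      have h2 : ∀ X, ⁅g.mid X, Z⁆ ∈ g.pPlus := fun X => g.mid_lie_mem (g.mid_mem X) hZ
      -- The cross terms of the second-order operator applied to Z ∧ φ. By `h4` the two of them
      -- agree, which matches the factor 2 in `kostantLaplacian_extMul`.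
      have h3 : ∑ ℓ, extMul g V k ⁅g.mid (ξ ℓ), Z⁆ (formAct g θ k (g.mid (η ℓ)) φ) =
          -∑ ℓ, extMul g V k ⁅Z, g.mid (ξ ℓ)⁆ (formAct g θ k (η ℓ) φ) := by
        refine Eq.trans (sum_comp_isKillingAdjoint (extMul g V k ∘ₗ (ad).flip Z ∘ₗ g.mid)
          (formAct g θ k) g.isKillingAdjoint_mid φ).symm ?_
        rw [← Finset.sum_neg_distrib]
        refine Finset.sum_congr rfl fun ℓ _ => ?_
        change extMul g V k ⁅g.mid (g.mid (ξ ℓ)), Z⁆ _ = _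
        rw [g.proj_proj, ← lie_skew, map_neg, LinearMap.neg_apply]
      have h4 : ∑ ℓ, extMul g V k ⁅g.mid (η ℓ), Z⁆ (formAct g θ k (g.mid (ξ ℓ)) φ) =
          ∑ ℓ, extMul g V k ⁅g.mid (ξ ℓ), Z⁆ (formAct g θ k (g.mid (η ℓ)) φ) :=
        (sum_comp_swap (extMul g V k ∘ₗ (ad).flip Z ∘ₗ g.mid) (formAct g θ k ∘ₗ g.mid) φ).symm
      simp only [formAct_extMul, map_add, g.plus_eq_self hZ, g.plus_eq_self (h2 _),
        Finset.sum_add_distrib, h4, h3]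
      linear_combination (norm := module) h0 - h1
    have := LinearMap.congr_fun key φ
    simpa [lhs, rhs] using this

end KostantTheorem

/-! ### The action and the filtration by degree -/

section Filtration

variable {𝔤 : Type*} [LieRing 𝔤] [LieAlgebra ℝ 𝔤] [FiniteDimensional ℝ 𝔤]
  [LieAlgebra.IsKilling ℝ 𝔤] (g : ParabolicGrading 𝔤)
  {V : Type*} [AddCommGroup V] [Module ℝ V] (θ : 𝔤 →ₗ[ℝ] V →ₗ[ℝ] V)

/-- Acting by 𝔤_i raises E-eigenvalues on V and degrees in 𝔭₊ by i. For i ≥ 0 the bracket of X with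
𝔭₊ stays in 𝔭₊, so the projection in `adProj` has no effect. -/
lemma formAct_mem_span_homogeneousForms
    (hθ : ∀ X Y v, θ ⁅X, Y⁆ v = θ X (θ Y v) - θ Y (θ X v)) (k : ℕ) {i : ℤ} (hi : 0 ≤ i)
    {X : 𝔤} (hX : X ∈ g.comp i) {c : ℝ} {w : Forms g.pPlus V k}
    (hw : w ∈ homogeneousForms g θ k c) :
    formAct g θ k X w ∈ Submodule.span ℝ (homogeneousForms g θ k (c + i)) := by
  obtain ⟨Z, n, v, b, hZ, hv, rfl, rfl⟩ := hw
  have hXv : θ g.gradingElement (θ X v) = (b + i) • θ X v := by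
    have h := hθ g.gradingElement X v
    rw [g.gradingElement_lie hX, hv, map_smul, map_smul, LinearMap.smul_apply,
      eq_sub_iff_add_eq] at h
    rw [← h, add_smul, add_comm]
  cases k with
  | zero =>
    rw [Forms.wedge_zero, formAct_unit, ← Forms.wedge_zero Z]
    exact Submodule.subset_span ⟨Z, n, θ X v, b + i, hZ, hXv, by simp, rfl⟩
  | succ k =>
    change Forms.derivation (adProj g X) (θ X) (k + 1) _ ∈ _
    rw [Forms.derivation_wedge]
    refine add_mem (Submodule.sum_mem _ fun j _ => ?_) ?_
    · refine zsmul_mem (Submodule.subset_span ?_) _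
      refine ⟨_, Fin.cons (i + n j) (j.removeNth n), v, b, ?_, hv, ?_, rfl⟩
      · have h : ⁅X, (Z j : 𝔤)⁆ ∈ g.pPlus :=
          g.lie_mem_iSup (S := {i}) (T := {i | 1 ≤ i}) (U := {i | 1 ≤ i})
            (by rintro _ rfl j hj; simp only [Set.mem_ofPred_eq] at *; omega)
            (by simpa using hX) (Z j).2
        intro l
        refine Fin.cases ?_ (fun l => ?_) l
        · simp only [Matrix.cons_val_zero, Fin.cons_zero, adProj_apply, g.coe_projPlus,
            g.plus_eq_self h]
          exact g.lie_mem hX (hZ j)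
        · exact hZ (j.succAbove l)
      · rw [Fin.sum_univ_succAbove _ j, Fin.sum_univ_succ (fun l => ((Fin.cons (i + n j) (j.removeNth n) : Fin (k + 1) → ℤ) l : ℝ))]
        have h1 : (Fin.cons (i + n j) (j.removeNth n) : Fin (k + 1) → ℤ) 0 = i + n j := rfl
        have h2 : ∀ l : Fin k, (Fin.cons (i + n j) (j.removeNth n) : Fin (k + 1) → ℤ) l.succ =
            n (j.succAbove l) := fun l => rfl
        simp only [h1, h2]
        push_cast
        ring
    · exact Submodule.subset_span ⟨Z, n, θ X v, b + i, hZ, hXv, by ring, rfl⟩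

lemma map_mem_span_biUnion {N : Type*} [AddCommGroup N] [Module ℝ N] {H : ℝ → Set N}
    {S S' : Set ℝ} {i : ℝ} {T : N →ₗ[ℝ] N} (hS : ∀ c ∈ S, c + i ∈ S')
    (hT : ∀ c, ∀ w ∈ H c, T w ∈ Submodule.span ℝ (H (c + i))) {w : N}
    (hw : w ∈ Submodule.span ℝ (⋃ c ∈ S, H c)) : T w ∈ Submodule.span ℝ (⋃ c ∈ S', H c) := by
  revert w
  change Submodule.span ℝ (⋃ c ∈ S, H c) ≤ (Submodule.span ℝ (⋃ c ∈ S', H c)).comap T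
  rw [Submodule.span_le]
  intro w hw
  obtain ⟨c, hc, hw⟩ := Set.mem_iUnion₂.mp hw
  exact Submodule.span_mono (Set.subset_biUnion_of_mem (u := H) (hS c hc)) (hT c w hw)

lemma formAct_mem_formFiltration
    (hθ : ∀ X Y v, θ ⁅X, Y⁆ v = θ X (θ Y v) - θ Y (θ X v)) (k : ℕ) (a : ℝ)
    {X : 𝔤} (hX : X ∈ g.comp 0) {w : Forms g.pPlus V k}
    (hw : w ∈ formFiltration g θ k a) : formAct g θ k X w ∈ formFiltration g θ k a :=
  map_mem_span_biUnion (i := ((0 : ℤ) : ℝ)) (fun c hc => by simpa using hc)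
    (fun c w hw => formAct_mem_span_homogeneousForms g θ hθ k le_rfl hX hw) hw

lemma formAct_mem_formFiltrationNext
    (hθ : ∀ X Y v, θ ⁅X, Y⁆ v = θ X (θ Y v) - θ Y (θ X v)) (k : ℕ) (a : ℝ)
    {X : 𝔤} (hX : X ∈ g.comp 0) {w : Forms g.pPlus V k}
    (hw : w ∈ formFiltrationNext g θ k a) : formAct g θ k X w ∈ formFiltrationNext g θ k a :=
  map_mem_span_biUnion (i := ((0 : ℤ) : ℝ)) (fun c hc => by simpa using hc)
    (fun c w hw => formAct_mem_span_homogeneousForms g θ hθ k le_rfl hX hw) hw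

lemma formAct_pPlus_mem_formFiltrationNext
    (hθ : ∀ X Y v, θ ⁅X, Y⁆ v = θ X (θ Y v) - θ Y (θ X v)) (k : ℕ) (a : ℝ)
    {X : 𝔤} (hX : X ∈ g.pPlus) {w : Forms g.pPlus V k}
    (hw : w ∈ formFiltration g θ k a) : formAct g θ k X w ∈ formFiltrationNext g θ k a := by
  refine g.iSup_comp_induction (S := {i | 1 ≤ i})
    (p := fun X => formAct g θ k X w ∈ formFiltrationNext g θ k a) ?_ ?_ ?_ hX
  · simp
  · intro x y hx hy
    rw [map_add]
    exact add_mem hx hy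
  · intro i (hi : 1 ≤ i) x hx
    refine map_mem_span_biUnion (i := (i : ℝ)) (fun c hc => ?_)
      (fun c w hw => formAct_mem_span_homogeneousForms g θ hθ k (by omega) hx hw) hw
    have : (1 : ℝ) ≤ i := by exact_mod_cast hi
    simp only [Set.mem_Ici, Set.mem_Ioi] at *
    linarith

lemma formFiltrationNext_le (k : ℕ) (a : ℝ) :
    formFiltrationNext g θ k a ≤ formFiltration g θ k a :=
  Submodule.span_mono (Set.biUnion_subset_biUnion_left Set.Ioi_subset_Ici_self)

lemma gradingElement_lie_proj (S : Set ℤ) (X : 𝔤) :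
    ⁅g.gradingElement, g.proj S X⁆ = g.proj S ⁅g.gradingElement, X⁆ := by
  classical
  induction X using g.induction_homogeneous with
  | h0 => simp
  | hadd x y hx hy => simp only [map_add, lie_add, hx, hy]
  | hmem j y hy =>
    rw [g.gradingElement_lie hy, map_smul, g.proj_of_mem_comp _ hy]
    split_ifs with hj
    · rw [g.gradingElement_lie hy]
    · simp

/-- The contraction is invariant under ad E and the projection to 𝔭₊ commutes with ad E, so the
shift commutes with E. -/
lemma shift_mem : g.shift ∈ g.comp 0 := by
  refine g.mem_comp_zero_of_gradingElement_lie_eq_zero ?_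
  have h := sum_isKillingAdjoint (lieBilin 𝔤 ∘ₗ g.plus) (isKillingAdjoint_lieBilin g.gradingElement)
  rw [ParabolicGrading.shift, lie_sum]
  have h2 : ∀ ℓ, ⁅g.gradingElement, ⁅g.plus (lieBasis 𝔤 ℓ), lieDualBasis 𝔤 ℓ⁆⁆ =
      (lieBilin 𝔤 ∘ₗ g.plus) (lieBilin 𝔤 g.gradingElement (lieBasis 𝔤 ℓ)) (lieDualBasis 𝔤 ℓ) -
      (lieBilin 𝔤 ∘ₗ g.plus) (lieBasis 𝔤 ℓ)
        ((-lieBilin 𝔤 g.gradingElement) (lieDualBasis 𝔤 ℓ)) := by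
    intro ℓ
    rw [leibniz_lie, gradingElement_lie_proj, LinearMap.neg_apply, map_neg, sub_neg_eq_add]
    rfl
  simp only [h2, Finset.sum_sub_distrib, h, sub_self]

end Filtration

/-! ### Calculus of functions with values in finite dimensional vector spaces -/

section Calculus

variable {EX : Type*} [NormedAddCommGroup EX] [NormedSpace ℝ EX]
  {HX : Type*} [TopologicalSpace HX] {I : ModelWithCorners ℝ EX HX}
  {X : Type*} [TopologicalSpace X] [ChartedSpace HX X]
  {EY : Type*} [NormedAddCommGroup EY] [NormedSpace ℝ EY]
  {HY : Type*} [TopologicalSpace HY] {J : ModelWithCorners ℝ EY HY}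
  {Y : Type*} [TopologicalSpace Y] [ChartedSpace HY Y]
  {W : Type*} [AddCommGroup W] [Module ℝ W] [FiniteDimensional ℝ W]
  {W₁ : Type*} [AddCommGroup W₁] [Module ℝ W₁] [FiniteDimensional ℝ W₁]
  {W₂ : Type*} [AddCommGroup W₂] [Module ℝ W₂] [FiniteDimensional ℝ W₂]

/-- `f` is differentiable at `x` with derivative `D`, for a function `f` with values in a finite
dimensional vector space. -/
def HasVecDeriv (I : ModelWithCorners ℝ EX HX) (f : X → W) (x : X)
    (D : TangentSpace I x →ₗ[ℝ] W) : Prop :=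
  MDifferentiableAt I 𝓘(ℝ, Fin (Module.finrank ℝ W) → ℝ) (fun y => coords W (f y)) x ∧
    vectorDeriv I f x = D

lemma HasVecDeriv.vectorDeriv_eq {f : X → W} {x : X} {D : TangentSpace I x →ₗ[ℝ] W}
    (h : HasVecDeriv I f x D) : vectorDeriv I f x = D := h.2

/-- The infinitesimal identities for representations and sections below are obtained by
differentiating one function in two ways. -/
lemma HasVecDeriv.unique {f : X → W} {x : X} {D D' : TangentSpace I x →ₗ[ℝ] W}
    (h : HasVecDeriv I f x D) (h' : HasVecDeriv I f x D') : D = D' := h.2.symm.trans h'.2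

lemma hasVecDeriv_of_hasMFDerivAt {f : X → W} {x : X}
    {D : TangentSpace I x →L[ℝ] (Fin (Module.finrank ℝ W) → ℝ)}
    (h : HasMFDerivAt I 𝓘(ℝ, Fin (Module.finrank ℝ W) → ℝ) (fun y => coords W (f y)) x D) :
    HasVecDeriv I f x ((coords W).symm.toLinearMap ∘ₗ D.toLinearMap) := by
  refine ⟨h.mdifferentiableAt, ?_⟩
  rw [vectorDeriv, h.mfderiv]

lemma HasVecDeriv.hasMFDerivAt {f : X → W} {x : X} {D : TangentSpace I x →ₗ[ℝ] W}
    (h : HasVecDeriv I f x D) :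
    ∃ D' : TangentSpace I x →L[ℝ] (Fin (Module.finrank ℝ W) → ℝ),
      HasMFDerivAt I 𝓘(ℝ, Fin (Module.finrank ℝ W) → ℝ) (fun y => coords W (f y)) x D' ∧
      D = (coords W).symm.toLinearMap ∘ₗ D'.toLinearMap :=
  ⟨_, h.1.hasMFDerivAt, h.2.symm⟩

lemma IsSmooth.hasVecDeriv {f : X → W} (hf : IsSmooth I f) (x : X) :
    HasVecDeriv I f x (vectorDeriv I f x) :=
  ⟨hf.mdifferentiableAt (by simp), rfl⟩

lemma hasVecDeriv_const (w : W) (x : X) : HasVecDeriv I (fun _ => w) x 0 := by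
  have h := hasVecDeriv_of_hasMFDerivAt (I := I) (f := fun _ : X => w) (x := x)
    (hasMFDerivAt_const (I := I) (I' := 𝓘(ℝ, Fin (Module.finrank ℝ W) → ℝ)) (coords W w) x)
  convert h using 1
  refine LinearMap.ext fun v => ?_
  exact ((coords W).symm.map_zero).symm

/-- The coordinate expression of a linear map, as a continuous linear map. -/
def coordMap (T : W →ₗ[ℝ] W₁) :
    (Fin (Module.finrank ℝ W) → ℝ) →L[ℝ] (Fin (Module.finrank ℝ W₁) → ℝ) :=
  LinearMap.toContinuousLinearMap
    ((coords W₁).toLinearMap ∘ₗ T ∘ₗ (coords W).symm.toLinearMap)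

lemma coordMap_coords (T : W →ₗ[ℝ] W₁) (w : W) : coordMap T (coords W w) = coords W₁ (T w) := by
  simp [coordMap]

lemma coords_symm_coordMap (T : W →ₗ[ℝ] W₁) (w) :
    (coords W₁).symm (coordMap T w) = T ((coords W).symm w) := by
  simp [coordMap]

lemma HasVecDeriv.linear {f : X → W} {x : X} {D : TangentSpace I x →ₗ[ℝ] W}
    (h : HasVecDeriv I f x D) (T : W →ₗ[ℝ] W₁) :
    HasVecDeriv I (fun y => T (f y)) x (T ∘ₗ D) := by
  obtain ⟨D', hD', rfl⟩ := h.hasMFDerivAt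
  have h1 : HasMFDerivAt I 𝓘(ℝ, Fin (Module.finrank ℝ W₁) → ℝ)
      (fun y => coords W₁ (T (f y))) x ((coordMap T).comp D') := by
    have := HasMFDerivAt.comp x (coordMap T).hasMFDerivAt hD'
    refine this.congr_of_eventuallyEq (Filter.Eventually.of_forall fun y => ?_)
    simp [coordMap_coords]
  convert hasVecDeriv_of_hasMFDerivAt h1 using 1
  refine LinearMap.ext fun v => ?_
  exact (coords_symm_coordMap T (D' v)).symm

lemma IsSmooth.linear {f : X → W} (h : IsSmooth I f) (T : W →ₗ[ℝ] W₁) :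
    IsSmooth I (fun y => T (f y)) := by
  have := (coordMap T).contMDiff.comp h
  refine ContMDiff.congr this fun y => ?_
  simp [coordMap_coords]

/-- The coordinate expression of a bilinear map, as a continuous bilinear map. -/
def coordMap₂ (β : W →ₗ[ℝ] W₁ →ₗ[ℝ] W₂) :
    (Fin (Module.finrank ℝ W) → ℝ) →L[ℝ] (Fin (Module.finrank ℝ W₁) → ℝ) →L[ℝ]
      (Fin (Module.finrank ℝ W₂) → ℝ) :=
  LinearMap.toContinuousLinearMap (LinearMap.toContinuousLinearMap.toLinearMap ∘ₗ
    (β.compl₁₂ (coords W).symm.toLinearMap (coords W₁).symm.toLinearMap).compr₂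
      (coords W₂).toLinearMap)

lemma coordMap₂_coords (β : W →ₗ[ℝ] W₁ →ₗ[ℝ] W₂) (w : W) (w₁ : W₁) :
    coordMap₂ β (coords W w) (coords W₁ w₁) = coords W₂ (β w w₁) := by
  simp [coordMap₂]

lemma coords_symm_coordMap₂ (β : W →ₗ[ℝ] W₁ →ₗ[ℝ] W₂) (w w₁) :
    (coords W₂).symm (coordMap₂ β w w₁) = β ((coords W).symm w) ((coords W₁).symm w₁) := by
  simp [coordMap₂]

lemma HasVecDeriv.bilinear {f : X → W} {f₁ : X → W₁} {x : X} {D : TangentSpace I x →ₗ[ℝ] W}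
    {D₁ : TangentSpace I x →ₗ[ℝ] W₁} (h : HasVecDeriv I f x D) (h₁ : HasVecDeriv I f₁ x D₁)
    (β : W →ₗ[ℝ] W₁ →ₗ[ℝ] W₂) :
    HasVecDeriv I (fun y => β (f y) (f₁ y)) x (β (f x) ∘ₗ D₁ + β.flip (f₁ x) ∘ₗ D) := by
  obtain ⟨D', hD', rfl⟩ := h.hasMFDerivAt
  obtain ⟨D₁', hD₁', rfl⟩ := h₁.hasMFDerivAt
  have h2 : HasMFDerivAt I 𝓘(ℝ, (Fin (Module.finrank ℝ W) → ℝ) × (Fin (Module.finrank ℝ W₁) → ℝ))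
      (fun y => (coords W (f y), coords W₁ (f₁ y))) x (D'.prod D₁') :=
    ⟨hD'.1.prodMk hD₁'.1, hD'.2.prodMk hD₁'.2⟩
  have h3 := ((coordMap₂ β).isBoundedBilinearMap.hasFDerivAt
    (coords W (f x), coords W₁ (f₁ x))).hasMFDerivAt
  have h4 := HasMFDerivAt.comp x h3 h2
  have h5 : HasMFDerivAt I 𝓘(ℝ, Fin (Module.finrank ℝ W₂) → ℝ)
      (fun y => coords W₂ (β (f y) (f₁ y))) x
      (((coordMap₂ β).isBoundedBilinearMap.deriv
        (coords W (f x), coords W₁ (f₁ x))).comp (D'.prod D₁')) := by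
    refine h4.congr_of_eventuallyEq ?_
    refine Filter.Eventually.of_forall fun y => ?_
    simp [coordMap₂_coords]
  convert hasVecDeriv_of_hasMFDerivAt h5 using 1
  refine LinearMap.ext fun v => ?_
  change β (f x) ((coords W₁).symm (D₁' v)) + β ((coords W).symm (D' v)) (f₁ x) =
    (coords W₂).symm (coordMap₂ β (coords W (f x)) (D₁' v) +
      coordMap₂ β (D' v) (coords W₁ (f₁ x)))
  rw [map_add, coords_symm_coordMap₂, coords_symm_coordMap₂]
  simp

lemma HasVecDeriv.comp_manifold {f : Y → W} {φ : X → Y} {x : X}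
    {D : TangentSpace J (φ x) →ₗ[ℝ] W} (h : HasVecDeriv J f (φ x) D)
    (hφ : MDifferentiableAt I J φ x) :
    HasVecDeriv I (fun z => f (φ z)) x (D ∘ₗ (mfderiv I J φ x).toLinearMap) := by
  obtain ⟨D', hD', hD⟩ := h.hasMFDerivAt
  have h1 : HasMFDerivAt I 𝓘(ℝ, Fin (Module.finrank ℝ W) → ℝ)
      ((fun y => coords W (f y)) ∘ φ) x (D'.comp (mfderiv I J φ x)) :=
    HasMFDerivAt.comp x hD' hφ.hasMFDerivAt
  have h2 := hasVecDeriv_of_hasMFDerivAt (f := fun z => f (φ z)) h1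
  refine ⟨h2.1, h2.2.trans ?_⟩
  rw [hD]
  exact (LinearMap.comp_assoc (mfderiv I J φ x).toLinearMap D'.toLinearMap
    (coords W).symm.toLinearMap).symm

lemma HasVecDeriv.congr {f f' : X → W} {x : X} {D : TangentSpace I x →ₗ[ℝ] W}
    (h : HasVecDeriv I f x D) (hf : ∀ y, f' y = f y) : HasVecDeriv I f' x D := by
  rwa [show f' = f from funext hf]

lemma HasVecDeriv.add {f f' : X → W} {x : X} {D D' : TangentSpace I x →ₗ[ℝ] W}
    (h : HasVecDeriv I f x D) (h' : HasVecDeriv I f' x D') :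
    HasVecDeriv I (fun y => f y + f' y) x (D + D') := by
  obtain ⟨A, hA, rfl⟩ := h.hasMFDerivAt
  obtain ⟨A', hA', rfl⟩ := h'.hasMFDerivAt
  have h1 : HasMFDerivAt I 𝓘(ℝ, Fin (Module.finrank ℝ W) → ℝ)
      (fun y => coords W (f y + f' y)) x (A + A') := by
    have := hA.add hA'
    refine this.congr_of_eventuallyEq (Filter.Eventually.of_forall fun y => ?_)
    simp
  convert hasVecDeriv_of_hasMFDerivAt h1 using 1
  refine LinearMap.ext fun v => ?_
  exact (map_add (coords W).symm _ _).symm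

lemma HasVecDeriv.sum {ι : Type*} (s : Finset ι) {f : ι → X → W} {x : X}
    {D : ι → TangentSpace I x →ₗ[ℝ] W} (h : ∀ i, HasVecDeriv I (f i) x (D i)) :
    HasVecDeriv I (fun y => ∑ i ∈ s, f i y) x (∑ i ∈ s, D i) := by
  classical
  induction s using Finset.induction_on with
  | empty => simpa using hasVecDeriv_const (I := I) (0 : W) x
  | insert i s hi ih =>
    simp only [Finset.sum_insert hi]
    exact (h i).add ih

/-- A linear map depending on a point is differentiable if its values are. -/
lemma hasVecDeriv_of_apply {f : X → W →ₗ[ℝ] W₁} {x : X} {D : TangentSpace I x →ₗ[ℝ] W →ₗ[ℝ] W₁}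
    (h : ∀ w, HasVecDeriv I (fun y => f y w) x (D.flip w)) : HasVecDeriv I f x D := by
  let b := Module.finBasis ℝ W
  have hexp : ∀ T : W →ₗ[ℝ] W₁, T = ∑ i, (LinearMap.smulRightₗ (b.coord i)) (T (b i)) := by
    intro T
    refine b.ext fun j => ?_
    simp [LinearMap.sum_apply, Finsupp.single_apply]
  have h1 := HasVecDeriv.sum Finset.univ
    (fun i => (h (b i)).linear (LinearMap.smulRightₗ (b.coord i) : W₁ →ₗ[ℝ] W →ₗ[ℝ] W₁))
  have h2 := h1.congr (fun y => hexp (f y))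
  convert h2 using 1
  refine LinearMap.ext fun v => ?_
  rw [hexp (D v), LinearMap.sum_apply]
  rfl

lemma isSmooth_sum {ι : Type*} (s : Finset ι) {f : ι → X → W} (h : ∀ i, IsSmooth I (f i)) :
    IsSmooth I (fun y => ∑ i ∈ s, f i y) := by
  have : ContMDiff I 𝓘(ℝ, Fin (Module.finrank ℝ W) → ℝ) ∞
      (fun y => ∑ i ∈ s, coords W (f i y)) := contMDiff_finsetSum fun i _ => h i
  refine this.congr fun y => ?_
  simp

lemma isSmooth_of_apply {f : X → W →ₗ[ℝ] W₁} (h : ∀ w, IsSmooth I (fun y => f y w)) :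
    IsSmooth I f := by
  let b := Module.finBasis ℝ W
  have hexp : ∀ T : W →ₗ[ℝ] W₁, T = ∑ i, (LinearMap.smulRightₗ (b.coord i)) (T (b i)) := by
    intro T
    refine b.ext fun j => ?_
    simp [LinearMap.sum_apply, Finsupp.single_apply]
  have h1 := isSmooth_sum (I := I) Finset.univ
    (fun i => (h (b i)).linear (LinearMap.smulRightₗ (b.coord i) : W₁ →ₗ[ℝ] W →ₗ[ℝ] W₁))
  convert h1 using 1
  ext y : 1
  exact hexp (f y)

section Normed

variable {F : Type*} [NormedAddCommGroup F] [NormedSpace ℝ F] [FiniteDimensional ℝ F]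

lemma hasVecDeriv_of_hasMFDerivAt' {f : X → F} {x : X} {D : TangentSpace I x →L[ℝ] F}
    (h : HasMFDerivAt I 𝓘(ℝ, F) f x D) : HasVecDeriv I f x D.toLinearMap := by
  have h1 : HasMFDerivAt I 𝓘(ℝ, Fin (Module.finrank ℝ F) → ℝ) (fun y => coords F (f y)) x
      ((coords F).toLinearMap.toContinuousLinearMap.comp D) :=
    HasMFDerivAt.comp x (coords F).toLinearMap.toContinuousLinearMap.hasMFDerivAt h
  convert hasVecDeriv_of_hasMFDerivAt h1 using 1
  refine LinearMap.ext fun v => ?_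
  exact ((coords F).symm_apply_apply (D v)).symm

end Normed

end Calculus

/-! ### The adjoint action in a chart -/

section LocalGroup

variable {E : Type*} [NormedAddCommGroup E] [NormedSpace ℝ E]

/-- For a local multiplication `m` with unit `e` and conjugation `c (a, b) = a b a⁻¹`, the
derivative of the adjoint action at the unit is the antisymmetrized second derivative of `m`. -/
lemma hasFDerivAt_local_adjoint {m c : E × E → E} {e : E} (hm : ContDiffAt ℝ 2 m (e, e))
    (hc : ContDiffAt ℝ 2 c (e, e)) (hml : ∀ᶠ a in nhds e, m (e, a) = a)
    (hmr : ∀ᶠ a in nhds e, m (a, e) = a)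
    (hce : ∀ᶠ a in nhds e, c (a, e) = e)
    (hmc : ∀ᶠ p in nhds (e, e), m (c p, p.1) = m p) (Y : E) :
    ∃ D : E →L[ℝ] E, HasFDerivAt (fun a => fderiv ℝ c (a, e) (0, Y)) D e ∧
      ∀ X, D X = fderiv ℝ (fun a => fderiv ℝ m (a, e) (0, Y)) e (fderiv ℝ m (e, e) (0, X)) -
        fderiv ℝ (fun a => fderiv ℝ m (a, e) (0, X)) e (fderiv ℝ m (e, e) (0, Y)) := by
  have hm' : DifferentiableAt ℝ (fderiv ℝ m) (e, e) :=
    (hm.fderiv_right (m := 1) le_rfl).differentiableAt one_ne_zero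
  have hc' : DifferentiableAt ℝ (fderiv ℝ c) (e, e) :=
    (hc.fderiv_right (m := 1) le_rfl).differentiableAt one_ne_zero
  have hsymm : IsSymmSndFDerivAt ℝ m (e, e) := hm.isSymmSndFDerivAt (by simp)
  have hi : HasFDerivAt (fun a : E => (a, e)) (ContinuousLinearMap.inl ℝ E E) e :=
    hasFDerivAt_prodMk_left e e
  have hj : HasFDerivAt (fun a : E => (e, a)) (ContinuousLinearMap.inr ℝ E E) e :=
    hasFDerivAt_prodMk_right e e
  have hm1 : DifferentiableAt ℝ m (e, e) := hm.differentiableAt (by norm_num)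
  have hme : ∀ X, fderiv ℝ m (e, e) (0, X) = X := by
    intro X
    have h1 := (hm1.hasFDerivAt.comp e hj)
    have h2 : HasFDerivAt (m ∘ fun a : E => (e, a)) (ContinuousLinearMap.id ℝ E) e :=
      (hasFDerivAt_id e).congr_of_eventuallyEq hml
    exact congrArg (fun T : E →L[ℝ] E => T X) (h1.unique h2)
  have hme' : ∀ X, fderiv ℝ m (e, e) (X, 0) = X := by
    intro X
    have h1 := (hm1.hasFDerivAt.comp (f := fun a : E => (a, e)) e hi)
    have h2 : HasFDerivAt (m ∘ fun a : E => (a, e)) (ContinuousLinearMap.id ℝ E) e :=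
      (hasFDerivAt_id e).congr_of_eventuallyEq hmr
    exact congrArg (fun T : E →L[ℝ] E => T X) (h1.unique h2)
  have hL : ∀ Z, HasFDerivAt (fun a => fderiv ℝ m (a, e) (0, Z))
      (((fderiv ℝ (fderiv ℝ m) (e, e)).comp (ContinuousLinearMap.inl ℝ E E)).flip (0, Z)) e := by
    intro Z
    have := (hm'.hasFDerivAt.comp (f := fun a : E => (a, e)) e hi).clm_apply (hasFDerivAt_const ((0 : E), Z) e)
    rwa [ContinuousLinearMap.comp_zero, zero_add] at this
  have hA0 : HasFDerivAt (fun a => fderiv ℝ c (a, e) (0, Y))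
      (((fderiv ℝ (fderiv ℝ c) (e, e)).comp (ContinuousLinearMap.inl ℝ E E)).flip (0, Y)) e := by
    have := (hc'.hasFDerivAt.comp (f := fun a : E => (a, e)) e hi).clm_apply (hasFDerivAt_const ((0 : E), Y) e)
    rwa [ContinuousLinearMap.comp_zero, zero_add] at this
  -- The derivative of m(c(a, b), a) = m(a, b) in b at b = e, where c(a, e) = e. It is the local
  -- form of dR_a(Ad(a)Y) = dL_a(Y).
  have hconj : ∀ᶠ a in nhds e, fderiv ℝ m (e, a) (fderiv ℝ c (a, e) (0, Y), 0) =
      fderiv ℝ m (a, e) (0, Y) := by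
    have hcm : ∀ᶠ p in nhds (e, e), DifferentiableAt ℝ c p :=
      (hc.eventually (by simp)).mono fun p hp => hp.differentiableAt (by norm_num)
    have hmm : ∀ᶠ p in nhds (e, e), DifferentiableAt ℝ m p :=
      (hm.eventually (by simp)).mono fun p hp => hp.differentiableAt (by norm_num)
    have h1 := hi.continuousAt.eventually
      (hmc.eventually_nhds.and hcm)
    have h2 := hj.continuousAt.eventually hmm
    filter_upwards [h1, h2, hce] with a ⟨ha, hca⟩ hma hea
    have h3 : HasFDerivAt (fun p => (c p, p.1))
        ((fderiv ℝ c (a, e)).prod (ContinuousLinearMap.fst ℝ E E)) (a, e) :=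
      hca.hasFDerivAt.prodMk hasFDerivAt_fst
    have h4 : HasFDerivAt m (fderiv ℝ m (e, a)) (c (a, e), (a, e).1) := by
      rw [hea]; exact hma.hasFDerivAt
    have h5 := HasFDerivAt.comp (a, e) h4 h3
    have h6 : fderiv ℝ m (a, e) = _ :=
      (h5.congr_of_eventuallyEq (ha.mono fun p hp => hp.symm)).fderiv
    rw [h6]
    simp
  have hc0 : fderiv ℝ c (e, e) (0, Y) = Y := by
    have := hconj.self_of_nhds
    rwa [hme', hme] at this
  -- Differentiating `hconj` in a at e along X gives d²m((0, X), (Y, 0)) + D X = d²m((X, 0), (0,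
  -- Y)). Symmetry of d²m then turns D X into the commutator expression.
  have h7 := (hm'.hasFDerivAt.comp e hj).clm_apply (hA0.prodMk (hasFDerivAt_const (0 : E) e))
  have h8 := (h7.congr_of_eventuallyEq (hconj.mono fun p hp => hp.symm)).unique (hL Y)
  refine ⟨_, hA0, fun X => ?_⟩
  have h9 := congrArg (fun T : E →L[ℝ] E => T X) h8
  simp only [Function.comp_apply, add_apply, ContinuousLinearMap.comp_apply,
    ContinuousLinearMap.flip_apply, ContinuousLinearMap.prod_apply,
    zero_apply, hme', hc0, ContinuousLinearMap.inl_apply,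
    ContinuousLinearMap.inr_apply] at h9
  rw [hme, hme, (hL Y).fderiv, (hL X).fderiv]
  simp only [ContinuousLinearMap.comp_apply, ContinuousLinearMap.flip_apply,
    ContinuousLinearMap.inl_apply]
  rw [← h9, hsymm (Y, 0) (0, X)]
  abel

end LocalGroup

section Chart

variable {E : Type*} [NormedAddCommGroup E] [NormedSpace ℝ E] {X : Type*} [TopologicalSpace X]
  [ChartedSpace E X] {F : Type*} [NormedAddCommGroup F] [NormedSpace ℝ F]

lemma hasMFDerivAt_comp_extChartAt {f : E → F} {x : X} {D : E →L[ℝ] F}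
    (h : HasFDerivAt f D (extChartAt 𝓘(ℝ, E) x x)) :
    HasMFDerivAt 𝓘(ℝ, E) 𝓘(ℝ, F) (fun y => f (extChartAt 𝓘(ℝ, E) x y)) x D := by
  refine ⟨h.continuousAt.comp (continuousAt_extChartAt x), ?_⟩
  refine HasFDerivAt.hasFDerivWithinAt (h.congr_of_eventuallyEq ?_)
  filter_upwards [extChartAt_target_mem_nhds (I := 𝓘(ℝ, E)) x] with z hz
  simp only [writtenInExtChartAt, Function.comp_apply, extChartAt_model_space_eq_id,
    PartialEquiv.refl_coe, id]
  rw [(extChartAt 𝓘(ℝ, E) x).right_inv hz]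

/-- The chart expression of the value of a vector field that is the image of a vector under the
derivative of a map. -/
lemma inverse_mfderivWithin_extChartAt_symm [IsManifold 𝓘(ℝ, E) 1 X] {x : X} {a : E}
    (ha : a ∈ (extChartAt 𝓘(ℝ, E) x).target)
    (v : TangentSpace 𝓘(ℝ, E) ((extChartAt 𝓘(ℝ, E) x).symm a)) :
    (mfderivWithin 𝓘(ℝ, E) 𝓘(ℝ, E) (extChartAt 𝓘(ℝ, E) x).symm (Set.range 𝓘(ℝ, E)) a).inverse v =
      mfderiv 𝓘(ℝ, E) 𝓘(ℝ, E) (extChartAt 𝓘(ℝ, E) x) ((extChartAt 𝓘(ℝ, E) x).symm a) v := by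
  rw [ContinuousLinearMap.inverse_eq
    (mfderivWithin_extChartAt_symm_comp_mfderiv_extChartAt ha)
    (mfderiv_extChartAt_comp_mfderivWithin_extChartAt_symm ha)]
  rfl

/-- The tangent space at x is modelled on E through the preferred chart at x, so no change of
coordinates enters. -/
lemma mfderiv_extChartAt_self (x : X) :
    mfderiv 𝓘(ℝ, E) 𝓘(ℝ, E) (extChartAt 𝓘(ℝ, E) x) x = ContinuousLinearMap.id ℝ E :=
  (hasMFDerivAt_comp_extChartAt (hasFDerivAt_id _)).mfderiv

end Chart

section AdDeriv

variable {EG : Type*} [NormedAddCommGroup EG] [NormedSpace ℝ EG] [FiniteDimensional ℝ EG]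
  [CompleteSpace EG]
  {G : Type*} [TopologicalSpace G] [ChartedSpace EG G] [Group G] [LieGroup 𝓘(ℝ, EG) ∞ G]

variable (EG G) in
/-- The multiplication of a Lie group in the chart at the identity. -/
def localMul (p : EG × EG) : EG :=
  extChartAt 𝓘(ℝ, EG) (1 : G)
    ((extChartAt 𝓘(ℝ, EG) (1 : G)).symm p.1 * (extChartAt 𝓘(ℝ, EG) (1 : G)).symm p.2)

variable (EG G) in
/-- The conjugation `(a, b) ↦ a b a⁻¹` of a Lie group in the chart at the identity. -/
def localConj (p : EG × EG) : EG :=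
  extChartAt 𝓘(ℝ, EG) (1 : G)
    ((extChartAt 𝓘(ℝ, EG) (1 : G)).symm p.1 * (extChartAt 𝓘(ℝ, EG) (1 : G)).symm p.2 *
      ((extChartAt 𝓘(ℝ, EG) (1 : G)).symm p.1)⁻¹)

variable (EG G) in
/-- The coordinates of the identity. -/
def localOne : EG := extChartAt 𝓘(ℝ, EG) (1 : G) (1 : G)

lemma extChartAt_symm_localOne :
    (extChartAt 𝓘(ℝ, EG) (1 : G)).symm (localOne EG G) = 1 :=
  extChartAt_to_inv (I := 𝓘(ℝ, EG)) (1 : G)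

lemma extChartAt_localMul_eventually :
    ∀ᶠ a in nhds (localOne EG G), a ∈ (extChartAt 𝓘(ℝ, EG) (1 : G)).target :=
  extChartAt_target_mem_nhds (I := 𝓘(ℝ, EG)) (1 : G)

lemma contMDiffAt_extChartAt_symm_localOne :
    ContMDiffAt 𝓘(ℝ, EG) 𝓘(ℝ, EG) ∞ (extChartAt 𝓘(ℝ, EG) (1 : G)).symm (localOne EG G) :=
  (contMDiffOn_extChartAt_symm (1 : G)).contMDiffAt extChartAt_localMul_eventually

lemma contMDiffAt_symm_fst :
    ContMDiffAt 𝓘(ℝ, EG × EG) 𝓘(ℝ, EG) ∞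
      (fun p : EG × EG => (extChartAt 𝓘(ℝ, EG) (1 : G)).symm p.1)
      (localOne EG G, localOne EG G) :=
  ContMDiffAt.comp (localOne EG G, localOne EG G) contMDiffAt_extChartAt_symm_localOne
    contDiff_fst.contMDiff.contMDiffAt

lemma contMDiffAt_symm_snd :
    ContMDiffAt 𝓘(ℝ, EG × EG) 𝓘(ℝ, EG) ∞
      (fun p : EG × EG => (extChartAt 𝓘(ℝ, EG) (1 : G)).symm p.2)
      (localOne EG G, localOne EG G) :=
  ContMDiffAt.comp (localOne EG G, localOne EG G) contMDiffAt_extChartAt_symm_localOne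
    contDiff_snd.contMDiff.contMDiffAt

lemma contMDiffAt_extChartAt_comp {X : Type*} [NormedAddCommGroup X] [NormedSpace ℝ X]
    {f : X → G} {x : X} (hf : ContMDiffAt 𝓘(ℝ, X) 𝓘(ℝ, EG) ∞ f x) (hx : f x = 1) :
    ContDiffAt ℝ ∞ (fun y => extChartAt 𝓘(ℝ, EG) (1 : G) (f y)) x := by
  have h : ContMDiffAt 𝓘(ℝ, EG) 𝓘(ℝ, EG) ∞ (extChartAt 𝓘(ℝ, EG) (1 : G)) (f x) := by
    rw [hx]; exact contMDiffAt_extChartAt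
  exact (ContMDiffAt.comp x h hf).contDiffAt

lemma contDiffAt_localMul : ContDiffAt ℝ ∞ (localMul EG G) (localOne EG G, localOne EG G) :=
  contMDiffAt_extChartAt_comp (contMDiffAt_symm_fst.mul contMDiffAt_symm_snd)
    (by simp only [extChartAt_symm_localOne, mul_one])

lemma contDiffAt_localConj : ContDiffAt ℝ ∞ (localConj EG G) (localOne EG G, localOne EG G) :=
  contMDiffAt_extChartAt_comp
    ((contMDiffAt_symm_fst.mul contMDiffAt_symm_snd).mul contMDiffAt_symm_fst.inv)
    (by simp only [extChartAt_symm_localOne, mul_one, inv_one])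

lemma extChartAt_symm_localConj_eventually :
    ∀ᶠ p in nhds (localOne EG G, localOne EG G),
      (extChartAt 𝓘(ℝ, EG) (1 : G)).symm (localConj EG G p) =
      (extChartAt 𝓘(ℝ, EG) (1 : G)).symm p.1 * (extChartAt 𝓘(ℝ, EG) (1 : G)).symm p.2 *
      ((extChartAt 𝓘(ℝ, EG) (1 : G)).symm p.1)⁻¹ := by
  have h := ((contMDiffAt_symm_fst (EG := EG) (G := G)).mul contMDiffAt_symm_snd).mul
    contMDiffAt_symm_fst.inv
  have h1 := h.continuousAt.eventually (p := fun x => x ∈ (extChartAt 𝓘(ℝ, EG) (1 : G)).source)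
    (by
      refine (isOpen_extChartAt_source (I := 𝓘(ℝ, EG)) (1 : G)).mem_nhds ?_
      simp only [Pi.mul_apply, extChartAt_symm_localOne, mul_one, inv_one]
      exact mem_extChartAt_source (I := 𝓘(ℝ, EG)) (1 : G))
  filter_upwards [h1] with p hp
  exact (extChartAt 𝓘(ℝ, EG) (1 : G)).left_inv hp

lemma localMul_one_left : ∀ᶠ a in nhds (localOne EG G), localMul EG G (localOne EG G, a) = a := by
  filter_upwards [extChartAt_localMul_eventually] with a ha
  simp only [localMul, extChartAt_symm_localOne, one_mul]
  exact (extChartAt 𝓘(ℝ, EG) (1 : G)).right_inv ha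

lemma localMul_one_right :
    ∀ᶠ a in nhds (localOne EG G), localMul EG G (a, localOne EG G) = a := by
  filter_upwards [extChartAt_localMul_eventually] with a ha
  simp only [localMul, extChartAt_symm_localOne, mul_one]
  exact (extChartAt 𝓘(ℝ, EG) (1 : G)).right_inv ha

lemma localConj_one (a : EG) : localConj EG G (a, localOne EG G) = localOne EG G := by
  rw [localConj, extChartAt_symm_localOne, mul_one, mul_inv_cancel, localOne]

lemma localMul_localConj : ∀ᶠ p in nhds (localOne EG G, localOne EG G),
    localMul EG G (localConj EG G p, p.1) = localMul EG G p := by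
  filter_upwards [extChartAt_symm_localConj_eventually] with p hp
  simp only [localMul, hp]
  simp

lemma contMDiff_conj (x : G) :
    ContMDiff 𝓘(ℝ, EG) 𝓘(ℝ, EG) ∞ (fun y : G => x * y * x⁻¹) :=
  (contMDiff_const.mul contMDiff_id).mul contMDiff_const

lemma mfderiv_extChartAt_comp {f : G → G} (hf : ContMDiff 𝓘(ℝ, EG) 𝓘(ℝ, EG) ∞ f)
    (h1 : f 1 ∈ (extChartAt 𝓘(ℝ, EG) (1 : G)).source) (v : EG) :
    mfderiv 𝓘(ℝ, EG) 𝓘(ℝ, EG) (extChartAt 𝓘(ℝ, EG) (1 : G)) (f 1)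
      (mfderiv 𝓘(ℝ, EG) 𝓘(ℝ, EG) f 1 v) =
    fderiv ℝ (fun b => extChartAt 𝓘(ℝ, EG) (1 : G) (f ((extChartAt 𝓘(ℝ, EG) (1 : G)).symm b)))
      (localOne EG G) v := by
  have h2 : MDifferentiableAt 𝓘(ℝ, EG) 𝓘(ℝ, EG) (extChartAt 𝓘(ℝ, EG) (1 : G)) (f 1) :=
    mdifferentiableAt_extChartAt (by rwa [← extChartAt_source 𝓘(ℝ, EG)])
  have h3 : MDifferentiableAt 𝓘(ℝ, EG) 𝓘(ℝ, EG) f 1 := hf.mdifferentiableAt (by simp)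
  have h4 := mfderiv_comp (1 : G) h2 h3
  have h5 := congrArg (fun T : EG →L[ℝ] EG => T v) h4
  refine Eq.trans h5.symm ?_
  have h6 : MDifferentiableAt 𝓘(ℝ, EG) 𝓘(ℝ, EG) (extChartAt 𝓘(ℝ, EG) (1 : G) ∘ f) 1 :=
    h2.comp _ h3
  rw [MDifferentiableAt.mfderiv h6, ModelWithCorners.range_eq_univ, fderivWithin_univ]
  rfl

lemma fderiv_comp_prodMk {F : Type*} [NormedAddCommGroup F] [NormedSpace ℝ F] {m : EG × EG → F}
    {a b : EG} (h : DifferentiableAt ℝ m (a, b)) (Y : EG) :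
    fderiv ℝ (fun b => m (a, b)) b Y = fderiv ℝ m (a, b) (0, Y) :=
  congrArg (fun T : EG →L[ℝ] F => T Y)
    (h.hasFDerivAt.comp b (hasFDerivAt_prodMk_right a b)).fderiv

lemma mfderiv_extChartAt_of_eq_one {x : G} (hx : x = 1) (v : EG) :
    mfderiv 𝓘(ℝ, EG) 𝓘(ℝ, EG) (extChartAt 𝓘(ℝ, EG) (1 : G)) x v = v := by
  subst hx
  rw [mfderiv_extChartAt_self]
  rfl

lemma mfderiv_extChartAt_congr {x x' : G} (hx : x = x') (v : EG) :
    mfderiv 𝓘(ℝ, EG) 𝓘(ℝ, EG) (extChartAt 𝓘(ℝ, EG) (1 : G)) x v =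
      mfderiv 𝓘(ℝ, EG) 𝓘(ℝ, EG) (extChartAt 𝓘(ℝ, EG) (1 : G)) x' v := by
  subst hx
  rfl

lemma tendsto_prodMk_localOne :
    Filter.Tendsto (fun a => (a, localOne EG G)) (nhds (localOne EG G))
      (nhds (localOne EG G, localOne EG G)) :=
  (Continuous.prodMk_left (localOne EG G)).tendsto (localOne EG G)

lemma Ad_eq_fderiv_localConj (Y : EG) : ∀ᶠ a in nhds (localOne EG G),
    Ad EG ((extChartAt 𝓘(ℝ, EG) (1 : G)).symm a) Y =
      fderiv ℝ (localConj EG G) (a, localOne EG G) (0, Y) := by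
  have h1 : ∀ᶠ p in nhds (localOne EG G, localOne EG G),
      DifferentiableAt ℝ (localConj EG G) p :=
    ((contDiffAt_localConj.of_le (m := 1) (by simp)).eventually (by simp)).mono
      fun p hp => hp.differentiableAt one_ne_zero
  filter_upwards [tendsto_prodMk_localOne.eventually h1] with a ha
  rw [← fderiv_comp_prodMk ha]
  have h2 := mfderiv_extChartAt_comp (contMDiff_conj ((extChartAt 𝓘(ℝ, EG) (1 : G)).symm a))
    (by simp) Y
  refine Eq.trans ?_ h2
  exact (mfderiv_extChartAt_of_eq_one (by simp) _).symm

/-- The left invariant field generated by Y is dL_a(Y) at a, hence a partial derivative of the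
multiplication. -/
lemma mpullback_mulInvariantVectorField_eventually (Y : EG) : ∀ᶠ a in nhds (localOne EG G),
    VectorField.mpullbackWithin 𝓘(ℝ, EG) 𝓘(ℝ, EG) (extChartAt 𝓘(ℝ, EG) (1 : G)).symm
      (mulInvariantVectorField (I := 𝓘(ℝ, EG)) (G := G) Y) (Set.range 𝓘(ℝ, EG)) a =
      fderiv ℝ (localMul EG G) (a, localOne EG G) (0, Y) := by
  have h1 : ∀ᶠ p in nhds (localOne EG G, localOne EG G),
      DifferentiableAt ℝ (localMul EG G) p :=
    ((contDiffAt_localMul.of_le (m := 1) (by simp)).eventually (by simp)).mono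
      fun p hp => hp.differentiableAt one_ne_zero
  filter_upwards [tendsto_prodMk_localOne.eventually h1, extChartAt_localMul_eventually]
    with a ha hat
  rw [← fderiv_comp_prodMk ha, VectorField.mpullbackWithin_apply]
  have h2 := mfderiv_extChartAt_comp (f := fun y => (extChartAt 𝓘(ℝ, EG) (1 : G)).symm a * y)
    (contMDiff_const.mul contMDiff_id)
    (by rw [mul_one]; exact (extChartAt 𝓘(ℝ, EG) (1 : G)).map_target hat) Y
  refine Eq.trans ?_ h2
  rw [inverse_mfderivWithin_extChartAt_symm hat]
  exact mfderiv_extChartAt_congr (mul_one _).symm _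

/-- The bracket of the Lie algebra is that of left invariant fields at the identity; in the chart it
is the commutator of directional derivatives, the same expression as in `hasFDerivAt_local_adjoint`.
-/
lemma bracket_eq_fderiv_localMul (X Y : GroupLieAlgebra 𝓘(ℝ, EG) G) :
    ⁅X, Y⁆ = fderiv ℝ (fun a => fderiv ℝ (localMul EG G) (a, localOne EG G) (0, Y))
        (localOne EG G) (fderiv ℝ (localMul EG G) (localOne EG G, localOne EG G) (0, X)) -
      fderiv ℝ (fun a => fderiv ℝ (localMul EG G) (a, localOne EG G) (0, X))
        (localOne EG G) (fderiv ℝ (localMul EG G) (localOne EG G, localOne EG G) (0, Y)) := by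
  have hX := mpullback_mulInvariantVectorField_eventually (EG := EG) (G := G) X
  have hY := mpullback_mulInvariantVectorField_eventually (EG := EG) (G := G) Y
  have hid : ∀ v : EG, (mfderiv 𝓘(ℝ, EG) 𝓘(ℝ, EG) (extChartAt 𝓘(ℝ, EG) (1 : G)) 1).inverse v
      = v := by
    intro v
    rw [mfderiv_extChartAt_self]
    exact congrArg (fun T : EG →L[ℝ] EG => T v) ContinuousLinearMap.inverse_id
  refine Eq.trans (hid _) ?_
  have hset : (extChartAt 𝓘(ℝ, EG) (1 : G)).symm ⁻¹' Set.univ ∩ Set.range 𝓘(ℝ, EG) = Set.univ := by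
    simp
  have hw : ∀ (U W : EG → EG) (s : Set EG), s = Set.univ → ∀ x,
      VectorField.lieBracketWithin ℝ U W s x = VectorField.lieBracket ℝ U W x := by
    rintro U W _ rfl x
    rw [VectorField.lieBracketWithin_univ]
  refine Eq.trans (hw _ _ _ hset _) ?_
  exact (Filter.EventuallyEq.lieBracket_vectorField_eq hX hY)

/-- The derivative of the adjoint action at the identity is the adjoint representation. -/
lemma hasVecDeriv_Ad (Y : GroupLieAlgebra 𝓘(ℝ, EG) G) :
    HasVecDeriv 𝓘(ℝ, EG) (fun x : G => Ad EG x Y) 1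
      ((lieBilin (GroupLieAlgebra 𝓘(ℝ, EG) G)).flip Y) := by
  obtain ⟨D, hD, hD'⟩ := hasFDerivAt_local_adjoint
    ((contDiffAt_localMul (EG := EG) (G := G)).of_le (by norm_cast))
    ((contDiffAt_localConj (EG := EG) (G := G)).of_le (by norm_cast))
    localMul_one_left localMul_one_right (Filter.Eventually.of_forall localConj_one)
    localMul_localConj Y
  let f : G → EG := fun x => Ad EG x Y
  have h1 : HasMFDerivAt 𝓘(ℝ, EG) 𝓘(ℝ, EG) f 1 D := by
    have h2 : HasFDerivAt (fun a => f ((extChartAt 𝓘(ℝ, EG) (1 : G)).symm a)) D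
        (localOne EG G) :=
      hD.congr_of_eventuallyEq (Ad_eq_fderiv_localConj (EG := EG) (G := G) Y)
    refine (hasMFDerivAt_comp_extChartAt h2).congr_of_eventuallyEq ?_
    filter_upwards [extChartAt_source_mem_nhds (I := 𝓘(ℝ, EG)) (1 : G)] with x hx
    rw [(extChartAt 𝓘(ℝ, EG) (1 : G)).left_inv hx]
  have h3 := hasVecDeriv_of_hasMFDerivAt' h1
  have h4 : (lieBilin (GroupLieAlgebra 𝓘(ℝ, EG) G)).flip Y = D.toLinearMap := by
    refine LinearMap.ext fun X => ?_
    exact (bracket_eq_fderiv_localMul X Y).trans (hD' X).symm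
  rw [h4]
  exact h3

end AdDeriv

section

variable {EX : Type*} [NormedAddCommGroup EX] [NormedSpace ℝ EX]
  {HX : Type*} [TopologicalSpace HX] {I : ModelWithCorners ℝ EX HX}
  {X : Type*} [TopologicalSpace X] [ChartedSpace HX X]
  {EY : Type*} [NormedAddCommGroup EY] [NormedSpace ℝ EY]
  {HY : Type*} [TopologicalSpace HY] {J : ModelWithCorners ℝ EY HY}
  {Y : Type*} [TopologicalSpace Y] [ChartedSpace HY Y]
  {W : Type*} [AddCommGroup W] [Module ℝ W] [FiniteDimensional ℝ W]

/-- The chain rule with the base point `y` kept apart from `φ x`, since tangent spaces at points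
that are only provably equal are distinct types. Typical instances are x · 1 · x⁻¹ = 1 and u · 1 =
u. -/
lemma HasVecDeriv.comp_manifold_of_eq {f : Y → W} {φ : X → Y} {x : X} {y : Y}
    {D : TangentSpace J y →ₗ[ℝ] W} (h : HasVecDeriv J f y D)
    (hφ : MDifferentiableAt I J φ x) (hy : φ x = y) {D' : TangentSpace I x →ₗ[ℝ] W}
    (hD : ∀ v : TangentSpace I x, D' v = D (mfderiv I J φ x v)) :
    HasVecDeriv I (fun z => f (φ z)) x D' := by
  subst hy
  rw [show D' = D ∘ₗ (mfderiv I J φ x).toLinearMap from LinearMap.ext hD]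
  exact h.comp_manifold hφ

lemma mfderiv_apply_congr {f : X → Y} {x x' : X} (h : x = x') (v : EX) :
    (mfderiv I J f x v : EY) = mfderiv I J f x' v := by
  subst h
  rfl

end

/-! ### Ad, infinitesimal representations and the Casimir scalar -/

section AdGroup

variable {EG : Type*} [NormedAddCommGroup EG] [NormedSpace ℝ EG] [FiniteDimensional ℝ EG]
  [CompleteSpace EG]
  {G : Type*} [TopologicalSpace G] [ChartedSpace EG G] [Group G] [LieGroup 𝓘(ℝ, EG) ∞ G]

local notation "𝔤" => GroupLieAlgebra 𝓘(ℝ, EG) G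

lemma Ad_one : Ad EG (1 : G) = LinearMap.id := by
  have h : (fun y : G => 1 * y * 1⁻¹) = id := by funext y; simp
  refine LinearMap.ext fun v => ?_
  rw [Ad, h]
  exact congrArg (fun T : EG →L[ℝ] EG => T v) (mfderiv_id (I := 𝓘(ℝ, EG)) (x := (1 : G)))

lemma Ad_mul (x y : G) : Ad EG (x * y) = Ad EG x ∘ₗ Ad EG y := by
  have h : (fun z : G => x * y * z * (x * y)⁻¹) =
      (fun z => x * z * x⁻¹) ∘ (fun z => y * z * y⁻¹) := by
    funext z; simp [mul_assoc]
  refine LinearMap.ext fun v => ?_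
  rw [Ad, h]
  have h1 := mfderiv_comp (I := 𝓘(ℝ, EG)) (I' := 𝓘(ℝ, EG)) (I'' := 𝓘(ℝ, EG)) (1 : G)
    ((contMDiff_conj (EG := EG) x).mdifferentiableAt (by simp))
    ((contMDiff_conj (EG := EG) y).mdifferentiableAt (by simp))
  refine (congrArg (fun T : EG →L[ℝ] EG => T v) h1).trans ?_
  exact mfderiv_apply_congr (by simp) _

lemma Ad_inv_Ad (x : G) (X : 𝔤) : Ad EG x⁻¹ (Ad EG x X) = X := by
  rw [← LinearMap.comp_apply, ← Ad_mul, inv_mul_cancel, Ad_one]; rfl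

lemma Ad_Ad_inv (x : G) (X : 𝔤) : Ad EG x (Ad EG x⁻¹ X) = X := by
  rw [← LinearMap.comp_apply, ← Ad_mul, mul_inv_cancel, Ad_one]; rfl

section Representation

variable {V : Type*} [AddCommGroup V] [Module ℝ V] [FiniteDimensional ℝ V]
  {r : G → V →ₗ[ℝ] V}

/-- Differentiate r(x y x⁻¹) = r(x) r(y) r(x⁻¹) in y at the identity. -/
lemma derivative_comp_Ad {θ : 𝔤 →ₗ[ℝ] V →ₗ[ℝ] V}
    (hmul : ∀ x y, r (x * y) = r x ∘ₗ r y)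
    (hθ : HasVecDeriv 𝓘(ℝ, EG) r 1 θ) (x : G) (Y : 𝔤) :
    θ (Ad EG x Y) = r x ∘ₗ θ Y ∘ₗ r x⁻¹ := by
  have h1 : HasVecDeriv 𝓘(ℝ, EG) (fun y => r (x * y * x⁻¹)) 1 (θ ∘ₗ Ad EG x) :=
    hθ.comp_manifold_of_eq ((contMDiff_conj (EG := EG) x).mdifferentiableAt (by simp)) (by simp)
      (fun v => rfl)
  have h2 := hθ.linear ((LinearMap.llcomp ℝ V V V (r x)) ∘ₗ
    ((LinearMap.llcomp ℝ V V V).flip (r x⁻¹)))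
  have h3 := h2.congr (f' := fun y => r (x * y * x⁻¹)) (fun y => by
    rw [hmul, hmul]; rfl)
  exact congrArg (fun T => T Y) (h1.unique h3)

/-- Differentiate θ(Ad(x)Y) r(x) = r(x) θ(Y) at the identity; in this form inversion need not be
differentiated. -/
lemma derivative_lie {θ : 𝔤 →ₗ[ℝ] V →ₗ[ℝ] V}
    (hr1 : r 1 = LinearMap.id) (hmul : ∀ x y, r (x * y) = r x ∘ₗ r y)
    (hθ : HasVecDeriv 𝓘(ℝ, EG) r 1 θ) (X Y : 𝔤) (v : V) :
    θ ⁅X, Y⁆ v = θ X (θ Y v) - θ Y (θ X v) := by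
  have h1 : HasVecDeriv 𝓘(ℝ, EG) (fun x : G => θ (Ad EG x Y)) 1
    (θ ∘ₗ (lieBilin 𝔤).flip Y) := (hasVecDeriv_Ad Y).linear θ
  have h2 := h1.bilinear hθ (LinearMap.llcomp ℝ V V V)
  have h3 := hθ.linear ((LinearMap.llcomp ℝ V V V).flip (θ Y))
  have h4 := h3.congr (f' := fun x => LinearMap.llcomp ℝ V V V (θ (Ad EG x Y)) (r x)) (fun x => by
    rw [derivative_comp_Ad hmul hθ]
    refine LinearMap.ext fun v => ?_
    have h5 : r x⁻¹ (r x v) = v := by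
      rw [← LinearMap.comp_apply, ← hmul, inv_mul_cancel, hr1]; rfl
    simp [h5])
  have h6 := congrArg (fun T : 𝔤 →ₗ[ℝ] V →ₗ[ℝ] V => T X v) (h2.unique h4)
  have h7 : θ (Ad EG (1 : G) Y) (θ X v) + θ ⁅X, Y⁆ (r 1 v) = θ X (θ Y v) := h6
  rw [hr1, Ad_one] at h7
  exact eq_sub_of_add_eq' h7

end Representation

lemma hasVecDeriv_Ad' : HasVecDeriv 𝓘(ℝ, EG) (Ad EG : G → 𝔤 →ₗ[ℝ] 𝔤) 1 (lieBilin 𝔤) :=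
  hasVecDeriv_of_apply hasVecDeriv_Ad

lemma Ad_lie (x : G) (X Y : 𝔤) : Ad EG x ⁅X, Y⁆ = ⁅Ad EG x X, Ad EG x Y⁆ := by
  have h := derivative_comp_Ad (r := (Ad EG : G → 𝔤 →ₗ[ℝ] 𝔤)) Ad_mul hasVecDeriv_Ad' x X
  have h1 := congrArg (fun T : 𝔤 →ₗ[ℝ] 𝔤 => T (Ad EG x Y)) h
  have h2 : ⁅Ad EG x X, Ad EG x Y⁆ = Ad EG x ⁅X, Ad EG x⁻¹ (Ad EG x Y)⁆ := h1
  rw [h2, Ad_inv_Ad]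

/-- The adjoint action as an automorphism of the Lie algebra. -/
def AdEquiv (x : G) : 𝔤 ≃ₗ⁅ℝ⁆ 𝔤 :=
  { Ad EG x with
    map_lie' := fun {X Y} => Ad_lie x X Y
    invFun := Ad EG x⁻¹
    left_inv := Ad_inv_Ad x
    right_inv := Ad_Ad_inv x }

variable [LieAlgebra.IsKilling ℝ (GroupLieAlgebra 𝓘(ℝ, EG) G)]

lemma isKillingAdjoint_Ad (x : G) : IsKillingAdjoint (Ad EG x : 𝔤 →ₗ[ℝ] 𝔤) (Ad EG x⁻¹) := by
  intro X Y
  have h := LieAlgebra.killingForm_of_equiv_apply (AdEquiv (EG := EG) x) X (Ad EG x⁻¹ Y)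
  change killingForm ℝ 𝔤 (Ad EG x X) (Ad EG x (Ad EG x⁻¹ Y)) = _ at h
  rwa [Ad_Ad_inv] at h

/-- The contraction with the Killing form is invariant under the adjoint action. -/
lemma sum_Ad {N : Type*} [AddCommGroup N] [Module ℝ N] (β : 𝔤 →ₗ[ℝ] 𝔤 →ₗ[ℝ] N) (x : G) :
    ∑ ℓ, β (Ad EG x (lieBasis 𝔤 ℓ)) (Ad EG x (lieDualBasis 𝔤 ℓ)) =
      ∑ ℓ, β (lieBasis 𝔤 ℓ) (lieDualBasis 𝔤 ℓ) := by
  have h := sum_isKillingAdjoint (β.compl₂ (Ad EG x)) (isKillingAdjoint_Ad (EG := EG) x)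
  simpa only [LinearMap.compl₂_apply, Ad_Ad_inv] using h

section Casimir

variable {𝕜 : Type*} [RCLike 𝕜] {V : Type*} [AddCommGroup V] [Module ℝ V] [Module 𝕜 V]
  [IsScalarTower ℝ 𝕜 V] [FiniteDimensional ℝ V] (ρ : Representation 𝕜 G V)

lemma realAction_one : realAction ρ 1 = LinearMap.id := by
  refine LinearMap.ext fun v => ?_
  change ρ 1 v = v
  rw [map_one]; rfl

lemma realAction_mul (x y : G) : realAction ρ (x * y) = realAction ρ x ∘ₗ realAction ρ y := by
  refine LinearMap.ext fun v => ?_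
  change ρ (x * y) v = ρ x (ρ y v)
  rw [map_mul]; rfl

lemma infinitesimal_lie (hρ : IsSmooth 𝓘(ℝ, EG) (realAction ρ)) (X Y : 𝔤) (v : V) :
    infinitesimal EG ρ ⁅X, Y⁆ v =
      infinitesimal EG ρ X (infinitesimal EG ρ Y v) -
      infinitesimal EG ρ Y (infinitesimal EG ρ X v) :=
  derivative_lie (realAction_one ρ) (realAction_mul ρ) (hρ.hasVecDeriv 1) X Y v

lemma infinitesimal_smul (hρ : IsSmooth 𝓘(ℝ, EG) (realAction ρ)) (X : 𝔤) (c : 𝕜) (v : V) :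
    infinitesimal EG ρ X (c • v) = c • infinitesimal EG ρ X v := by
  let T : V →ₗ[ℝ] V := (LinearMap.lsmul 𝕜 V c).restrictScalars ℝ
  have h1 := (hρ.hasVecDeriv 1).linear ((LinearMap.llcomp ℝ V V V).flip T)
  have h2 := ((hρ.hasVecDeriv 1).linear (LinearMap.llcomp ℝ V V V T)).congr
    (f' := fun x => (LinearMap.llcomp ℝ V V V).flip T (realAction ρ x)) (fun x => by
      refine LinearMap.ext fun v => ?_
      exact (ρ x).map_smul c v)
  exact congrArg (fun S : 𝔤 →ₗ[ℝ] V →ₗ[ℝ] V => S X v) (h1.unique h2)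

lemma casimir_smul (hρ : IsSmooth 𝓘(ℝ, EG) (realAction ρ)) (c : 𝕜) (v : V) :
    casimir (infinitesimal EG ρ) (c • v) = c • casimir (infinitesimal EG ρ) v := by
  simp only [casimir, LinearMap.sum_apply, LinearMap.comp_apply, infinitesimal_smul ρ hρ,
    Finset.smul_sum]

lemma casimir_realAction (hρ : IsSmooth 𝓘(ℝ, EG) (realAction ρ)) (x : G) (v : V) :
    casimir (infinitesimal EG ρ) (realAction ρ x v) =
      realAction ρ x (casimir (infinitesimal EG ρ) v) := by
  have h := sum_Ad (EG := EG) (compBilin (infinitesimal EG ρ) (infinitesimal EG ρ)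
    (realAction ρ x v)) x
  simp only [casimir, LinearMap.sum_apply, LinearMap.comp_apply, map_sum]
  refine Eq.trans h.symm (Finset.sum_congr rfl fun ℓ _ => ?_)
  change infinitesimal EG ρ (Ad EG x _) (infinitesimal EG ρ (Ad EG x _) (realAction ρ x v)) = _
  have h1 : ∀ w, realAction ρ x⁻¹ (realAction ρ x w) = w := fun w => by
    rw [← LinearMap.comp_apply, ← realAction_mul, inv_mul_cancel, realAction_one]; rfl
  have h2 : ∀ Y, infinitesimal EG ρ (Ad EG x Y) =
      realAction ρ x ∘ₗ infinitesimal EG ρ Y ∘ₗ realAction ρ x⁻¹ :=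
    derivative_comp_Ad (realAction_mul ρ) (hρ.hasVecDeriv 1) x
  rw [h2, h2]
  simp only [LinearMap.comp_apply, h1]

/-- The Casimir operator acts by a scalar on an irreducible representation. -/
lemma casimir_eq_smul (hρ : IsSmooth 𝓘(ℝ, EG) (realAction ρ)) [ρ.IsIrreducible] {c₀ : ℝ}
    (hc₀ : (casimir (infinitesimal EG ρ)).HasEigenvalue c₀) (v : V) :
    casimir (infinitesimal EG ρ) v = c₀ • v := by
  -- The eigenspace for c₀ is invariant under G and closed under scalars of 𝕜. It is nonzero by
  -- hypothesis, so irreducibility makes it everything; no algebraic closedness is needed.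
  let S : Subrepresentation ρ :=
    { toSubmodule :=
        { carrier := {v | casimir (infinitesimal EG ρ) v = c₀ • v}
          add_mem' := fun {a b} ha hb => by
            simp only [Set.mem_ofPred_eq] at *
            rw [map_add, ha, hb, smul_add]
          zero_mem' := by simp
          smul_mem' := fun c a ha => by
            simp only [Set.mem_ofPred_eq] at *
            rw [casimir_smul ρ hρ, ha, ← algebraMap_smul 𝕜 c₀ a, ← algebraMap_smul 𝕜 c₀ (c • a),
              smul_comm] }
      apply_mem_toSubmodule := fun x w hw => by
        change casimir (infinitesimal EG ρ) (realAction ρ x w) = c₀ • realAction ρ x w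
        rw [casimir_realAction ρ hρ, show casimir (infinitesimal EG ρ) w = c₀ • w from hw, map_smul] }
  have hS : S = ⊤ := by
    refine (eq_bot_or_eq_top S).resolve_left fun h => ?_
    obtain ⟨w, hw⟩ := hc₀.exists_hasEigenvector
    have h1 : w ∈ S.toSubmodule := hw.apply_eq_smul
    rw [h] at h1
    exact hw.2 ((Submodule.mem_bot 𝕜).mp h1)
  have hv : v ∈ S.toSubmodule := by rw [hS]; trivial
  exact hv

end Casimir

end AdGroup

/-! ### Smoothness of the fundamental derivative -/

section SmoothInverse

variable {EB : Type*} [NormedAddCommGroup EB] [NormedSpace ℝ EB]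
  {𝒢 : Type*} [TopologicalSpace 𝒢] [ChartedSpace EB 𝒢] [IsManifold 𝓘(ℝ, EB) ∞ 𝒢]
  {F : Type*} [NormedAddCommGroup F] [NormedSpace ℝ F]

instance contMDiffVectorBundle_tangent :
    ContMDiffVectorBundle ∞ EB (TangentSpace 𝓘(ℝ, EB) : 𝒢 → Type _) 𝓘(ℝ, EB) :=
  TangentBundle.contMDiffVectorBundle (n := ∞) (h := inferInstanceAs (IsManifold 𝓘(ℝ, EB) ∞ 𝒢))

variable (EB) in
/-- The vector at `u` with given coordinates in the trivialization of the tangent bundle at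
`u₀`. -/
def tangentVector (u₀ u : 𝒢) : EB →ₗ[ℝ] TangentSpace 𝓘(ℝ, EB) u :=
  (trivializationAt EB (TangentSpace 𝓘(ℝ, EB)) u₀).symmₗ ℝ u

lemma contMDiffAt_comp_tangentVector {f : TangentBundle 𝓘(ℝ, EB) 𝒢 → F}
    (hf : ContMDiff 𝓘(ℝ, EB).tangent 𝓘(ℝ, F) ∞ f) (u₀ : 𝒢) (v : EB) :
    ContMDiffAt 𝓘(ℝ, EB) 𝓘(ℝ, F) ∞ (fun u => f ⟨u, tangentVector EB u₀ u v⟩) u₀ := by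
  let e := trivializationAt EB (TangentSpace 𝓘(ℝ, EB) : 𝒢 → Type _) u₀
  have he : u₀ ∈ e.baseSet := FiberBundle.mem_baseSet_trivializationAt' u₀
  have h1 : ContMDiffAt (𝓘(ℝ, EB).prod 𝓘(ℝ, EB)) 𝓘(ℝ, EB).tangent ∞
      e.toOpenPartialHomeomorph.symm (u₀, v) :=
    (Bundle.Trivialization.contMDiffOn_symm e).contMDiffAt
      (e.open_target.mem_nhds (e.mem_target.mpr he))
  have h2 : ContMDiffAt 𝓘(ℝ, EB) (𝓘(ℝ, EB).prod 𝓘(ℝ, EB)) ∞ (fun u : 𝒢 => (u, v)) u₀ :=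
    contMDiffAt_id.prodMk contMDiffAt_const
  have h3 := ContMDiffAt.comp u₀ hf.contMDiffAt (ContMDiffAt.comp u₀ h1 h2)
  refine h3.congr_of_eventuallyEq ?_
  filter_upwards [e.open_baseSet.mem_nhds he] with u hu
  have := e.mk_symm hu v
  simp only [Function.comp_apply]
  rw [← this, tangentVector, Bundle.Trivialization.coe_symmₗ]
  exact hu

lemma tangentVector_bijective (u₀ : 𝒢) :
    ∀ᶠ u in nhds u₀, Function.Bijective (tangentVector EB u₀ u) := by
  let e := trivializationAt EB (TangentSpace 𝓘(ℝ, EB) : 𝒢 → Type _) u₀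
  have he : u₀ ∈ e.baseSet := FiberBundle.mem_baseSet_trivializationAt' u₀
  filter_upwards [e.open_baseSet.mem_nhds he] with u hu
  have := (e.linearEquivAt ℝ u hu).symm.bijective
  rw [tangentVector, Bundle.Trivialization.coe_symmₗ (hb := hu)]
  exact this

/-- A linear map on coordinate space depending on a point is smooth if its values are. -/
lemma contMDiffAt_clm_of_apply {n : ℕ} {A : 𝒢 → (Fin n → ℝ) →L[ℝ] F} {u₀ : 𝒢}
    (h : ∀ i, ContMDiffAt 𝓘(ℝ, EB) 𝓘(ℝ, F) ∞ (fun u => A u (Pi.single i 1)) u₀) :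
    ContMDiffAt 𝓘(ℝ, EB) 𝓘(ℝ, (Fin n → ℝ) →L[ℝ] F) ∞ A u₀ := by
  have h1 : ∀ T : (Fin n → ℝ) →L[ℝ] F, T = ∑ i, ContinuousLinearMap.smulRightL ℝ (Fin n → ℝ) F
      (ContinuousLinearMap.proj i) (T (Pi.single i 1)) := by
    intro T
    ext i
    have h2 := T.toLinearMap.pi_apply_eq_sum_univ i
    have h3 : ∀ j : Fin n, (fun m => if j = m then (1 : ℝ) else 0) = Pi.single j 1 := by
      intro j
      funext m
      simp [Pi.single_apply, eq_comm]
    simp only [h3] at h2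
    simpa using h2
  have h2 : ContMDiffAt 𝓘(ℝ, EB) 𝓘(ℝ, (Fin n → ℝ) →L[ℝ] F) ∞ (fun u => ∑ i,
      ContinuousLinearMap.smulRightL ℝ (Fin n → ℝ) F
      (ContinuousLinearMap.proj i) (A u (Pi.single i 1))) u₀ :=
    contMDiffAt_finsetSum fun i _ => ContMDiffAt.comp u₀
      (ContinuousLinearMap.contMDiff _).contMDiffAt (h i)
  exact h2.congr_of_eventuallyEq (Filter.Eventually.of_forall fun u => h1 (A u))

lemma contMDiff_vectorDeriv {W : Type*} [AddCommGroup W] [Module ℝ W] [FiniteDimensional ℝ W]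
    {f : 𝒢 → W} (hf : IsSmooth 𝓘(ℝ, EB) f) :
    ContMDiff 𝓘(ℝ, EB).tangent 𝓘(ℝ, Fin (Module.finrank ℝ W) → ℝ) ∞
      (fun v : TangentBundle 𝓘(ℝ, EB) 𝒢 => coords W (vectorDeriv 𝓘(ℝ, EB) f v.proj v.snd)) := by
  have h1 : ContMDiff 𝓘(ℝ, EB).tangent 𝓘(ℝ, Fin (Module.finrank ℝ W) → ℝ).tangent ∞
      (tangentMap 𝓘(ℝ, EB) 𝓘(ℝ, Fin (Module.finrank ℝ W) → ℝ) (fun x => coords W (f x))) :=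
    ContMDiff.contMDiff_tangentMap hf (by simp)
  have h2 := (contMDiff_snd_tangentBundle_modelSpace (n := ∞) (Fin (Module.finrank ℝ W) → ℝ)
    𝓘(ℝ, Fin (Module.finrank ℝ W) → ℝ)).comp h1
  refine h2.congr fun v => ?_
  exact (coords W).apply_symm_apply _

end SmoothInverse

section FundamentalDerivative

variable {EG : Type*} [NormedAddCommGroup EG] [NormedSpace ℝ EG] [FiniteDimensional ℝ EG]
  [CompleteSpace EG]
  {G : Type*} [TopologicalSpace G] [ChartedSpace EG G] [Group G] [LieGroup 𝓘(ℝ, EG) ∞ G]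
  {EP : Type*} [NormedAddCommGroup EP] [NormedSpace ℝ EP]
  {P : Subgroup G} [ChartedSpace EP P]
  {EB : Type*} [NormedAddCommGroup EB] [NormedSpace ℝ EB]
  {𝒢 : Type*} [TopologicalSpace 𝒢] [ChartedSpace EB 𝒢] [IsManifold 𝓘(ℝ, EB) ∞ 𝒢]
  {EM : Type*} [NormedAddCommGroup EM] [NormedSpace ℝ EM]
  {M : Type*} [TopologicalSpace M] [ChartedSpace EM M]
  (Γ : CartanGeometry EG EP P EB 𝒢 EM M)
  {W : Type*} [AddCommGroup W] [Module ℝ W] [FiniteDimensional ℝ W]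

local notation "𝔤" => GroupLieAlgebra 𝓘(ℝ, EG) G

/-- In a local frame of T𝒢 the form ω is a smooth family A of invertible matrices and dσ is a smooth
family C. Then Dσ is C A⁻¹, and inversion of matrices is smooth. -/
lemma isSmooth_fundamentalDerivative {σ : 𝒢 → W} (hσ : IsSmooth 𝓘(ℝ, EB) σ) :
    IsSmooth 𝓘(ℝ, EB) (Γ.fundamentalDerivative σ) := by
  refine isSmooth_of_apply fun X u₀ => ?_
  set n := Module.finrank ℝ 𝔤
  -- ω at u₀ identifies the model space of 𝒢 with ℝⁿ, which makes A an endomorphism of ℝⁿ.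
  obtain ⟨L, hL⟩ : ∃ L : (Fin n → ℝ) →ₗ[ℝ] EB, Function.Bijective L :=
    ⟨((Γ.form u₀).symm.toLinearMap : 𝔤 →ₗ[ℝ] EB) ∘ₗ (coords 𝔤).symm.toLinearMap,
      (Γ.form u₀).symm.bijective.comp (coords 𝔤).symm.bijective⟩
  let A : 𝒢 → (Fin n → ℝ) →L[ℝ] (Fin n → ℝ) := fun u =>
    LinearMap.toContinuousLinearMap ((coords 𝔤).toLinearMap ∘ₗ (Γ.form u).toLinearMap ∘ₗ
      tangentVector EB u₀ u ∘ₗ L)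
  let C : 𝒢 → (Fin n → ℝ) →L[ℝ] (Fin (Module.finrank ℝ W) → ℝ) := fun u =>
    LinearMap.toContinuousLinearMap ((coords W).toLinearMap ∘ₗ vectorDeriv 𝓘(ℝ, EB) σ u ∘ₗ
      tangentVector EB u₀ u ∘ₗ L)
  have hA : ContMDiffAt 𝓘(ℝ, EB) 𝓘(ℝ, (Fin n → ℝ) →L[ℝ] (Fin n → ℝ)) ∞ A u₀ :=
    contMDiffAt_clm_of_apply fun i => contMDiffAt_comp_tangentVector Γ.smooth_form u₀ _
  have hC : ContMDiffAt 𝓘(ℝ, EB) 𝓘(ℝ, (Fin n → ℝ) →L[ℝ] (Fin (Module.finrank ℝ W) → ℝ)) ∞ C u₀ :=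
    contMDiffAt_clm_of_apply fun i =>
      contMDiffAt_comp_tangentVector (contMDiff_vectorDeriv hσ) u₀ _
  have hunit : ∀ᶠ u in nhds u₀, IsUnit (A u) := by
    filter_upwards [tangentVector_bijective (EB := EB) u₀] with u hu
    have hb : Function.Bijective (A u) :=
      (coords 𝔤).bijective.comp ((Γ.form u).bijective.comp (hu.comp hL))
    exact ContinuousLinearMap.isUnit_iff_bijective.mpr hb
  have hAinv : ContMDiffAt 𝓘(ℝ, EB) 𝓘(ℝ, (Fin n → ℝ) →L[ℝ] (Fin n → ℝ)) ∞
      (fun u => Ring.inverse (A u)) u₀ := by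
    obtain ⟨a, ha⟩ := hunit.self_of_nhds
    have h1 := contDiffAt_ringInverse (n := ∞) ℝ a
    rw [ha] at h1
    exact ContMDiffAt.comp u₀ h1.contMDiffAt hA
  have hfin : ContMDiffAt 𝓘(ℝ, EB) 𝓘(ℝ, Fin (Module.finrank ℝ W) → ℝ) ∞
      (fun u => C u (Ring.inverse (A u) (coords 𝔤 X))) u₀ :=
    hC.clm_apply (hAinv.clm_apply contMDiffAt_const)
  refine hfin.congr_of_eventuallyEq ?_
  filter_upwards [hunit] with u hu
  have h1 : A u (Ring.inverse (A u) (coords 𝔤 X)) = coords 𝔤 X :=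
    congrArg (fun T : (Fin n → ℝ) →L[ℝ] (Fin n → ℝ) => T (coords 𝔤 X))
      (Ring.mul_inverse_cancel (A u) hu)
  have h2 : Γ.form u (tangentVector EB u₀ u (L (Ring.inverse (A u) (coords 𝔤 X)))) = X :=
    (coords 𝔤).injective h1
  have h3 := (LinearEquiv.eq_symm_apply _).mpr h2
  change coords W (vectorDeriv 𝓘(ℝ, EB) σ u ((Γ.form u).symm X)) = _
  rw [← h3]
  rfl

end FundamentalDerivative

/-! ### Equivariance of the fundamental derivative and of 𝒞 -/

section Equivariance

variable {EG : Type*} [NormedAddCommGroup EG] [NormedSpace ℝ EG] [FiniteDimensional ℝ EG]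
  [CompleteSpace EG]
  {G : Type*} [TopologicalSpace G] [ChartedSpace EG G] [Group G] [LieGroup 𝓘(ℝ, EG) ∞ G]
  {EP : Type*} [NormedAddCommGroup EP] [NormedSpace ℝ EP]
  {P : Subgroup G} [ChartedSpace EP P]
  {EB : Type*} [NormedAddCommGroup EB] [NormedSpace ℝ EB]
  {𝒢 : Type*} [TopologicalSpace 𝒢] [ChartedSpace EB 𝒢] [IsManifold 𝓘(ℝ, EB) ∞ 𝒢]
  {EM : Type*} [NormedAddCommGroup EM] [NormedSpace ℝ EM]
  {M : Type*} [TopologicalSpace M] [ChartedSpace EM M]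
  (Γ : CartanGeometry EG EP P EB 𝒢 EM M)
  {W : Type*} [AddCommGroup W] [Module ℝ W] [FiniteDimensional ℝ W]

local notation "𝔤" => GroupLieAlgebra 𝓘(ℝ, EG) G
local notation "𝔭" => GroupLieAlgebra 𝓘(ℝ, EP) P

variable (EG EP P) in
/-- The derivative of the inclusion of `P` at the identity. -/
def inclDeriv : 𝔭 →ₗ[ℝ] 𝔤 :=
  (mfderiv 𝓘(ℝ, EP) 𝓘(ℝ, EG) (Subtype.val : P → G) 1).toLinearMap

lemma hasVecDeriv_incl {g : ParabolicGrading 𝔤} (hP : IsParabolicSubgroup EP P g) {f : G → W} {D : 𝔤 →ₗ[ℝ] W}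
    (hf : HasVecDeriv 𝓘(ℝ, EG) f 1 D) :
    HasVecDeriv 𝓘(ℝ, EP) (fun h : P => f (h : G)) 1 (D ∘ₗ inclDeriv EG EP P) :=
  hf.comp_manifold_of_eq (φ := (Subtype.val : P → G)) (x := (1 : P))
    (hP.smooth_incl.mdifferentiableAt (by simp)) rfl (fun _ => rfl)

lemma mdifferentiableAt_act_left (h : P) (u : 𝒢) :
    MDifferentiableAt 𝓘(ℝ, EB) 𝓘(ℝ, EB) (fun u' => Γ.act u' h) u :=
  (Γ.smooth_act.comp (contMDiff_id.prodMk contMDiff_const)).mdifferentiableAt (by simp)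

lemma mdifferentiableAt_act_right (u : 𝒢) (h : P) :
    MDifferentiableAt 𝓘(ℝ, EP) 𝓘(ℝ, EB) (fun h' => Γ.act u h') h :=
  (Γ.smooth_act.comp (contMDiff_const.prodMk contMDiff_id)).mdifferentiableAt (by simp)

lemma form_congr {u u' : 𝒢} (h : u = u') (v : EB) : Γ.form u v = Γ.form u' v := by
  subst h
  rfl

/-- Along a fibre the velocity is a fundamental vector, whose generator ω reproduces; so D in
directions of 𝔭 differentiates along orbits of P. -/
lemma hasVecDeriv_act_right {f : 𝒢 → W} (hf : IsSmooth 𝓘(ℝ, EB) f) (u : 𝒢) :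
    HasVecDeriv 𝓘(ℝ, EP) (fun h : P => f (Γ.act u h)) 1
      (Γ.fundamentalDerivative f u ∘ₗ inclDeriv EG EP P) := by
  refine (hf.hasVecDeriv u).comp_manifold_of_eq (mdifferentiableAt_act_right Γ u 1)
    (Γ.act_one u) fun A => ?_
  have h1 : (Γ.form u).symm (inclDeriv EG EP P A) =
      mfderiv 𝓘(ℝ, EP) 𝓘(ℝ, EB) (fun h : P => Γ.act u h) 1 A := by
    refine (LinearEquiv.symm_apply_eq _).mpr ?_
    exact (Γ.form_fundamental u A).symm.trans (form_congr Γ (Γ.act_one u) _)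
  exact congrArg (vectorDeriv 𝓘(ℝ, EB) f u) h1

/-- Differentiate σ(u·h) = h⁻¹·σ(u) in u and use the equivariance of ω. -/
lemma fundamentalDerivative_act {τ : P → W →ₗ[ℝ] W} {σ : 𝒢 → W} (hσ : σ ∈ Γ.sections τ)
    (u : 𝒢) (h : P) (X : 𝔤) :
    Γ.fundamentalDerivative σ (Γ.act u h) X =
      τ h⁻¹ (Γ.fundamentalDerivative σ u (Ad EG (h : G) X)) := by
  have h1 := HasVecDeriv.comp_manifold (φ := fun u' => Γ.act u' h)
    (hσ.1.hasVecDeriv (Γ.act u h)) (mdifferentiableAt_act_left Γ h u)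
  have h2 := ((hσ.1.hasVecDeriv u).linear (τ h⁻¹)).congr (f' := fun u' => σ (Γ.act u' h))
    (fun u' => hσ.2 u' h)
  have h3 := congrArg (fun T : TangentSpace 𝓘(ℝ, EB) u →ₗ[ℝ] W =>
    T ((Γ.form u).symm (Ad EG (h : G) X))) (h1.unique h2)
  refine Eq.trans ?_ h3
  refine congrArg (vectorDeriv 𝓘(ℝ, EB) σ (Γ.act u h)) ?_
  refine (LinearEquiv.symm_apply_eq (Γ.form (Γ.act u h))).mpr ?_
  refine Eq.trans ?_ (Γ.form_act u h _).symm
  rw [LinearEquiv.apply_symm_apply]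
  exact (Ad_inv_Ad (EG := EG) (h : G) X).symm

lemma curvedCasimir_mem_sections [LieAlgebra.IsKilling ℝ (GroupLieAlgebra 𝓘(ℝ, EG) G)]
    {τ : P → W →ₗ[ℝ] W} {σ : 𝒢 → W} (hσ : σ ∈ Γ.sections τ) :
    Γ.curvedCasimir σ ∈ Γ.sections τ := by
  have hD := isSmooth_fundamentalDerivative Γ hσ.1
  have hDD := isSmooth_fundamentalDerivative Γ hD
  refine ⟨?_, fun u h => ?_⟩
  · refine isSmooth_sum Finset.univ fun ℓ => ?_
    exact (hDD.linear (LinearMap.applyₗ (lieBasis 𝔤 ℓ))).linear (LinearMap.applyₗ (lieDualBasis 𝔤 ℓ))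
  -- The action on 𝔤* ⊗ W, for which Dσ is a section, so that its equivariance can be differentiated
  -- once more. The contraction is Ad-invariant by `sum_Ad`.
  · let τ' : P → (𝔤 →ₗ[ℝ] W) →ₗ[ℝ] (𝔤 →ₗ[ℝ] W) := fun h =>
      (LinearMap.llcomp ℝ 𝔤 W W (τ h)) ∘ₗ (LinearMap.llcomp ℝ 𝔤 𝔤 W).flip (Ad EG ((h⁻¹ : P) : G))
    have hσ' : Γ.fundamentalDerivative σ ∈ Γ.sections τ' := by
      refine ⟨hD, fun u h => LinearMap.ext fun X => ?_⟩
      rw [fundamentalDerivative_act Γ hσ]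
      simp [τ']
    have h1 : ∀ X Y, Γ.fundamentalDerivative (Γ.fundamentalDerivative σ) (Γ.act u h) X Y =
        τ h⁻¹ (Γ.fundamentalDerivative (Γ.fundamentalDerivative σ) u (Ad EG (h : G) X)
          (Ad EG (h : G) Y)) := by
      intro X Y
      rw [fundamentalDerivative_act Γ hσ']
      simp [τ']
    simp only [CartanGeometry.curvedCasimir, h1]
    rw [← map_sum, sum_Ad]

end Equivariance

section Span

variable {EX : Type*} [NormedAddCommGroup EX] [NormedSpace ℝ EX]
  {HX : Type*} [TopologicalSpace HX] {I : ModelWithCorners ℝ EX HX}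
  {X : Type*} [TopologicalSpace X] [ChartedSpace HX X]
  {W : Type*} [AddCommGroup W] [Module ℝ W] [FiniteDimensional ℝ W]
  {W₁ : Type*} [AddCommGroup W₁] [Module ℝ W₁] [FiniteDimensional ℝ W₁]

lemma hasVecDeriv_of_span {f : X → W →ₗ[ℝ] W₁} {x : X} {D : TangentSpace I x →ₗ[ℝ] W →ₗ[ℝ] W₁}
    {s : Set W} (hs : Submodule.span ℝ s = ⊤)
    (h : ∀ w ∈ s, HasVecDeriv I (fun y => f y w) x (D.flip w)) : HasVecDeriv I f x D := by
  refine hasVecDeriv_of_apply fun w => ?_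
  have hw : w ∈ Submodule.span ℝ s := by rw [hs]; trivial
  induction hw using Submodule.span_induction with
  | mem w hw => exact h w hw
  | zero =>
    have := (hasVecDeriv_const (I := I) (0 : W₁) x).congr (f' := fun y => f y 0)
      (fun y => map_zero _)
    simpa using this
  | add v w _ _ hv hw =>
    have := (hv.add hw).congr (f' := fun y => f y (v + w)) (fun y => map_add _ _ _)
    rwa [← map_add] at this
  | smul c w _ hw =>
    have := (hw.linear (LinearMap.lsmul ℝ W₁ c)).congr (f' := fun y => f y (c • w))
      (fun y => map_smul _ _ _)
    rwa [show LinearMap.lsmul ℝ W₁ c ∘ₗ D.flip w = D.flip (c • w) from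
      LinearMap.ext fun v => ((D v).map_smul c w).symm] at this

variable (L V : Type*) [LieRing L] [LieAlgebra ℝ L] [AddCommGroup V] [Module ℝ V]

lemma Forms.span_unit : Submodule.span ℝ (Set.range (Forms.unit L V)) = ⊤ := by
  rw [← Submodule.ker_mkQ (Submodule.span ℝ _), LinearMap.ker_eq_top]
  exact Forms.hom_ext_zero fun v =>
    (Submodule.Quotient.mk_eq_zero _).mpr (Submodule.subset_span ⟨v, rfl⟩)

lemma Forms.span_leftMul (k : ℕ) : Submodule.span ℝ
    (Set.range fun p : L × Forms L V k => Forms.leftMul V k p.1 p.2) = ⊤ := by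
  rw [← Submodule.ker_mkQ (Submodule.span ℝ _), LinearMap.ker_eq_top]
  exact Forms.hom_ext_succ fun Z φ =>
    (Submodule.Quotient.mk_eq_zero _).mpr (Submodule.subset_span ⟨(Z, φ), rfl⟩)

end Span

/-! ### The derivative of the P-action on forms -/

section FormAction

variable {EG : Type*} [NormedAddCommGroup EG] [NormedSpace ℝ EG] [FiniteDimensional ℝ EG]
  [CompleteSpace EG]
  {G : Type*} [TopologicalSpace G] [ChartedSpace EG G] [Group G] [LieGroup 𝓘(ℝ, EG) ∞ G]
  {EP : Type*} [NormedAddCommGroup EP] [NormedSpace ℝ EP]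
  {P : Subgroup G} [ChartedSpace EP P]

local notation "𝔤" => GroupLieAlgebra 𝓘(ℝ, EG) G
local notation "𝔭" => GroupLieAlgebra 𝓘(ℝ, EP) P

variable [LieAlgebra.IsKilling ℝ (GroupLieAlgebra 𝓘(ℝ, EG) G)]
  {g : ParabolicGrading (GroupLieAlgebra 𝓘(ℝ, EG) G)}
  {𝕜 : Type*} [RCLike 𝕜] {V : Type*} [AddCommGroup V] [Module ℝ V] [Module 𝕜 V]
  [IsScalarTower ℝ 𝕜 V] [FiniteDimensional ℝ V]
  (hP : IsParabolicSubgroup EP P g) (ρ : Representation 𝕜 G V)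

lemma formAction_wedge (k : ℕ) (h : P) (Z : Fin k → g.pPlus) (v : V) :
    formAction hP ρ k h (Forms.wedge V k Z v) =
      Forms.wedge V k (adPlus hP h ∘ Z) (realAction ρ (h : G) v) := by
  rw [formAction, Forms.map, Forms.wedge_apply]
  change TensorProduct.map _ _ (_ ⊗ₜ[ℝ] _) = _
  rw [TensorProduct.map_tmul, exteriorPower.map_apply_ιMulti]
  rfl

lemma formAction_unit (h : P) (v : V) :
    formAction hP ρ 0 h (Forms.unit g.pPlus V v) =
      Forms.unit g.pPlus V (realAction ρ (h : G) v) :=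
  (formAction_wedge hP ρ 0 h Fin.elim0 v).trans (Forms.wedge_zero _ _)

lemma formAction_leftMul (k : ℕ) (h : P) (Z : g.pPlus) (φ : Forms g.pPlus V k) :
    formAction hP ρ (k + 1) h (Forms.leftMul V k Z φ) =
      Forms.leftMul V k (adPlus hP h Z) (formAction hP ρ k h φ) := by
  refine LinearMap.congr_fun (f := formAction hP ρ (k + 1) h ∘ₗ Forms.leftMul V k Z)
    (g := Forms.leftMul V k (adPlus hP h Z) ∘ₗ formAction hP ρ k h)
    (Forms.hom_ext fun X v => ?_) φ
  simp only [LinearMap.comp_apply, Forms.leftMul_wedge, formAction_wedge]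
  congr 2
  funext i
  refine Fin.cases rfl (fun i => rfl) i

lemma adPlus_one : adPlus hP 1 = LinearMap.id := by
  refine LinearMap.ext fun Z => Subtype.ext ?_
  change Ad EG (1 : G) (Z : 𝔤) = Z
  rw [Ad_one]; rfl

lemma formAction_one (k : ℕ) : formAction hP ρ k 1 = LinearMap.id := by
  refine Forms.hom_ext fun X v => ?_
  rw [formAction_wedge, adPlus_one]
  change Forms.wedge V k X (realAction ρ 1 v) = Forms.wedge V k X v
  rw [realAction_one]; rfl

lemma formAction_mul (k : ℕ) (h h' : P) :
    formAction hP ρ k (h * h') = formAction hP ρ k h ∘ₗ formAction hP ρ k h' := by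
  refine Forms.hom_ext fun X v => ?_
  rw [LinearMap.comp_apply, formAction_wedge, formAction_wedge, formAction_wedge]
  have h1 : adPlus hP (h * h') ∘ X = adPlus hP h ∘ adPlus hP h' ∘ X := by
    funext i
    refine Subtype.ext ?_
    change Ad EG ((h : G) * (h' : G)) (X i : 𝔤) = _
    rw [Ad_mul]; rfl
  rw [h1]
  change _ = Forms.wedge V k _ (realAction ρ (h : G) (realAction ρ (h' : G) v))
  rw [← LinearMap.comp_apply (realAction ρ (h : G)), ← realAction_mul]
  rfl

lemma hasVecDeriv_adPlus (Z : g.pPlus) :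
    HasVecDeriv 𝓘(ℝ, EP) (fun h : P => adPlus hP h Z) 1
      ((adProj g).flip Z ∘ₗ inclDeriv EG EP P) := by
  have h1 := (hasVecDeriv_incl hP (hasVecDeriv_Ad (EG := EG) (G := G) (Z : 𝔤))).linear g.projPlus
  exact h1.congr fun h => (g.projPlus_coe (adPlus hP h Z)).symm

/-- By induction, the product rule for h·(Z ∧ φ) = Ad(h)Z ∧ h·φ at h = 1 is the Leibniz rule for
`formAct`. -/
lemma hasVecDeriv_formAction (hρ : IsSmooth 𝓘(ℝ, EG) (realAction ρ)) (k : ℕ) :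
    HasVecDeriv 𝓘(ℝ, EP) (formAction hP ρ k) 1
      (formAct g (infinitesimal EG ρ) k ∘ₗ inclDeriv EG EP P) := by
  induction k with
  | zero =>
    refine hasVecDeriv_of_span (Forms.span_unit g.pPlus V) ?_
    rintro _ ⟨v, rfl⟩
    have h1 := ((hasVecDeriv_incl hP (hρ.hasVecDeriv 1)).linear
      (LinearMap.applyₗ v)).linear (Forms.unit g.pPlus V)
    have h2 := h1.congr fun h => formAction_unit hP ρ h v
    have h3 : (formAct g (infinitesimal EG ρ) 0 ∘ₗ inclDeriv EG EP P).flip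
        (Forms.unit g.pPlus V v) = Forms.unit g.pPlus V ∘ₗ LinearMap.applyₗ v ∘ₗ
          vectorDeriv 𝓘(ℝ, EG) (realAction ρ) 1 ∘ₗ inclDeriv EG EP P :=
      LinearMap.ext fun A => formAct_unit g (infinitesimal EG ρ) (inclDeriv EG EP P A) v
    rw [h3]
    exact h2
  | succ k ih =>
    refine hasVecDeriv_of_span (Forms.span_leftMul g.pPlus V k) ?_
    rintro _ ⟨⟨Z, φ⟩, rfl⟩
    have h1 := (hasVecDeriv_adPlus hP Z).bilinear (ih.linear (LinearMap.applyₗ φ))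
      (Forms.leftMul V k)
    have h2 := h1.congr fun h => formAction_leftMul hP ρ k h Z φ
    convert h2 using 1
    refine LinearMap.ext fun A => ?_
    refine (Forms.derivation_leftMul (adProj g (inclDeriv EG EP P A))
      (infinitesimal EG ρ (inclDeriv EG EP P A)) k Z φ).trans ?_
    rw [adPlus_one, formAction_one]
    exact add_comm _ _

end FormAction

/-! ### Derivatives of sections in directions of 𝔭 and in invariant subspaces -/

section Vertical

variable {EG : Type*} [NormedAddCommGroup EG] [NormedSpace ℝ EG] [FiniteDimensional ℝ EG]
  [CompleteSpace EG]
  {G : Type*} [TopologicalSpace G] [ChartedSpace EG G] [Group G] [LieGroup 𝓘(ℝ, EG) ∞ G]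
  {EP : Type*} [NormedAddCommGroup EP] [NormedSpace ℝ EP]
  {P : Subgroup G} [ChartedSpace EP P]
  {EB : Type*} [NormedAddCommGroup EB] [NormedSpace ℝ EB]
  {𝒢 : Type*} [TopologicalSpace 𝒢] [ChartedSpace EB 𝒢] [IsManifold 𝓘(ℝ, EB) ∞ 𝒢]
  {EM : Type*} [NormedAddCommGroup EM] [NormedSpace ℝ EM]
  {M : Type*} [TopologicalSpace M] [ChartedSpace EM M]
  (Γ : CartanGeometry EG EP P EB 𝒢 EM M)
  {W : Type*} [AddCommGroup W] [Module ℝ W] [FiniteDimensional ℝ W]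

local notation "𝔤" => GroupLieAlgebra 𝓘(ℝ, EG) G
local notation "𝔭" => GroupLieAlgebra 𝓘(ℝ, EP) P

/-- The composition of σ with the projection to W/F vanishes identically, hence so does its
derivative, in every direction of 𝔤. -/
lemma fundamentalDerivative_mem {σ : 𝒢 → W} (hσ : IsSmooth 𝓘(ℝ, EB) σ) {F : Submodule ℝ W}
    (hF : ∀ u, σ u ∈ F) (u : 𝒢) (X : 𝔤) : Γ.fundamentalDerivative σ u X ∈ F := by
  have h1 := (hσ.hasVecDeriv u).linear F.mkQ
  have h2 := (hasVecDeriv_const (I := 𝓘(ℝ, EB)) (0 : W ⧸ F) u).congr (f' := fun u => F.mkQ (σ u))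
    (fun u => (Submodule.Quotient.mk_eq_zero F).mpr (hF u))
  have h3 := congrArg (fun T : TangentSpace 𝓘(ℝ, EB) u →ₗ[ℝ] W ⧸ F => T ((Γ.form u).symm X))
    (h1.unique h2)
  exact (Submodule.Quotient.mk_eq_zero F).mp h3

lemma fundamentalDerivative_linear {W₁ : Type*} [AddCommGroup W₁] [Module ℝ W₁]
    [FiniteDimensional ℝ W₁] {f : 𝒢 → W} (hf : IsSmooth 𝓘(ℝ, EB) f) (T : W →ₗ[ℝ] W₁) (u : 𝒢)
    (X : 𝔤) :
    Γ.fundamentalDerivative (fun u => T (f u)) u X = T (Γ.fundamentalDerivative f u X) :=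
  congrArg (fun S : TangentSpace 𝓘(ℝ, EB) u →ₗ[ℝ] W₁ => S ((Γ.form u).symm X))
    ((hf.hasVecDeriv u).linear T).vectorDeriv_eq

variable {τ : P → W →ₗ[ℝ] W}

lemma sections_apply_act (h1 : τ 1 = LinearMap.id) (hmul : ∀ h h', τ (h * h') = τ h ∘ₗ τ h')
    {σ : 𝒢 → W} (hσ : σ ∈ Γ.sections τ) (u : 𝒢) (h : P) : τ h (σ (Γ.act u h)) = σ u := by
  rw [hσ.2, ← LinearMap.comp_apply, ← hmul, mul_inv_cancel, h1]; rfl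

/-- The function h ↦ h·σ(u·h) is constant; differentiate it at the identity. -/
lemma fundamentalDerivative_inclDeriv {T : 𝔭 →ₗ[ℝ] W →ₗ[ℝ] W} (h1 : τ 1 = LinearMap.id)
    (hmul : ∀ h h', τ (h * h') = τ h ∘ₗ τ h') (hT : HasVecDeriv 𝓘(ℝ, EP) τ 1 T)
    {σ : 𝒢 → W} (hσ : σ ∈ Γ.sections τ) (u : 𝒢) (A : 𝔭) :
    Γ.fundamentalDerivative σ u (inclDeriv EG EP P A) = -T A (σ u) := by
  have h2 := hT.bilinear (hasVecDeriv_act_right Γ hσ.1 u) LinearMap.id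
  have h3 := (hasVecDeriv_const (I := 𝓘(ℝ, EP)) (σ u) (1 : P)).congr
    (f' := fun h => (LinearMap.id : (W →ₗ[ℝ] W) →ₗ[ℝ] (W →ₗ[ℝ] W)) (τ h) (σ (Γ.act u h)))
    (fun h => sections_apply_act Γ h1 hmul hσ u h)
  have h4 := congrArg (fun S : 𝔭 →ₗ[ℝ] W => S A) (h2.unique h3)
  have h5 : τ 1 (Γ.fundamentalDerivative σ u (inclDeriv EG EP P A)) + T A (σ (Γ.act u 1)) = 0 := h4
  rw [h1, Γ.act_one] at h5
  exact eq_neg_of_add_eq_zero_left h5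

/-- Differentiate h·Dσ(u·h)(X) = Dσ(u)(Ad(h)X) at the identity; the right side produces the bracket.
-/
lemma fundamentalDerivative_fundamentalDerivative_inclDeriv {T : 𝔭 →ₗ[ℝ] W →ₗ[ℝ] W}
    {g : ParabolicGrading 𝔤} (hP : IsParabolicSubgroup EP P g) (h1 : τ 1 = LinearMap.id)
    (hmul : ∀ h h', τ (h * h') = τ h ∘ₗ τ h') (hT : HasVecDeriv 𝓘(ℝ, EP) τ 1 T)
    {σ : 𝒢 → W} (hσ : σ ∈ Γ.sections τ) (u : 𝒢) (A : 𝔭) (X : 𝔤) :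
    Γ.fundamentalDerivative (Γ.fundamentalDerivative σ) u (inclDeriv EG EP P A) X =
      Γ.fundamentalDerivative σ u ⁅inclDeriv EG EP P A, X⁆ -
        T A (Γ.fundamentalDerivative σ u X) := by
  have hD := isSmooth_fundamentalDerivative Γ hσ.1
  have h2 := hT.bilinear ((hasVecDeriv_act_right Γ hD u).linear (LinearMap.applyₗ X)) LinearMap.id
  have h3 := ((hasVecDeriv_incl hP (hasVecDeriv_Ad (EG := EG) (G := G) X)).linear
    (Γ.fundamentalDerivative σ u)).congr
    (f' := fun h => (LinearMap.id : (W →ₗ[ℝ] W) →ₗ[ℝ] (W →ₗ[ℝ] W)) (τ h)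
      (LinearMap.applyₗ X (Γ.fundamentalDerivative σ (Γ.act u h)))) (fun h => by
      change τ h (Γ.fundamentalDerivative σ (Γ.act u h) X) = _
      rw [fundamentalDerivative_act Γ hσ, ← LinearMap.comp_apply, ← hmul, mul_inv_cancel, h1]
      rfl)
  have h4 := congrArg (fun S : 𝔭 →ₗ[ℝ] W => S A) (h2.unique h3)
  have h5 : τ 1 (Γ.fundamentalDerivative (Γ.fundamentalDerivative σ) u (inclDeriv EG EP P A) X) +
      T A (Γ.fundamentalDerivative σ (Γ.act u 1) X) =
      Γ.fundamentalDerivative σ u ⁅inclDeriv EG EP P A, X⁆ := h4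
  rw [h1, Γ.act_one] at h5
  exact eq_sub_of_add_eq h5

end Vertical

/-! ### 𝒞 in terms of □ -/

section Main

variable {EG : Type*} [NormedAddCommGroup EG] [NormedSpace ℝ EG] [FiniteDimensional ℝ EG]
  [CompleteSpace EG]
  {G : Type*} [TopologicalSpace G] [ChartedSpace EG G] [Group G] [LieGroup 𝓘(ℝ, EG) ∞ G]
  {EP : Type*} [NormedAddCommGroup EP] [NormedSpace ℝ EP]
  {P : Subgroup G} [ChartedSpace EP P]
  {EB : Type*} [NormedAddCommGroup EB] [NormedSpace ℝ EB]
  {𝒢 : Type*} [TopologicalSpace 𝒢] [ChartedSpace EB 𝒢] [IsManifold 𝓘(ℝ, EB) ∞ 𝒢]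
  {EM : Type*} [NormedAddCommGroup EM] [NormedSpace ℝ EM]
  {M : Type*} [TopologicalSpace M] [ChartedSpace EM M]
  (Γ : CartanGeometry EG EP P EB 𝒢 EM M)

local notation "𝔤" => GroupLieAlgebra 𝓘(ℝ, EG) G

variable [LieAlgebra.IsKilling ℝ (GroupLieAlgebra 𝓘(ℝ, EG) G)]
  {g : ParabolicGrading (GroupLieAlgebra 𝓘(ℝ, EG) G)}
  {𝕜 : Type*} [RCLike 𝕜] {V : Type*} [AddCommGroup V] [Module ℝ V] [Module 𝕜 V]
  [IsScalarTower ℝ 𝕜 V] [FiniteDimensional ℝ V]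
  (hP : IsParabolicSubgroup EP P g) (ρ : Representation 𝕜 G V)

lemma ParabolicGrading.pPlus_le_filt : g.pPlus.toSubmodule ≤ g.filt 0 :=
  iSup₂_le fun j (hj : 1 ≤ j) =>
    le_iSup₂_of_le (f := fun j (_ : j ≥ (0 : ℤ)) => g.comp j) j (by omega) le_rfl

lemma ParabolicGrading.comp_zero_le_filt : g.comp 0 ≤ g.filt 0 :=
  le_iSup₂_of_le (f := fun j (_ : j ≥ (0 : ℤ)) => g.comp j) 0 le_rfl le_rfl

lemma exists_inclDeriv_eq (hP : IsParabolicSubgroup EP P g) {X : 𝔤} (hX : X ∈ g.filt 0) :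
    ∃ A, inclDeriv EG EP P A = X := by
  have h : X ∈ LinearMap.range (inclDeriv EG EP P) := hP.range_incl.symm ▸ hX
  exact h

variable {k : ℕ} {σ : 𝒢 → Forms g.pPlus V k}

/-- Infinitesimal equivariance of a section. -/
lemma fundamentalDerivative_of_mem_filt (hρ : IsSmooth 𝓘(ℝ, EG) (realAction ρ))
    (hσ : σ ∈ Γ.sections (formAction hP ρ k)) (u : 𝒢) {A : 𝔤} (hA : A ∈ g.filt 0) :
    Γ.fundamentalDerivative σ u A = -formAct g (infinitesimal EG ρ) k A (σ u) := by
  obtain ⟨A, rfl⟩ := exists_inclDeriv_eq hP hA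
  exact fundamentalDerivative_inclDeriv Γ (formAction_one hP ρ k) (formAction_mul hP ρ k)
    (hasVecDeriv_formAction hP ρ hρ k) hσ u A

/-- Infinitesimal equivariance of the fundamental derivative of a section. -/
lemma fundamentalDerivative_twice_of_mem_filt_left (hρ : IsSmooth 𝓘(ℝ, EG) (realAction ρ))
    (hσ : σ ∈ Γ.sections (formAction hP ρ k)) (u : 𝒢) {A : 𝔤} (hA : A ∈ g.filt 0) (X : 𝔤) :
    Γ.fundamentalDerivative (Γ.fundamentalDerivative σ) u A X =
      Γ.fundamentalDerivative σ u ⁅A, X⁆ -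
        formAct g (infinitesimal EG ρ) k A (Γ.fundamentalDerivative σ u X) := by
  obtain ⟨A, rfl⟩ := exists_inclDeriv_eq hP hA
  exact fundamentalDerivative_fundamentalDerivative_inclDeriv Γ hP (formAction_one hP ρ k)
    (formAction_mul hP ρ k) (hasVecDeriv_formAction hP ρ hρ k) hσ u A X

/-- The identity Dσ(A) = −A·σ holds at every point with A fixed, so it can be differentiated in the
direction X; no bracket appears. -/
lemma fundamentalDerivative_twice_of_mem_filt_right (hρ : IsSmooth 𝓘(ℝ, EG) (realAction ρ))
    (hσ : σ ∈ Γ.sections (formAction hP ρ k)) (u : 𝒢) (X : 𝔤) {A : 𝔤} (hA : A ∈ g.filt 0) :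
    Γ.fundamentalDerivative (Γ.fundamentalDerivative σ) u X A =
      -formAct g (infinitesimal EG ρ) k A (Γ.fundamentalDerivative σ u X) := by
  have h1 := fundamentalDerivative_linear Γ (isSmooth_fundamentalDerivative Γ hσ.1)
    (LinearMap.applyₗ A) u X
  have h2 := fundamentalDerivative_linear Γ hσ.1 (-formAct g (infinitesimal EG ρ) k A) u X
  have h3 : (fun u => LinearMap.applyₗ A (Γ.fundamentalDerivative σ u)) =
      fun u => (-formAct g (infinitesimal EG ρ) k A) (σ u) :=
    funext fun u => fundamentalDerivative_of_mem_filt Γ hP ρ hρ hσ u hA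
  rw [h3, h2] at h1
  exact h1.symm

/-- The curved Casimir operator in terms of the Kostant Laplacian. -/
lemma curvedCasimir_eq (hρ : IsSmooth 𝓘(ℝ, EG) (realAction ρ)) {c₀ : ℝ}
    (hc : ∀ v, casimir (infinitesimal EG ρ) v = c₀ • v)
    (hσ : σ ∈ Γ.sections (formAction hP ρ k)) (u : 𝒢) :
    Γ.curvedCasimir σ u =
      (2 : ℝ) • kostantLaplacian g (infinitesimal EG ρ) k (σ u) + c₀ • σ u -
        (2 : ℝ) • ∑ ℓ, formAct g (infinitesimal EG ρ) k (g.plus (lieBasis 𝔤 ℓ))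
          (Γ.fundamentalDerivative σ u (lieDualBasis 𝔤 ℓ)) := by
  have hplus : ∀ X, g.plus X ∈ g.filt 0 := fun X => g.pPlus_le_filt (g.plus_mem X)
  have hmid : ∀ X, g.mid X ∈ g.filt 0 := fun X => g.comp_zero_le_filt (g.mid_mem X)
  rw [kostantLaplacian_formula g _ (infinitesimal_lie ρ hρ) hc,
    CartanGeometry.curvedCasimir, sum_eq_sum_plus_add_sum_mid_add_sum_plus g]
  -- The brackets [(ξ_ℓ)_+, η^ℓ] add up to the shift. It lies in 𝔤_0, so the derivative in its
  -- direction is again algebraic.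
  have h1 : ∑ ℓ, Γ.fundamentalDerivative (Γ.fundamentalDerivative σ) u
      (g.plus (lieBasis 𝔤 ℓ)) (lieDualBasis 𝔤 ℓ) =
      -formAct g (infinitesimal EG ρ) k g.shift (σ u) -
        ∑ ℓ, formAct g (infinitesimal EG ρ) k (g.plus (lieBasis 𝔤 ℓ))
          (Γ.fundamentalDerivative σ u (lieDualBasis 𝔤 ℓ)) := by
    rw [← fundamentalDerivative_of_mem_filt Γ hP ρ hρ hσ u (g.comp_zero_le_filt (shift_mem g)),
      ParabolicGrading.shift, map_sum, ← Finset.sum_sub_distrib]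
    exact Finset.sum_congr rfl fun ℓ _ =>
      fundamentalDerivative_twice_of_mem_filt_left Γ hP ρ hρ hσ u (hplus _) _
  have h2 : ∑ ℓ, Γ.fundamentalDerivative (Γ.fundamentalDerivative σ) u
      (g.mid (lieBasis 𝔤 ℓ)) (g.mid (lieDualBasis 𝔤 ℓ)) =
      ∑ ℓ, formAct g (infinitesimal EG ρ) k (g.mid (lieBasis 𝔤 ℓ))
        (formAct g (infinitesimal EG ρ) k (g.mid (lieDualBasis 𝔤 ℓ)) (σ u)) := by
    -- Evaluating the second slot first makes the two elements of 𝔤_0 act in reversed order;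
    -- symmetry of the contraction restores it.
    refine Eq.trans (Finset.sum_congr rfl fun ℓ _ => ?_)
      (sum_comp_swap (formAct g (infinitesimal EG ρ) k ∘ₗ g.mid)
        (formAct g (infinitesimal EG ρ) k ∘ₗ g.mid) (σ u)).symm
    rw [fundamentalDerivative_twice_of_mem_filt_right Γ hP ρ hρ hσ u _ (hmid _),
      fundamentalDerivative_of_mem_filt Γ hP ρ hρ hσ u (hmid _), map_neg, neg_neg]
    rfl
  have h3 : ∑ ℓ, Γ.fundamentalDerivative (Γ.fundamentalDerivative σ) u
      (lieDualBasis 𝔤 ℓ) (g.plus (lieBasis 𝔤 ℓ)) =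
      -∑ ℓ, formAct g (infinitesimal EG ρ) k (g.plus (lieBasis 𝔤 ℓ))
          (Γ.fundamentalDerivative σ u (lieDualBasis 𝔤 ℓ)) := by
    rw [← Finset.sum_neg_distrib]
    exact Finset.sum_congr rfl fun ℓ _ =>
      fundamentalDerivative_twice_of_mem_filt_right Γ hP ρ hρ hσ u _ (hplus _)
  rw [h1, h2, h3, two_smul]
  abel

end Main

section Laplacian

variable {𝔤 : Type*} [LieRing 𝔤] [LieAlgebra ℝ 𝔤] [FiniteDimensional ℝ 𝔤]
  [LieAlgebra.IsKilling ℝ 𝔤] {V : Type*} [AddCommGroup V] [Module ℝ V]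
  (g : ParabolicGrading 𝔤) {θ : 𝔤 →ₗ[ℝ] V →ₗ[ℝ] V}

/-- The Kostant Laplacian preserves subspaces that are invariant under `𝔤_0`. -/
lemma kostantLaplacian_mem (hθ : ∀ X Y v, θ ⁅X, Y⁆ v = θ X (θ Y v) - θ Y (θ X v)) {c : ℝ}
    (hc : ∀ v, casimir θ v = c • v) {k : ℕ} {F : Submodule ℝ (Forms g.pPlus V k)}
    (hF : ∀ X ∈ g.comp 0, ∀ w ∈ F, formAct g θ k X w ∈ F) {w : Forms g.pPlus V k} (hw : w ∈ F) :
    kostantLaplacian g θ k w ∈ F := by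
  have h := eq_sub_of_add_eq (kostantLaplacian_formula g θ hθ hc k w)
  rw [← F.smul_mem_iff (two_ne_zero (α := ℝ)), h]
  refine sub_mem (sub_mem (sum_mem fun ℓ _ => ?_) (hF _ (shift_mem g) _ hw)) (F.smul_mem _ hw)
  exact hF _ (g.mid_mem _) _ (hF _ (g.mid_mem _) _ hw)

end Laplacian

end CurvedCasimir

end

/-! ### Proof of the theorem -/

open CurvedCasimir in
theorem lemma4p3
    {EG : Type*} [NormedAddCommGroup EG] [NormedSpace ℝ EG] [FiniteDimensional ℝ EG]
    [CompleteSpace EG]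
    {G : Type*} [TopologicalSpace G] [ChartedSpace EG G] [Group G] [LieGroup 𝓘(ℝ, EG) ∞ G]
    [LieAlgebra.IsSemisimple ℝ (GroupLieAlgebra 𝓘(ℝ, EG) G)]
    {EP : Type*} [NormedAddCommGroup EP] [NormedSpace ℝ EP]
    {P : Subgroup G} [ChartedSpace EP P] [LieGroup 𝓘(ℝ, EP) ∞ P]
    {g : ParabolicGrading (GroupLieAlgebra 𝓘(ℝ, EG) G)}
    (hP : IsParabolicSubgroup EP P g)
    {EB : Type*} [NormedAddCommGroup EB] [NormedSpace ℝ EB]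
    {𝒢 : Type*} [TopologicalSpace 𝒢] [ChartedSpace EB 𝒢] [IsManifold 𝓘(ℝ, EB) ∞ 𝒢]
    {EM : Type*} [NormedAddCommGroup EM] [NormedSpace ℝ EM]
    {M : Type*} [TopologicalSpace M] [ChartedSpace EM M] [IsManifold 𝓘(ℝ, EM) ∞ M]
    (Γ : CartanGeometry EG EP P EB 𝒢 EM M)
    {𝕜 : Type*} [RCLike 𝕜] {V : Type*} [AddCommGroup V] [Module ℝ V] [Module 𝕜 V]
    [IsScalarTower ℝ 𝕜 V] [FiniteDimensional ℝ V]
    (ρ : Representation 𝕜 G V) (hρ : IsSmooth 𝓘(ℝ, EG) (realAction ρ)) [ρ.IsIrreducible]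
    (c₀ : ℝ) (hc₀ : (casimir (infinitesimal EG ρ)).HasEigenvalue c₀) (k : ℕ) (a : ℝ) :
    -- the curved Casimir operator preserves the sections of the filtration components
    (∀ σ ∈ formSections Γ hP ρ k (formFiltration g (infinitesimal EG ρ) k a),
      Γ.curvedCasimir σ ∈ formSections Γ hP ρ k (formFiltration g (infinitesimal EG ρ) k a)) ∧
    (∀ σ ∈ formSections Γ hP ρ k (formFiltrationNext g (infinitesimal EG ρ) k a),
      Γ.curvedCasimir σ ∈
        formSections Γ hP ρ k (formFiltrationNext g (infinitesimal EG ρ) k a)) ∧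
    -- the Kostant Laplacian induces a map on the associated graded
    (∀ w ∈ formFiltration g (infinitesimal EG ρ) k a,
      kostantLaplacian g (infinitesimal EG ρ) k w ∈
        formFiltration g (infinitesimal EG ρ) k a) ∧
    (∀ w ∈ formFiltrationNext g (infinitesimal EG ρ) k a,
      kostantLaplacian g (infinitesimal EG ρ) k w ∈
        formFiltrationNext g (infinitesimal EG ρ) k a) ∧
    -- on the associated graded the curved Casimir operator is `2 □ + c₀`
    (∀ σ ∈ formSections Γ hP ρ k (formFiltration g (infinitesimal EG ρ) k a), ∀ u : 𝒢,
      Γ.curvedCasimir σ u -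
          ((2 : ℝ) • kostantLaplacian g (infinitesimal EG ρ) k (σ u) + c₀ • σ u) ∈
        formFiltrationNext g (infinitesimal EG ρ) k a) := by
  set θ := infinitesimal EG ρ with hθdef
  have hθ : ∀ X Y v, θ ⁅X, Y⁆ v = θ X (θ Y v) - θ Y (θ X v) := infinitesimal_lie ρ hρ
  have hc : ∀ v, casimir θ v = c₀ • v := casimir_eq_smul ρ hρ hc₀
  have hL : ∀ w ∈ formFiltration g θ k a, kostantLaplacian g θ k w ∈ formFiltration g θ k a :=
    fun w hw => kostantLaplacian_mem g hθ hc
      (fun X hX w hw => formAct_mem_formFiltration g θ hθ k a hX hw) hw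
  have hL' : ∀ w ∈ formFiltrationNext g θ k a,
      kostantLaplacian g θ k w ∈ formFiltrationNext g θ k a :=
    fun w hw => kostantLaplacian_mem g hθ hc
      (fun X hX w hw => formAct_mem_formFiltrationNext g θ hθ k a hX hw) hw
  have hmain : ∀ σ ∈ formSections Γ hP ρ k (formFiltration g θ k a), ∀ u : 𝒢,
      Γ.curvedCasimir σ u - ((2 : ℝ) • kostantLaplacian g θ k (σ u) + c₀ • σ u) ∈
        formFiltrationNext g θ k a := by
    intro σ hσ u
    rw [curvedCasimir_eq Γ hP ρ hρ hc hσ.1 u, sub_sub_cancel_left]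
    exact neg_mem (Submodule.smul_mem _ _ (sum_mem fun ℓ _ =>
      formAct_pPlus_mem_formFiltrationNext g θ hθ k a (g.plus_mem _)
        (fundamentalDerivative_mem Γ hσ.1.1 hσ.2 u _)))
  refine ⟨fun σ hσ => ⟨curvedCasimir_mem_sections Γ hσ.1, fun u => ?_⟩,
    fun σ hσ => ⟨curvedCasimir_mem_sections Γ hσ.1, fun u => ?_⟩, hL, hL', hmain⟩
  · have h := add_mem (formFiltrationNext_le g θ k a (hmain σ hσ u))
      (add_mem (Submodule.smul_mem _ (2 : ℝ) (hL _ (hσ.2 u))) (Submodule.smul_mem _ c₀ (hσ.2 u)))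
    rwa [sub_add_cancel] at h
  -- A section of F^{>a} is one of F^{≥a}, so the error term is already in F^{>a}; the remaining
  -- terms are there because □ preserves F^{>a}.
  · have h := add_mem (hmain σ ⟨hσ.1, fun u => formFiltrationNext_le g θ k a (hσ.2 u)⟩ u)
      (add_mem (Submodule.smul_mem _ (2 : ℝ) (hL' _ (hσ.2 u))) (Submodule.smul_mem _ c₀ (hσ.2 u)))
    rwa [sub_add_cancel] at h
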